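/- Let $\eta>0$ and $s>-\tfrac12$ be fixed. For $\beta\ge 0$ consider on the real line the Cauchy problem $$u_t+uu_x+\beta\,\mathcal H u_{xx}+\eta\,(\mathcal H u_x-u_{xx})=0,\qquad u(x,0)=\phi(x),\qquad \phi\in H^s(\mathbb R),$$ where $\mathcal H$ is the Hilbert transform, i.e. the Fourier multiplier with symbol $i\,\mathrm{sgn}(\xi)$ (for $\beta>0$ this is the Chen--Lee equation, for $\beta=0$ its non-dispersive version). Let $S_\beta(t)$, $t\ge0$, be the Fourier multiplier with symbol $e^{(i\beta\xi|\xi|-\eta(\xi^2-|\xi|))t}$. For $T>0$ let $\mathfrak X_T^s=C([0,T];H^s(\mathbb R))$ if $s\ge 0$ and, if $s<0$, $$\mathfrak X_T^s=\Bigl\{u\in C([0,T];H^s(\mathbb R)) : \sup_{0<t\le T} t^{|s|/2}\|u(t)\|_{L^2}<\infty\Bigr\}.$$ A solution on $[0,T]$ with datum $\phi$ is a function $u\in\mathfrak X_T^s$ with $$u(t)=S_\beta(t)\phi-\int_0^t S_\beta(t-t')\,\tfrac12\partial_x\bigl(u(t')^2\bigr)\,dt'\qquad\text{for all } t\in[0,T],$$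 where the integral converges as a Bochner integral in $H^s(\mathbb R)$. Then: 1. For every $R$ there is $T>0$, depending only on $\eta$, $s$ and $R$ (in particular not on $\beta$), such that for every $\phi\in H^s(\mathbb R)$ with $\|\phi\|_{H^s}\le R$ and every $\beta\ge0$ there is a solution on $[0,T]$ with datum $\phi$. 2. For every $T>0$, $\beta\ge0$ and $\phi\in H^s(\mathbb R)$ there is at most one solution on $[0,T]$ with datum $\phi$. 3. Let $T>0$ and $\phi\in H^s(\mathbb R)$, and suppose that for every $\beta\ge0$ there is a solution $u^\beta$ on $[0,T]$ with datum $\phi$. Then $$\lim_{\beta\to0^+}\ \sup_{t\in[0,T]}\|u^\beta(t)-u^0(t)\|_{H^s}=0 .$$ -/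

import Mathlib

open MeasureTheory Set Filter Topology
open scoped SchwartzMap FourierTransform LineDeriv ENNReal

noncomputable section

namespace ChenLee

/-! ### The Bessel potential and the Sobolev spaces `H^s(ℝ)`

The Fourier transform of Mathlib is `𝓕 f ξ = ∫ e^{-2πixξ} f(x) dx`; the variable `ξ` of the
convention `∫ e^{-ixξ} f(x) dx` is therefore `2πξ` below. -/

/-- The operator `(1 - ∂ₓ²)^{s/2}` on tempered distributions. -/
def bessel (s : ℝ) : 𝓢'(ℝ, ℂ) →L[ℂ] 𝓢'(ℝ, ℂ) :=
  TemperedDistribution.fourierMultiplierCLM ℂ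
    (fun ξ : ℝ ↦ (((1 + (2 * Real.pi * ξ) ^ 2) ^ (s / 2) : ℝ) : ℂ))

theorem bessel_growth (s : ℝ) :
    (fun ξ : ℝ ↦ (((1 + (2 * Real.pi * ξ) ^ 2) ^ (s / 2) : ℝ) : ℂ)).HasTemperateGrowth := by
  have h := (Function.hasTemperateGrowth_one_add_norm_sq_rpow ℝ (s / 2)).comp
    (show (fun ξ : ℝ ↦ 2 * Real.pi * ξ).HasTemperateGrowth by fun_prop)
  simp only [Function.comp_def, Real.norm_eq_abs, sq_abs] at h
  fun_prop

theorem bessel_bessel (s r : ℝ) (F : 𝓢'(ℝ, ℂ)) : bessel r (bessel s F) = bessel (s + r) F := by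
  unfold bessel
  rw [TemperedDistribution.fourierMultiplierCLM_fourierMultiplierCLM_apply
    (bessel_growth s) (bessel_growth r)]
  congr
  ext ξ
  simp only [Pi.mul_apply]
  norm_cast
  rw [← Real.rpow_add (by positivity)]
  congr 1
  ring

theorem bessel_zero (F : 𝓢'(ℝ, ℂ)) : bessel 0 F = F := by
  simp [bessel]

theorem ratio_bound {a b c : ℝ} (ha : 0 < a) (hb : 0 < b) (hc : 1 ≤ c) (hab : a ≤ c * b)
    (hba : b ≤ c * a) (r : ℝ) : a ^ r * b ^ (-r) ≤ c ^ |r| := by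
  have hc0 : 0 < c := by linarith
  rw [Real.rpow_neg hb.le, ← div_eq_mul_inv, ← Real.div_rpow ha.le hb.le]
  rcases le_total 0 r with hr | hr
  · rw [abs_of_nonneg hr]
    exact Real.rpow_le_rpow (by positivity) ((div_le_iff₀ hb).2 hab) hr
  · rw [abs_of_nonpos hr, ← neg_neg r, Real.rpow_neg (by positivity), ← Real.inv_rpow (by positivity),
      inv_div, neg_neg]
    exact Real.rpow_le_rpow (by positivity) ((div_le_iff₀ ha).2 hba) (by linarith)

/-- Membership in Mathlib's Sobolev space of order `s` means that `(1 - ∂ₓ²)^{s/2} F` is in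
`L²`. -/
theorem memSobolev_iff (s : ℝ) (F : 𝓢'(ℝ, ℂ)) :
    TemperedDistribution.MemSobolev s 2 F ↔
      ∃ g : Lp ℂ 2 (volume : Measure ℝ), bessel s F = g := by
  have hpi : (1 : ℝ) ≤ (2 * Real.pi) ^ 2 := by nlinarith [Real.pi_gt_three]
  have h1 : ∀ ξ : ℝ, 1 + (2 * Real.pi * ξ) ^ 2 ≤ (2 * Real.pi) ^ 2 * (1 + ‖ξ‖ ^ 2) := by
    intro ξ
    rw [Real.norm_eq_abs, sq_abs]
    nlinarith
  have h2 : ∀ ξ : ℝ, 1 + ‖ξ‖ ^ 2 ≤ (2 * Real.pi) ^ 2 * (1 + (2 * Real.pi * ξ) ^ 2) := by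
    intro ξ
    rw [Real.norm_eq_abs, sq_abs]
    nlinarith [sq_nonneg ξ, mul_nonneg (sub_nonneg.2 hpi) (sq_nonneg ξ),
      mul_nonneg (sub_nonneg.2 hpi) (sq_nonneg (2 * Real.pi * ξ))]
  have hg : ∀ r : ℝ, (fun x : ℝ ↦ (((1 + ‖x‖ ^ 2) ^ (r / 2) : ℝ) : ℂ)).HasTemperateGrowth := by
    intro r
    fun_prop
  rw [← TemperedDistribution.memSobolev_zero_iff]
  constructor
  · intro h
    have h0 : TemperedDistribution.MemSobolev 0 2
        (TemperedDistribution.besselPotential ℝ ℂ s F) := by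
      simpa using h
    have h3 := h0.fourierMultiplierCLM_of_bounded ((bessel_growth s).mul (hg (-s)))
      ⟨((2 * Real.pi) ^ 2) ^ |s / 2|, by
        intro ξ
        have := ratio_bound (by positivity) (by positivity) hpi (h1 ξ) (h2 ξ) (s / 2)
        rw [Pi.mul_apply, ← Complex.ofReal_mul, Complex.norm_real, Real.norm_eq_abs,
          abs_of_nonneg (by positivity), neg_div]
        exact this⟩
    rw [mul_comm, ← TemperedDistribution.fourierMultiplierCLM_fourierMultiplierCLM_apply
      (hg (-s)) (bessel_growth s)] at h3
    have h4 : TemperedDistribution.besselPotential ℝ ℂ (-s)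
        (TemperedDistribution.besselPotential ℝ ℂ s F) = F := by simp
    unfold TemperedDistribution.besselPotential at h3 h4
    rw [h4] at h3
    exact h3
  · intro h
    have h3 := h.fourierMultiplierCLM_of_bounded ((hg s).mul (bessel_growth (-s)))
      ⟨((2 * Real.pi) ^ 2) ^ |s / 2|, by
        intro ξ
        have := ratio_bound (by positivity) (by positivity) hpi (h2 ξ) (h1 ξ) (s / 2)
        rw [Pi.mul_apply, ← Complex.ofReal_mul, Complex.norm_real, Real.norm_eq_abs,
          abs_of_nonneg (by positivity), neg_div]
        exact this⟩
    rw [mul_comm, ← TemperedDistribution.fourierMultiplierCLM_fourierMultiplierCLM_apply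
      (bessel_growth (-s)) (hg s)] at h3
    have h4 : bessel (-s) (bessel s F) = F := by simp [bessel_bessel, bessel_zero]
    unfold bessel at h3 h4
    rw [h4] at h3
    have h5 : TemperedDistribution.MemSobolev 0 2
        (TemperedDistribution.besselPotential ℝ ℂ s F) := h3
    simpa using h5

/-- The Sobolev space `H^s(ℝ)` as a subspace of the tempered distributions. -/
def HsSubmodule (s : ℝ) : Submodule ℂ 𝓢'(ℝ, ℂ) where
  carrier := {F | TemperedDistribution.MemSobolev s 2 F}
  add_mem' := fun hF hG ↦ hF.add hG
  zero_mem' := TemperedDistribution.memSobolev_fun_zero ℝ ℂ s 2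
  smul_mem' := fun c _ hF ↦ hF.smul c

/-- The Sobolev space `H^s(ℝ)`, as a type of its own that carries the Sobolev norm. -/
def Hs (s : ℝ) : Type := HsSubmodule s

instance (s : ℝ) : AddCommGroup (Hs s) := inferInstanceAs (AddCommGroup (HsSubmodule s))

instance (s : ℝ) : Module ℂ (Hs s) := inferInstanceAs (Module ℂ (HsSubmodule s))

/-- The tempered distribution underlying an element of `H^s(ℝ)`. -/
def Hs.toDist (s : ℝ) : Hs s →ₗ[ℂ] 𝓢'(ℝ, ℂ) := (HsSubmodule s).subtype

theorem Hs.memSobolev {s : ℝ} (f : Hs s) :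
    TemperedDistribution.MemSobolev s 2 (Hs.toDist s f) := f.2

/-- A tempered distribution in Mathlib's Sobolev space of order `s`, as an element of `H^s(ℝ)`. -/
def Hs.mk {s : ℝ} (F : 𝓢'(ℝ, ℂ)) (h : TemperedDistribution.MemSobolev s 2 F) : Hs s :=
  (⟨F, h⟩ : HsSubmodule s)

theorem Hs.toDist_mk {s : ℝ} (F : 𝓢'(ℝ, ℂ)) (h : TemperedDistribution.MemSobolev s 2 F) :
    Hs.toDist s (Hs.mk F h) = F := rfl

theorem Hs.toDist_injective (s : ℝ) : Function.Injective (Hs.toDist s) :=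
  Subtype.val_injective

theorem lp_injective {g h : Lp ℂ 2 (volume : Measure ℝ)}
    (H : (g : 𝓢'(ℝ, ℂ)) = (h : 𝓢'(ℝ, ℂ))) : g = h :=
  LinearMap.ker_eq_bot.1
    (Lp.ker_toTemperedDistributionCLM_eq_bot (F := ℂ) (μ := (volume : Measure ℝ)) (p := 2)) H

/-- The `L²` function `(1 - ∂ₓ²)^{s/2} f`, for `f ∈ H^s(ℝ)`. -/
def Hs.besselLp {s : ℝ} (f : Hs s) : Lp ℂ 2 (volume : Measure ℝ) :=
  ((memSobolev_iff s (Hs.toDist s f)).1 f.memSobolev).choose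

theorem Hs.besselLp_spec {s : ℝ} (f : Hs s) :
    bessel s (Hs.toDist s f) = (f.besselLp : 𝓢'(ℝ, ℂ)) :=
  ((memSobolev_iff s (Hs.toDist s f)).1 f.memSobolev).choose_spec

/-- `f ↦ (1 - ∂ₓ²)^{s/2} f` as a linear isomorphism from `H^s(ℝ)` onto `L²(ℝ)`. -/
def Hs.besselEquiv (s : ℝ) : Hs s ≃ₗ[ℂ] Lp ℂ 2 (volume : Measure ℝ) where
  toFun := Hs.besselLp
  map_add' f g := by
    apply lp_injective
    rw [← Hs.besselLp_spec, map_add, map_add, Hs.besselLp_spec, Hs.besselLp_spec]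
    exact ((Lp.toTemperedDistributionCLM ℂ (volume : Measure ℝ) 2).map_add _ _).symm
  map_smul' c f := by
    apply lp_injective
    rw [← Hs.besselLp_spec, map_smul, map_smul, Hs.besselLp_spec]
    exact ((Lp.toTemperedDistributionCLM ℂ (volume : Measure ℝ) 2).map_smul _ _).symm
  invFun g := Hs.mk (bessel (-s) (g : 𝓢'(ℝ, ℂ)))
    ((memSobolev_iff s _).2 ⟨g, by rw [bessel_bessel, neg_add_cancel, bessel_zero]⟩)
  left_inv f := by
    apply Hs.toDist_injective
    rw [Hs.toDist_mk, ← Hs.besselLp_spec, bessel_bessel, add_neg_cancel, bessel_zero]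
  right_inv g := by
    apply lp_injective
    rw [← Hs.besselLp_spec, Hs.toDist_mk, bessel_bessel, neg_add_cancel, bessel_zero]

/-- The norm of `H^s(ℝ)` is `‖f‖_{H^s} = ‖(1 - ∂ₓ²)^{s/2} f‖_{L²}`. -/
instance (s : ℝ) : NormedAddCommGroup (Hs s) :=
  NormedAddCommGroup.induced (Hs s) (Lp ℂ 2 (volume : Measure ℝ))
    (Hs.besselEquiv s).toLinearMap (Hs.besselEquiv s).injective

theorem Hs.norm_def {s : ℝ} (f : Hs s) : ‖f‖ = ‖f.besselLp‖ := rfl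

instance (s : ℝ) : NormedSpace ℂ (Hs s) where
  norm_smul_le c f := by
    have h : (c • f).besselLp = c • f.besselLp := (Hs.besselEquiv s).map_smul c f
    rw [Hs.norm_def, Hs.norm_def, h, norm_smul]

/-- `(1 - ∂ₓ²)^{s/2}` is an isometry from `H^s(ℝ)` onto `L²(ℝ)`. -/
def Hs.besselIsometry (s : ℝ) : Hs s ≃ₗᵢ[ℂ] Lp ℂ 2 (volume : Measure ℝ) where
  toLinearEquiv := Hs.besselEquiv s
  norm_map' _ := rfl

instance (s : ℝ) : CompleteSpace (Hs s) :=
  (completeSpace_congr (e := (Hs.besselEquiv s).toEquiv)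
    (Hs.besselIsometry s).isometry.isUniformEmbedding).2 inferInstance

open Classical in
/-- A tempered distribution as an element of `H^s(ℝ)` (and `0` if it does not belong to it). -/
def toHs (s : ℝ) (F : 𝓢'(ℝ, ℂ)) : Hs s :=
  if h : TemperedDistribution.MemSobolev s 2 F then Hs.mk F h else 0

theorem toHs_toDist {s : ℝ} (f : Hs s) : toHs s (Hs.toDist s f) = f := by
  rw [toHs, dif_pos f.memSobolev]
  rfl

/-! ### Functions as tempered distributions -/

/-- The tempered distribution `F` is given by the function `g`. -/
def Represents (g : ℝ → ℂ) (F : 𝓢'(ℝ, ℂ)) : Prop :=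
  ∀ ψ : 𝓢(ℝ, ℂ), Integrable (fun x ↦ ψ x * g x) ∧ F ψ = ∫ x, ψ x * g x

open Classical in
/-- The function, unique almost everywhere, that a tempered distribution is given by
(and `0` if there is none). -/
def funOf (F : 𝓢'(ℝ, ℂ)) : ℝ → ℂ :=
  if h : ∃ g, Represents g F then h.choose else 0

open Classical in
/-- The tempered distribution given by a function (and `0` if there is none). -/
def distOf (g : ℝ → ℂ) : 𝓢'(ℝ, ℂ) :=
  if h : ∃ F, Represents g F then h.choose else 0

theorem distOf_eq {g : ℝ → ℂ} {F : 𝓢'(ℝ, ℂ)} (h : Represents g F) : distOf g = F := by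
  have h' : ∃ F, Represents g F := ⟨F, h⟩
  rw [distOf, dif_pos h']
  ext ψ
  rw [(h'.choose_spec ψ).2, (h ψ).2]

theorem represents_locallyIntegrable {g : ℝ → ℂ} {F : 𝓢'(ℝ, ℂ)} (h : Represents g F) :
    LocallyIntegrable g := by
  rw [locallyIntegrable_iff]
  intro K hK
  obtain ⟨R, hR⟩ := hK.isBounded.subset_ball (0 : ℝ)
  let b : ContDiffBump (0 : ℝ) := ⟨|R| + 1, |R| + 2, by positivity, by linarith⟩
  have hg₁ : HasCompactSupport (Complex.ofRealCLM ∘ b) := b.hasCompactSupport.comp_left rfl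
  have hg₂ : ContDiff ℝ ((⊤ : ℕ∞) : WithTop ℕ∞) (Complex.ofRealCLM ∘ b) :=
    Complex.ofRealCLM.contDiff.comp b.contDiff
  have h1 := ((h (hg₁.toSchwartzMap hg₂)).1).integrableOn (s := K)
  refine h1.congr_fun (fun x hx ↦ ?_) hK.measurableSet
  have hx' : x ∈ Metric.closedBall (0 : ℝ) (|R| + 1) := by
    have := hR hx
    rw [Metric.mem_ball] at this
    rw [Metric.mem_closedBall]
    linarith [le_abs_self R]
  have h2 : b x = 1 := b.one_of_mem_closedBall hx'
  simp [h2]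

theorem funOf_ae_eq {g : ℝ → ℂ} {F : 𝓢'(ℝ, ℂ)} (h : Represents g F) : funOf F =ᵐ[volume] g := by
  have h' : ∃ g, Represents g F := ⟨g, h⟩
  rw [funOf, dif_pos h']
  have hk := h'.choose_spec
  apply ae_eq_of_integral_contDiff_smul_eq (represents_locallyIntegrable hk)
    (represents_locallyIntegrable h)
  intro θ hθ hθc
  have hg₁ : HasCompactSupport (Complex.ofRealCLM ∘ θ) := hθc.comp_left rfl
  have hg₂ : ContDiff ℝ ((⊤ : ℕ∞) : WithTop ℕ∞) (Complex.ofRealCLM ∘ θ) :=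
    Complex.ofRealCLM.contDiff.comp hθ
  have e1 := (hk (hg₁.toSchwartzMap hg₂)).2
  have e2 := (h (hg₁.toSchwartzMap hg₂)).2
  simpa [e1] using e2

/-! ### The Chen–Lee equation
`u_t + u u_x + β H u_xx + η (H u_x - u_xx) = 0`, where the Hilbert transform `H` is the Fourier
multiplier `i sgn ξ` -/

/-- The symbol `exp (i q(ζ) t - p(ζ) t)`, with `ζ = 2πξ`, `q(ζ) = β ζ |ζ|` and
`p(ζ) = η (ζ² - |ζ|)`. -/
def symbol (β η t ξ : ℝ) : ℂ :=
  Complex.exp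
    ((Complex.I * ((β * (2 * Real.pi * ξ) * |2 * Real.pi * ξ| : ℝ) : ℂ) -
      ((η * ((2 * Real.pi * ξ) ^ 2 - |2 * Real.pi * ξ|) : ℝ) : ℂ)) * (t : ℂ))

/-- The semigroup `S(t)` generated by `-(β H ∂ₓ² + η (H ∂ₓ - ∂ₓ²))`: the Fourier transform of
`S(t) F` is `exp (i q t - p t)` times that of `F`. -/
def semigroup (β η t : ℝ) (F : 𝓢'(ℝ, ℂ)) : 𝓢'(ℝ, ℂ) :=
  𝓕⁻ (distOf (fun ξ ↦ symbol β η t ξ * funOf (𝓕 F) ξ))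

/-- The nonlinearity `u u_x = ½ ∂ₓ (u²)`, for `u` a function. -/
def nonlin (F : 𝓢'(ℝ, ℂ)) : 𝓢'(ℝ, ℂ) :=
  (1 / 2 : ℂ) • ∂_{(1 : ℝ)} (distOf (fun x ↦ funOf F x ^ 2))

/-- The space `𝔛_T^s`: all `u ∈ C([0,T]; H^s(ℝ))`, with the additional condition
`sup_{0 < t ≤ T} t^{|s|/2} ‖u(t)‖_{L²} < ∞` when `s < 0`. -/
def SolSpace (s T : ℝ) (u : ℝ → Hs s) : Prop :=
  ContinuousOn u (Icc 0 T) ∧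
    (s < 0 → ∃ M : ℝ, ∀ t ∈ Ioc 0 T, ∃ w : Lp ℂ 2 (volume : Measure ℝ),
      Hs.toDist s (u t) = (w : 𝓢'(ℝ, ℂ)) ∧ t ^ (|s| / 2) * ‖w‖ ≤ M)

/-- `u ∈ 𝔛_T^s` solves the Cauchy problem with datum `φ` on `[0,T]`, that is
`u(t) = S(t) φ - ∫₀ᵗ S(t - t') [u(t') u_x(t')] dt'` for all `t ∈ [0,T]`, the integral being a
Bochner integral in `H^s(ℝ)`. -/
def IsSolution (β η s T : ℝ) (φ : Hs s) (u : ℝ → Hs s) : Prop :=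
  SolSpace s T u ∧
    ∀ t ∈ Icc 0 T,
      IntervalIntegrable
        (fun t' ↦ toHs s (semigroup β η (t - t') (nonlin (Hs.toDist s (u t'))))) volume 0 t ∧
      u t = toHs s (semigroup β η t (Hs.toDist s φ)) -
        ∫ t' in (0 : ℝ)..t, toHs s (semigroup β η (t - t') (nonlin (Hs.toDist s (u t'))))

end ChenLee

end

/-!
On the Fourier side, `f ↦ ⟨ζ⟩^s 𝓕 f` (`freq`) identifies `H^s(ℝ)` with `L²(ℝ)` and turns the
semigroup into multiplication by `symbol`. Put `σ = max s 0` and `a = (σ - s) / 2`, so that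
`0 ≤ a < 1/4`. A solution takes its values in `H^σ` for `t > 0`, with a norm of size `t^{-a}`. This
is the defining condition of the solution space for `s < 0` and is continuity for `s ≥ 0`. A
*mild solution* (`IsMild`) records the `L²` function `U t` that corresponds to `H^s` together with
the weighted one `V t` that corresponds to `H^σ`; it is the same thing as a solution
(`IsSolution.exists_isMild`, `IsMild.exists_isSolution`).

The analysis rests on a single bilinear estimate (`norm_duhamel_le`). For `u, v ∈ H^σ`, `σ ≥ 0`,
the function `⟨ζ⟩^σ 𝓕 (u v)` is bounded by a multiple of `‖u‖ ‖v‖`, by Cauchy–Schwarz and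
Peetre's inequality `⟨ζ⟩^σ ≤ 2^{σ/2} ⟨ζ - ζ'⟩^σ ⟨ζ'⟩^σ`. The derivative, the semigroup and the weight
`⟨ζ⟩^{-2θ}` contribute the `L²` function `ker`, whose norm is at most a multiple of `τ^{-3/4+θ}` by
the parabolic decay `|symbol| ≤ e^{ηt} e^{-ηζ²t/2}`. Here `θ = a` when the result is measured in
`H^s` and `θ = 0` when it is measured in `H^σ`. Dispersion only affects the phase of the symbol,
so the constants do not depend on `β`.

*Existence.* As `2a < 1` and `a < 1/4`, the integrals `∫₀ᵗ (t - t')^{-3/4} t'^{-2a} dt'` converge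
and, multiplied by `t^a`, carry the positive power `t^{1/4 - a}`. Hence the Duhamel map is a
contraction in the space of curves with `sup t^a ‖V t‖ < ∞` on an interval whose length depends on
`‖φ‖`, `η` and `s` only (`exists_duhamel_fixedPoint`, `exists_isSolution`).

*Uniqueness and the limit.* Both follow from one stability estimate
(`IsSolution.exists_stability_const`). The weighted difference `f t = t^a ‖V t - V' t‖` of two mild
solutions for `β` and `β'` satisfies a singular integral inequality whose error terms are
`|β - β'|` and `freeGap`, the effect of `β - β'` on the free evolution of the datum. The
difference of the integrals is an integral in `H^s` only; that it is controlled in the stronger norm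
of `H^σ` follows by pairing with test vectors (`norm_le_of_mulOp_wt_eq_integral`). The inequality
is quadratic in `f`, and `f` need not be small or even measurable. `singular_gronwall` therefore
propagates `f t ≤ ρ e^{lt}` in short steps: on a new step the rough bound of `f` suffices, the
step being short, and this returns the good bound. For `β = β'` the error vanishes and `f = 0`. For
`β' = 0` and `β → 0` it tends to zero by dominated convergence, which gives the uniform limit.
-/

noncomputable section

namespace ChenLee

/-! ### Weights, multipliers on `L²` and distributions given by functions -/

/-- The weight `⟨ζ⟩^r = (1 + ζ²)^{r/2}` at `ζ = 2πξ`. -/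
def wt (r ξ : ℝ) : ℝ := (1 + (2 * Real.pi * ξ) ^ 2) ^ (r / 2)

theorem wt_pos (r ξ : ℝ) : 0 < wt r ξ := by unfold wt; positivity

theorem wt_add (r q ξ : ℝ) : wt (r + q) ξ = wt r ξ * wt q ξ := by
  unfold wt
  rw [← Real.rpow_add (by positivity)]
  congr 1
  ring

theorem wt_zero (ξ : ℝ) : wt 0 ξ = 1 := by simp [wt]

theorem wt_neg_mul (r ξ : ℝ) : wt (-r) ξ * wt r ξ = 1 := by
  rw [← wt_add, neg_add_cancel, wt_zero]

theorem wt_mul_neg (r ξ : ℝ) : wt r ξ * wt (-r) ξ = 1 := by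
  rw [← wt_add, add_neg_cancel, wt_zero]

theorem wt_le_one {r : ℝ} (hr : r ≤ 0) (ξ : ℝ) : wt r ξ ≤ 1 :=
  Real.rpow_le_one_of_one_le_of_nonpos (by nlinarith [sq_nonneg (2 * Real.pi * ξ)]) (by linarith)

@[fun_prop]
theorem continuous_wt (r : ℝ) : Continuous (wt r) := by
  unfold wt
  refine Continuous.rpow_const (by fun_prop) fun ξ ↦ Or.inl ?_
  positivity

theorem wt_growth (r : ℝ) : (fun ξ : ℝ ↦ ((wt r ξ : ℝ) : ℂ)).HasTemperateGrowth :=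
  bessel_growth r

/-- The pointwise product of an `L²` function with an `L^∞` function, as a continuous bilinear
map. -/
def mulTop : Lp ℂ 2 (volume : Measure ℝ) →L[ℂ] Lp ℂ ⊤ (volume : Measure ℝ) →L[ℂ]
    Lp ℂ 2 (volume : Measure ℝ) :=
  (ContinuousLinearMap.mul ℂ ℂ).holderL volume 2 ⊤ 2

theorem mulTop_coe (k : Lp ℂ 2 (volume : Measure ℝ)) (q : Lp ℂ ⊤ (volume : Measure ℝ)) :
    mulTop k q =ᵐ[volume] fun ξ ↦ k ξ * q ξ := by
  unfold mulTop
  rw [ContinuousLinearMap.holderL_apply_apply]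
  exact ContinuousLinearMap.coeFn_holder _ _ _

theorem norm_mulTop_le (k : Lp ℂ 2 (volume : Measure ℝ)) (q : Lp ℂ ⊤ (volume : Measure ℝ)) :
    ‖mulTop k q‖ ≤ ‖k‖ * ‖q‖ := by
  unfold mulTop
  rw [ContinuousLinearMap.holderL_apply_apply]
  refine (ContinuousLinearMap.norm_holder_apply_apply_le _ _ _).trans ?_
  have := ContinuousLinearMap.opNorm_mul_le ℂ ℂ
  rw [mul_assoc]
  exact mul_le_of_le_one_left (by positivity) this

theorem norm_toLp_top_le {m : ℝ → ℂ} (hm : MemLp m ⊤ volume) {C : ℝ} (hC0 : 0 ≤ C)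
    (hC : ∀ ξ, ‖m ξ‖ ≤ C) : ‖hm.toLp m‖ ≤ C := by
  rw [Lp.norm_toLp]
  refine ENNReal.toReal_le_of_le_ofReal hC0 ?_
  rw [eLpNorm_exponent_top]
  exact eLpNormEssSup_le_of_ae_bound (Eventually.of_forall hC)

open Classical in
/-- Multiplication by the bounded measurable function `m` on `L²` (and `0` if `m` is not
essentially bounded). -/
def mulOp (m : ℝ → ℂ) : Lp ℂ 2 (volume : Measure ℝ) →L[ℂ] Lp ℂ 2 (volume : Measure ℝ) :=
  if h : MemLp m ⊤ volume then mulTop.flip (h.toLp m) else 0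

theorem memLp_top_of_norm_le {m : ℝ → ℂ} {C : ℝ} (hm : Measurable m) (hC : ∀ ξ, ‖m ξ‖ ≤ C) :
    MemLp m ⊤ volume :=
  memLp_top_of_bound hm.aestronglyMeasurable C (Eventually.of_forall hC)

theorem mulOp_coe {m : ℝ → ℂ} (h : MemLp m ⊤ volume) (U : Lp ℂ 2 (volume : Measure ℝ)) :
    mulOp m U =ᵐ[volume] fun ξ ↦ m ξ * U ξ := by
  rw [mulOp, dif_pos h, ContinuousLinearMap.flip_apply]
  filter_upwards [mulTop_coe U (h.toLp m), h.coeFn_toLp] with ξ h1 h2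
  rw [h1, h2, mul_comm]

theorem norm_mulOp_le {m : ℝ → ℂ} {C : ℝ} (hm : Measurable m) (hC0 : 0 ≤ C)
    (hC : ∀ ξ, ‖m ξ‖ ≤ C) (U : Lp ℂ 2 (volume : Measure ℝ)) : ‖mulOp m U‖ ≤ C * ‖U‖ := by
  have h := memLp_top_of_norm_le hm hC
  rw [mulOp, dif_pos h, ContinuousLinearMap.flip_apply, mul_comm]
  exact (norm_mulTop_le _ _).trans
    (mul_le_mul_of_nonneg_left (norm_toLp_top_le h hC0 hC) (norm_nonneg _))

/-- A pointwise bound of multipliers gives a bound of the operators. -/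
theorem norm_mulOp_le_mulOp {m n : ℝ → ℂ} (hm : MemLp m ⊤ volume) (hn : MemLp n ⊤ volume)
    {C : ℝ} (hC : ∀ ξ, ‖m ξ‖ ≤ C * ‖n ξ‖)
    (U : Lp ℂ 2 (volume : Measure ℝ)) : ‖mulOp m U‖ ≤ C * ‖mulOp n U‖ := by
  refine Lp.norm_le_mul_norm_of_ae_le_mul ?_
  filter_upwards [mulOp_coe hm U, mulOp_coe hn U] with ξ h1 h2
  rw [h1, h2, norm_mul, norm_mul, ← mul_assoc]
  exact mul_le_mul_of_nonneg_right (hC ξ) (norm_nonneg _)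

theorem mulOp_mulOp {m n : ℝ → ℂ} (hm : MemLp m ⊤ volume) (hn : MemLp n ⊤ volume)
    (hmn : MemLp (fun ξ ↦ m ξ * n ξ) ⊤ volume) (U : Lp ℂ 2 (volume : Measure ℝ)) :
    mulOp m (mulOp n U) = mulOp (fun ξ ↦ m ξ * n ξ) U := by
  apply Lp.ext
  filter_upwards [mulOp_coe hm (mulOp n U), mulOp_coe hn U, mulOp_coe hmn U] with ξ h1 h2 h3
  rw [h1, h2, h3, mul_assoc]

theorem mulOp_sub {m n : ℝ → ℂ} (hm : MemLp m ⊤ volume) (hn : MemLp n ⊤ volume)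
    (U : Lp ℂ 2 (volume : Measure ℝ)) :
    mulOp m U - mulOp n U = mulOp (fun ξ ↦ m ξ - n ξ) U := by
  apply Lp.ext
  filter_upwards [Lp.coeFn_sub (mulOp m U) (mulOp n U), mulOp_coe hm U, mulOp_coe hn U,
    mulOp_coe (hm.sub hn) U] with ξ h0 h1 h2 h3
  rw [h0, Pi.sub_apply, h1, h2]
  refine Eq.trans ?_ h3.symm
  rw [Pi.sub_apply, sub_mul]

theorem mulOp_one (U : Lp ℂ 2 (volume : Measure ℝ)) : mulOp (fun _ ↦ 1) U = U := by
  apply Lp.ext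
  filter_upwards [mulOp_coe (memLp_top_of_norm_le (m := fun _ ↦ 1) (C := 1) measurable_const
    (by simp)) U] with ξ h
  rw [h, one_mul]

theorem mulOp_zero (U : Lp ℂ 2 (volume : Measure ℝ)) : mulOp (fun _ ↦ 0) U = 0 := by
  apply Lp.ext
  filter_upwards [mulOp_coe (memLp_top_of_norm_le (m := fun _ ↦ 0) (C := 0) measurable_const
    (by simp)) U,
    Lp.coeFn_zero ℂ 2 (volume : Measure ℝ)] with ξ h h'
  rw [h, h', zero_mul, Pi.zero_apply]

theorem norm_sq_eq_integral (f : Lp ℂ 2 (volume : Measure ℝ)) :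
    ‖f‖ ^ 2 = ∫ ξ, ‖f ξ‖ ^ 2 := by
  have h : ((‖f‖ ^ 2 : ℝ) : ℂ) = ((∫ ξ, ‖f ξ‖ ^ 2 : ℝ) : ℂ) := by
    have h1 := inner_self_eq_norm_sq_to_K (𝕜 := ℂ) f
    rw [MeasureTheory.L2.inner_def] at h1
    simp only [inner_self_eq_norm_sq_to_K] at h1
    push_cast
    rw [← integral_complex_ofReal]
    simpa using h1.symm
  exact_mod_cast h

theorem integrable_norm_sq (f : Lp ℂ 2 (volume : Measure ℝ)) :
    Integrable (fun ξ ↦ ‖f ξ‖ ^ 2) :=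
  (memLp_two_iff_integrable_sq_norm (Lp.aestronglyMeasurable f)).1 (Lp.memLp f)

/-- A pointwise convergent, uniformly bounded family of multipliers converges strongly. -/
theorem tendsto_mulOp {X : Type*} {l : Filter X} [l.IsCountablyGenerated] {m : X → ℝ → ℂ}
    {m₀ : ℝ → ℂ} {C : ℝ} (hm : ∀ᶠ x in l, Measurable (m x)) (hm₀ : Measurable m₀)
    (hC : ∀ᶠ x in l, ∀ ξ, ‖m x ξ‖ ≤ C) (hC₀ : ∀ ξ, ‖m₀ ξ‖ ≤ C)
    (hlim : ∀ ξ, Tendsto (fun x ↦ m x ξ) l (𝓝 (m₀ ξ))) (U : Lp ℂ 2 (volume : Measure ℝ)) :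
    Tendsto (fun x ↦ mulOp (m x) U) l (𝓝 (mulOp m₀ U)) := by
  rw [tendsto_iff_norm_sub_tendsto_zero]
  have key : Tendsto (fun x ↦ ‖mulOp (m x) U - mulOp m₀ U‖ ^ 2) l (𝓝 0) := by
    have h1 : Tendsto (fun x ↦ ∫ ξ, ‖(m x ξ - m₀ ξ) * U ξ‖ ^ 2) l (𝓝 (∫ _ξ : ℝ, (0 : ℝ))) := by
      refine tendsto_integral_filter_of_dominated_convergence
        (fun ξ ↦ (2 * C) ^ 2 * ‖U ξ‖ ^ 2) ?_ ?_ ((integrable_norm_sq U).const_mul _) ?_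
      · filter_upwards [hm] with x hx
        exact ((hx.sub hm₀).aestronglyMeasurable.mul (Lp.aestronglyMeasurable U)).norm.pow 2
      · filter_upwards [hC] with x hx
        refine Eventually.of_forall fun ξ ↦ ?_
        rw [Real.norm_of_nonneg (by positivity), norm_mul, mul_pow]
        gcongr
        linarith [norm_sub_le (m x ξ) (m₀ ξ), hx ξ, hC₀ ξ]
      · refine Eventually.of_forall fun ξ ↦ ?_
        have h2 : Tendsto (fun x ↦ ‖(m x ξ - m₀ ξ) * U ξ‖ ^ 2) l
            (𝓝 (‖(m₀ ξ - m₀ ξ) * U ξ‖ ^ 2)) :=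
          ((((hlim ξ).sub_const _).mul_const _).norm).pow 2
        simpa using h2
    rw [integral_zero] at h1
    refine h1.congr' ?_
    filter_upwards [hm, hC] with x hx hx'
    have ha := memLp_top_of_norm_le hx hx'
    have hb := memLp_top_of_norm_le hm₀ hC₀
    rw [mulOp_sub ha hb, norm_sq_eq_integral]
    refine integral_congr_ae ?_
    filter_upwards [mulOp_coe (ha.sub hb) U] with ξ h
    have h' : mulOp (fun ξ ↦ m x ξ - m₀ ξ) U ξ = (m x ξ - m₀ ξ) * U ξ := h
    rw [h']
  have h3 := key.sqrt
  simpa [Real.sqrt_sq] using h3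

/-- The function of an `L^p` class gives the tempered distribution of the class. -/
theorem represents_lp {p : ℝ≥0∞} [Fact (1 ≤ p)] (f : Lp ℂ p (volume : Measure ℝ)) :
    Represents f (f : 𝓢'(ℝ, ℂ)) := by
  intro ψ
  have := ENNReal.HolderConjugate.inv_one_sub_inv' (Fact.out : 1 ≤ p)
  refine ⟨?_, by simp⟩
  have h1 := (Lp.memLp f).integrable_mul (q := (1 - p⁻¹)⁻¹) (ψ.memLp _ volume)
  exact h1.congr (Eventually.of_forall fun x ↦ mul_comm _ _)

theorem Represents.congr {g h : ℝ → ℂ} {F : 𝓢'(ℝ, ℂ)} (H : Represents g F)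
    (hgh : g =ᵐ[volume] h) : Represents h F := by
  intro ψ
  have e : (fun x ↦ ψ x * g x) =ᵐ[volume] fun x ↦ ψ x * h x := by
    filter_upwards [hgh] with x hx
    rw [hx]
  exact ⟨(H ψ).1.congr e, (H ψ).2.trans (integral_congr_ae e)⟩

theorem Represents.unique {g : ℝ → ℂ} {F G : 𝓢'(ℝ, ℂ)} (hF : Represents g F)
    (hG : Represents g G) : F = G := by
  ext ψ
  rw [(hF ψ).2, (hG ψ).2]

theorem Represents.const_smul {g : ℝ → ℂ} {F : 𝓢'(ℝ, ℂ)} (c : ℂ) (h : Represents g F) :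
    Represents (fun x ↦ c * g x) (c • F) := by
  intro ψ
  have e : (fun x ↦ ψ x * (c * g x)) = fun x ↦ c * (ψ x * g x) := by
    ext x
    ring
  rw [e]
  refine ⟨(h ψ).1.const_mul c, ?_⟩
  rw [integral_const_mul, ← (h ψ).2]
  rfl

theorem Represents.smulLeft {g m : ℝ → ℂ} {F : 𝓢'(ℝ, ℂ)} (hm : m.HasTemperateGrowth)
    (h : Represents g F) :
    Represents (fun x ↦ m x * g x) (TemperedDistribution.smulLeftCLM ℂ m F) := by
  intro ψ
  have e : (fun x ↦ ψ x * (m x * g x)) =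
      fun x ↦ (SchwartzMap.smulLeftCLM ℂ m ψ) x * g x := by
    ext x
    rw [SchwartzMap.smulLeftCLM_apply_apply hm, smul_eq_mul]
    ring
  rw [e, TemperedDistribution.smulLeftCLM_apply_apply]
  exact h _

/-- The Fourier transform of an integrable function, as a distribution and as an integral. -/
theorem Represents.fourier {g : ℝ → ℂ} {F : 𝓢'(ℝ, ℂ)} (h : Represents g F)
    (hg : Integrable g) : Represents (𝓕 g) (𝓕 F) := by
  intro ψ
  have hc : Continuous (𝓕 g) :=
    VectorFourier.fourierIntegral_continuous Real.continuous_fourierChar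
      continuous_inner hg
  have hb : ∀ ξ, ‖𝓕 g ξ‖ ≤ ∫ x, ‖g x‖ := fun ξ ↦
    VectorFourier.norm_fourierIntegral_le_integral_norm _ _ _ _ _
  refine ⟨?_, ?_⟩
  · exact ψ.integrable.mul_bdd hc.aestronglyMeasurable (Eventually.of_forall hb)
  · rw [TemperedDistribution.fourier_apply, (h _).2, SchwartzMap.fourier_coe]
    have := VectorFourier.integral_fourierIntegral_smul_eq_flip (L := innerₗ ℝ)
      Real.continuous_fourierChar continuous_inner (ψ.integrable (μ := volume)) hg
    simpa [flip_innerₗ] using! this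

theorem represents_fourier_lp (w : Lp ℂ 2 (volume : Measure ℝ)) :
    Represents (𝓕 w : Lp ℂ 2 (volume : Measure ℝ)) (𝓕 (w : 𝓢'(ℝ, ℂ))) := by
  rw [Lp.fourier_toTemperedDistribution_eq]
  exact represents_lp _

/-! ### The symbol and the kernel of the Duhamel integral -/

theorem symbol_zero (β η ξ : ℝ) : symbol β η 0 ξ = 1 := by simp [symbol]

theorem symbol_add (β η t t' ξ : ℝ) :
    symbol β η (t + t') ξ = symbol β η t ξ * symbol β η t' ξ := by
  unfold symbol
  rw [← Complex.exp_add]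
  congr 1
  push_cast
  ring

theorem continuous_symbol (β η t : ℝ) : Continuous (symbol β η t) := by
  unfold symbol
  fun_prop

theorem continuous_symbol_time (β η ξ : ℝ) : Continuous fun t ↦ symbol β η t ξ := by
  unfold symbol
  fun_prop

theorem norm_symbol (β η t ξ : ℝ) : ‖symbol β η t ξ‖ =
    Real.exp (-(η * ((2 * Real.pi * ξ) ^ 2 - |2 * Real.pi * ξ|)) * t) := by
  rw [symbol, Complex.norm_exp]
  congr 1
  rw [Complex.re_mul_ofReal, Complex.sub_re, Complex.re_mul_ofReal, Complex.ofReal_re,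
    Complex.I_re, zero_mul, zero_sub]

/-- The growth of the low frequencies is absorbed by the factor `e^{ηt}`. -/
theorem norm_symbol_le {η t : ℝ} (hη : 0 < η) (ht : 0 ≤ t) (β ξ : ℝ) : ‖symbol β η t ξ‖ ≤
    Real.exp (η * t) * Real.exp (-(η / 2) * ((1 + (2 * Real.pi * ξ) ^ 2) * t)) := by
  rw [norm_symbol, ← Real.exp_add]
  apply Real.exp_le_exp.2
  have h : |2 * Real.pi * ξ| ≤ 1 / 2 + (2 * Real.pi * ξ) ^ 2 / 2 := by
    have := sq_abs (2 * Real.pi * ξ)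
    nlinarith [sq_nonneg (|2 * Real.pi * ξ| - 1)]
  have h2 := mul_le_mul_of_nonneg_left h (mul_nonneg hη.le ht)
  linarith

theorem norm_symbol_le_exp {η t : ℝ} (hη : 0 < η) (ht : 0 ≤ t) (β ξ : ℝ) :
    ‖symbol β η t ξ‖ ≤ Real.exp (η * t) := by
  refine (norm_symbol_le hη ht β ξ).trans ?_
  apply mul_le_of_le_one_right (Real.exp_pos _).le
  apply Real.exp_le_one_iff.2
  have : 0 ≤ η / 2 * ((1 + (2 * Real.pi * ξ) ^ 2) * t) := by positivity
  linarith

theorem symbol_memLp {η t : ℝ} (hη : 0 < η) (ht : 0 ≤ t) (β : ℝ) :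
    MemLp (symbol β η t) ⊤ volume :=
  memLp_top_of_norm_le (continuous_symbol β η t).measurable (norm_symbol_le_exp hη ht β)

/-- A bound of `|e^{ibζ|ζ|t} - 1|`, the relative difference of the symbols at time `t` for two
dispersion parameters that differ by `b`. -/
def phaseGap (b t ξ : ℝ) : ℝ := min 2 (|b| * ((2 * Real.pi * ξ) ^ 2 * t))

theorem norm_symbol_sub_le {t : ℝ} (ht : 0 ≤ t) (η β β' ξ : ℝ) :
    ‖symbol β η t ξ - symbol β' η t ξ‖ ≤ phaseGap (β - β') t ξ * ‖symbol β' η t ξ‖ := by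
  set ζ := 2 * Real.pi * ξ with hζ
  have h1 : symbol β η t ξ - symbol β' η t ξ =
      (Complex.exp (Complex.I * (((β - β') * (ζ * |ζ|) * t : ℝ) : ℂ)) - 1) *
        symbol β' η t ξ := by
    rw [sub_mul, one_mul, symbol, symbol, ← Complex.exp_add, ← hζ]
    congr 2
    push_cast
    ring
  rw [h1, norm_mul]
  refine mul_le_mul_of_nonneg_right (le_min ?_ ?_) (norm_nonneg _)
  · refine (norm_sub_le _ _).trans ?_
    rw [mul_comm, Complex.norm_exp_ofReal_mul_I, norm_one]
    norm_num
  · refine (Real.norm_exp_I_mul_ofReal_sub_one_le).trans (le_of_eq ?_)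
    rw [Real.norm_eq_abs, abs_mul, abs_mul, abs_mul, abs_abs, abs_of_nonneg ht, ← sq, sq_abs,
      mul_assoc]

/-- A constant with `(1 + y)³ e^{-ηy/2} ≤ decayConst η` for `y ≥ 0`. -/
def decayConst (η : ℝ) : ℝ := Real.exp (η / 2) * (6 / (η / 2) ^ 3)

theorem cube_mul_exp_le {η y : ℝ} (hη : 0 < η) (hy : 0 ≤ y) :
    (1 + y) ^ 3 * Real.exp (-(η / 2) * y) ≤ decayConst η := by
  have h := Real.pow_div_factorial_le_exp (η / 2 * (1 + y)) (by positivity) 3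
  have h2 : (1 + y) ^ 3 ≤ Real.exp (η / 2 * (1 + y)) * (6 / (η / 2) ^ 3) := by
    rw [mul_div_assoc', le_div_iff₀ (by positivity)]
    rw [div_le_iff₀ (by positivity)] at h
    norm_num [Nat.factorial] at h
    calc (1 + y) ^ 3 * (η / 2) ^ 3 = (η / 2 * (1 + y)) ^ 3 := by ring
      _ ≤ _ := h
  calc (1 + y) ^ 3 * Real.exp (-(η / 2) * y)
      ≤ Real.exp (η / 2 * (1 + y)) * (6 / (η / 2) ^ 3) * Real.exp (-(η / 2) * y) := by gcongr
    _ = (Real.exp (η / 2 * (1 + y)) * Real.exp (-(η / 2) * y)) * (6 / (η / 2) ^ 3) := by ring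
    _ = decayConst η := by
      rw [← Real.exp_add, decayConst]
      congr 2
      ring

/-- The constant of the smoothing estimates on the time interval `[0,T]`. -/
def smoothConst (η T : ℝ) : ℝ := Real.exp (η * T) * decayConst η

theorem decayConst_pos {η : ℝ} (hη : 0 < η) : 0 < decayConst η := by
  unfold decayConst
  positivity

theorem smoothConst_pos {η : ℝ} (hη : 0 < η) (T : ℝ) : 0 < smoothConst η T :=
  mul_pos (Real.exp_pos _) (decayConst_pos hη)

/-- The basic smoothing estimate: a power `⟨ζ⟩^{2p}` costs `t^{-p}`, and a decay of order four in
`ζ √t` is to spare. -/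
theorem wt_mul_symbol_le {η T t p : ℝ} (hη : 0 < η) (ht : 0 < t) (htT : t ≤ T) (hp : 0 ≤ p)
    (hp1 : p ≤ 1) (β ξ : ℝ) :
    wt (2 * p) ξ * ‖symbol β η t ξ‖ * (1 + (2 * Real.pi * ξ) ^ 2 * t) ^ 2 ≤
      smoothConst η T * t ^ (-p) := by
  set z := (2 * Real.pi * ξ) ^ 2 with hz
  have hz0 : 0 ≤ z := sq_nonneg _
  set y := (1 + z) * t with hy
  have hy0 : 0 < y := by positivity
  have h1 : wt (2 * p) ξ = y ^ p * t ^ (-p) := by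
    rw [hy, Real.mul_rpow (by positivity) ht.le, mul_assoc, ← Real.rpow_add ht, add_neg_cancel,
      Real.rpow_zero, mul_one, wt]
    congr 1
    ring
  have h2 : y ^ p ≤ 1 + y := by
    rcases le_total y 1 with h | h
    · linarith [Real.rpow_le_one hy0.le h hp]
    · have := Real.rpow_le_rpow_of_exponent_le h hp1
      rw [Real.rpow_one] at this
      linarith
  have h3 : 1 + z * t ≤ 1 + y := by nlinarith
  have h4 : ‖symbol β η t ξ‖ ≤ Real.exp (η * T) * Real.exp (-(η / 2) * y) := by
    refine (norm_symbol_le hη ht.le β ξ).trans ?_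
    gcongr
  have htp : 0 < t ^ (-p) := Real.rpow_pos_of_pos ht _
  calc wt (2 * p) ξ * ‖symbol β η t ξ‖ * (1 + z * t) ^ 2
      ≤ ((1 + y) * t ^ (-p)) * (Real.exp (η * T) * Real.exp (-(η / 2) * y)) * (1 + y) ^ 2 := by
        rw [h1]
        gcongr
    _ = Real.exp (η * T) * ((1 + y) ^ 3 * Real.exp (-(η / 2) * y)) * t ^ (-p) := by ring
    _ ≤ smoothConst η T * t ^ (-p) := by
        unfold smoothConst
        gcongr
        exact cube_mul_exp_le hη hy0.le

theorem norm_wt_symbol_le {η T t p : ℝ} (hη : 0 < η) (ht : 0 < t) (htT : t ≤ T) (hp : 0 ≤ p)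
    (hp1 : p ≤ 1) (β ξ : ℝ) :
    ‖((wt (2 * p) ξ : ℝ) : ℂ) * symbol β η t ξ‖ ≤ smoothConst η T * t ^ (-p) := by
  rw [norm_mul, Complex.norm_real, Real.norm_of_nonneg (wt_pos _ _).le]
  refine le_trans ?_ (wt_mul_symbol_le hη ht htT hp hp1 β ξ)
  apply le_mul_of_one_le_right (mul_nonneg (wt_pos _ _).le (norm_nonneg _))
  have : 0 ≤ (2 * Real.pi * ξ) ^ 2 * t := by positivity
  nlinarith

/-- The Fourier multiplier of `S(τ) ½ ∂ₓ` times the weight `⟨ζ⟩^{-2θ}`; it maps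
`⟨ζ⟩^σ 𝓕(u²)` to the Duhamel integrand in `H^{σ - 2θ}`. -/
def kerFun (β η θ τ ξ : ℝ) : ℂ :=
  symbol β η τ ξ * (Real.pi * Complex.I * ξ) * ((wt (-(2 * θ)) ξ : ℝ) : ℂ)

theorem continuous_kerFun (β η θ τ : ℝ) : Continuous (kerFun β η θ τ) := by
  unfold kerFun
  have := continuous_symbol β η τ
  fun_prop

theorem norm_kerFun_le {η T τ θ : ℝ} (hη : 0 < η) (hτ : 0 < τ) (hτT : τ ≤ T) (hθ : 0 ≤ θ)
    (hθ1 : θ ≤ 1 / 2) (β ξ : ℝ) :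
    ‖kerFun β η θ τ ξ‖ * (1 + (2 * Real.pi * ξ) ^ 2 * τ) ^ 2 ≤
      smoothConst η T * τ ^ (-(1 / 2 - θ)) := by
  refine le_trans ?_ (wt_mul_symbol_le hη hτ hτT (sub_nonneg.2 hθ1) (by linarith) β ξ)
  gcongr
  have h1 : ‖(Real.pi * Complex.I * ξ : ℂ)‖ ≤ wt 1 ξ := by
    have e : ‖(Real.pi * Complex.I * ξ : ℂ)‖ = Real.pi * |ξ| := by
      simp [abs_of_pos Real.pi_pos]
    rw [e, wt, ← Real.sqrt_eq_rpow]
    apply Real.le_sqrt_of_sq_le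
    rw [mul_pow, sq_abs]
    nlinarith [mul_nonneg (sq_nonneg Real.pi) (sq_nonneg ξ)]
  rw [kerFun, norm_mul, norm_mul, Complex.norm_real, Real.norm_of_nonneg (wt_pos _ _).le,
    show 2 * (1 / 2 - θ) = 1 + -(2 * θ) by ring, wt_add]
  have := (wt_pos (-(2 * θ)) ξ).le
  calc ‖symbol β η τ ξ‖ * ‖(Real.pi * Complex.I * ξ : ℂ)‖ * wt (-(2 * θ)) ξ
      ≤ ‖symbol β η τ ξ‖ * wt 1 ξ * wt (-(2 * θ)) ξ := by gcongr
    _ = _ := by ring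

theorem norm_kerFun_sub_le {η T τ θ : ℝ} (hη : 0 < η) (hτ : 0 < τ) (hτT : τ ≤ T) (hθ : 0 ≤ θ)
    (hθ1 : θ ≤ 1 / 2) (β β' ξ : ℝ) :
    ‖kerFun β η θ τ ξ - kerFun β' η θ τ ξ‖ * (1 + (2 * Real.pi * ξ) ^ 2 * τ) ≤
      |β - β'| * smoothConst η T * τ ^ (-(1 / 2 - θ)) := by
  have h0 := norm_kerFun_le hη hτ hτT hθ hθ1 β' ξ
  have h1 : ‖kerFun β η θ τ ξ - kerFun β' η θ τ ξ‖ ≤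
      |β - β'| * ((2 * Real.pi * ξ) ^ 2 * τ) * ‖kerFun β' η θ τ ξ‖ := by
    have h2 := (norm_symbol_sub_le hτ.le η β β' ξ).trans
      (mul_le_mul_of_nonneg_right (min_le_right _ _) (norm_nonneg _))
    have e : kerFun β η θ τ ξ - kerFun β' η θ τ ξ = (symbol β η τ ξ - symbol β' η τ ξ) *
        ((Real.pi * Complex.I * ξ) * ((wt (-(2 * θ)) ξ : ℝ) : ℂ)) := by
      unfold kerFun
      ring
    have e' : kerFun β' η θ τ ξ = symbol β' η τ ξ *
        ((Real.pi * Complex.I * ξ) * ((wt (-(2 * θ)) ξ : ℝ) : ℂ)) := by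
      unfold kerFun
      ring
    rw [e, e', norm_mul, norm_mul (symbol β' η τ ξ), ← mul_assoc]
    exact mul_le_mul_of_nonneg_right h2 (norm_nonneg _)
  have hz : 0 ≤ (2 * Real.pi * ξ) ^ 2 * τ := by positivity
  calc ‖kerFun β η θ τ ξ - kerFun β' η θ τ ξ‖ * (1 + (2 * Real.pi * ξ) ^ 2 * τ)
      ≤ |β - β'| * (1 + (2 * Real.pi * ξ) ^ 2 * τ) * ‖kerFun β' η θ τ ξ‖ *
          (1 + (2 * Real.pi * ξ) ^ 2 * τ) := by
        gcongr
        refine h1.trans ?_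
        gcongr
        linarith
    _ = |β - β'| * (‖kerFun β' η θ τ ξ‖ * (1 + (2 * Real.pi * ξ) ^ 2 * τ) ^ 2) := by ring
    _ ≤ _ := by
        rw [mul_assoc |β - β'|]
        exact mul_le_mul_of_nonneg_left h0 (abs_nonneg _)

/-- The `L²` norm of `(1 + ζ²τ)⁻¹` is at most `τ^{-1/4}`. -/
theorem memLp_two_of_decay {g : ℝ → ℂ} (hg : Measurable g) {A τ : ℝ} (hA : 0 ≤ A) (hτ : 0 < τ)
    (hb : ∀ ξ, ‖g ξ‖ * (1 + (2 * Real.pi * ξ) ^ 2 * τ) ≤ A) :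
    ∃ h : MemLp g 2 volume, ‖h.toLp g‖ ≤ A * τ ^ (-(1 / 4) : ℝ) := by
  set c := 2 * Real.pi * Real.sqrt τ with hc
  have hc0 : 0 < c := by positivity
  have hsq : ∀ ξ, (2 * Real.pi * ξ) ^ 2 * τ = (c * ξ) ^ 2 := by
    intro ξ
    rw [hc]
    have := Real.sq_sqrt hτ.le
    calc (2 * Real.pi * ξ) ^ 2 * τ = (2 * Real.pi * ξ) ^ 2 * Real.sqrt τ ^ 2 := by rw [this]
      _ = _ := by ring
  have hpt : ∀ ξ, ‖g ξ‖ ^ 2 ≤ A ^ 2 * (1 + (c * ξ) ^ 2)⁻¹ := by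
    intro ξ
    have h1 := hb ξ
    rw [hsq] at h1
    have h2 : 1 ≤ 1 + (c * ξ) ^ 2 := by nlinarith [sq_nonneg (c * ξ)]
    rw [← div_eq_mul_inv, le_div_iff₀ (by linarith)]
    calc ‖g ξ‖ ^ 2 * (1 + (c * ξ) ^ 2) ≤ ‖g ξ‖ ^ 2 * (1 + (c * ξ) ^ 2) ^ 2 := by
          gcongr
          nlinarith
      _ = (‖g ξ‖ * (1 + (c * ξ) ^ 2)) ^ 2 := by ring
      _ ≤ A ^ 2 := by gcongr
  have hint : Integrable fun ξ : ℝ ↦ A ^ 2 * (1 + (c * ξ) ^ 2)⁻¹ :=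
    (integrable_inv_one_add_sq.comp_mul_left' hc0.ne').const_mul _
  have hgi : Integrable fun ξ ↦ ‖g ξ‖ ^ 2 := by
    refine hint.mono' (hg.norm.pow_const 2).aestronglyMeasurable (Eventually.of_forall fun ξ ↦ ?_)
    rw [Real.norm_of_nonneg (by positivity)]
    exact hpt ξ
  have hm : MemLp g 2 volume :=
    (memLp_two_iff_integrable_sq_norm hg.aestronglyMeasurable).2 hgi
  refine ⟨hm, ?_⟩
  have h4 : ‖hm.toLp g‖ ^ 2 ≤ (A * τ ^ (-(1 / 4) : ℝ)) ^ 2 := by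
    rw [norm_sq_eq_integral]
    have e : ∫ ξ, ‖hm.toLp g ξ‖ ^ 2 = ∫ ξ, ‖g ξ‖ ^ 2 := by
      refine integral_congr_ae ?_
      filter_upwards [hm.coeFn_toLp] with ξ h
      rw [h]
    rw [e]
    refine (integral_mono hgi hint hpt).trans ?_
    rw [integral_const_mul, Measure.integral_comp_mul_left (fun x : ℝ ↦ (1 + x ^ 2)⁻¹) c,
      integral_univ_inv_one_add_sq, abs_of_pos (by positivity), mul_pow, smul_eq_mul]
    have h5 : (τ ^ (-(1 / 4) : ℝ)) ^ 2 = (Real.sqrt τ)⁻¹ := by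
      rw [← Real.rpow_natCast, ← Real.rpow_mul hτ.le, Real.sqrt_eq_rpow, ← Real.rpow_neg hτ.le]
      norm_num
    rw [h5]
    gcongr
    have h6 : 0 < Real.sqrt τ := Real.sqrt_pos.2 hτ
    rw [hc, mul_inv, mul_inv]
    have h7 : (2 : ℝ)⁻¹ * Real.pi⁻¹ * (Real.sqrt τ)⁻¹ * Real.pi = (Real.sqrt τ)⁻¹ / 2 := by
      have := Real.pi_pos.ne'
      field_simp
    rw [h7]
    have : 0 < (Real.sqrt τ)⁻¹ := by positivity
    linarith
  exact (pow_le_pow_iff_left₀ (norm_nonneg _) (by positivity) two_ne_zero).1 h4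

theorem kerFun_memLp {η τ θ : ℝ} (hη : 0 < η) (hτ : 0 < τ) (hθ : 0 ≤ θ) (hθ1 : θ ≤ 1 / 2)
    (β : ℝ) : ∃ h : MemLp (kerFun β η θ τ) 2 volume, ∀ T, τ ≤ T →
      ‖h.toLp _‖ ≤ smoothConst η T * τ ^ (-(3 / 4 - θ)) := by
  have key : ∀ T, τ ≤ T → ∃ h : MemLp (kerFun β η θ τ) 2 volume,
      ‖h.toLp _‖ ≤ smoothConst η T * τ ^ (-(3 / 4 - θ)) := by
    intro T hT
    have hS := smoothConst_pos hη T
    have := memLp_two_of_decay (continuous_kerFun β η θ τ).measurable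
      (A := smoothConst η T * τ ^ (-(1 / 2 - θ))) (by positivity) hτ (by
        intro ξ
        refine le_trans ?_ (norm_kerFun_le hη hτ hT hθ hθ1 β ξ)
        gcongr
        have : 0 ≤ (2 * Real.pi * ξ) ^ 2 * τ := by positivity
        nlinarith)
    rwa [mul_assoc, ← Real.rpow_add hτ,
      show -(1 / 2 - θ) + -(1 / 4) = -(3 / 4 - θ) by ring] at this
  exact ⟨(key τ le_rfl).1, fun T hT ↦ (key T hT).2⟩

open Classical in
/-- The kernel of the Duhamel integral as an `L²` function of the frequency. -/
def ker (β η θ τ : ℝ) : Lp ℂ 2 (volume : Measure ℝ) :=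
  if h : MemLp (kerFun β η θ τ) 2 volume then h.toLp _ else 0

theorem ker_coe {η τ θ : ℝ} (hη : 0 < η) (hτ : 0 < τ) (hθ : 0 ≤ θ) (hθ1 : θ ≤ 1 / 2)
    (β : ℝ) : ker β η θ τ =ᵐ[volume] kerFun β η θ τ := by
  obtain ⟨h, -⟩ := kerFun_memLp hη hτ hθ hθ1 β
  rw [ker, dif_pos h]
  exact h.coeFn_toLp

theorem norm_ker_le {η τ θ : ℝ} (hη : 0 < η) (hτ : 0 < τ) (hθ : 0 ≤ θ) (hθ1 : θ ≤ 1 / 2)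
    {T : ℝ} (hτT : τ ≤ T) (β : ℝ) :
    ‖ker β η θ τ‖ ≤ smoothConst η T * τ ^ (-(3 / 4 - θ)) := by
  obtain ⟨h, h2⟩ := kerFun_memLp hη hτ hθ hθ1 β
  rw [ker, dif_pos h]
  exact h2 T hτT

theorem norm_ker_sub_le {η τ θ : ℝ} (hη : 0 < η) (hτ : 0 < τ) (hθ : 0 ≤ θ) (hθ1 : θ ≤ 1 / 2)
    {T : ℝ} (hτT : τ ≤ T) (β β' : ℝ) :
    ‖ker β η θ τ - ker β' η θ τ‖ ≤
      |β - β'| * smoothConst η T * τ ^ (-(3 / 4 - θ)) := by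
  have hS := smoothConst_pos hη T
  obtain ⟨h, h2⟩ := memLp_two_of_decay
    ((continuous_kerFun β η θ τ).sub (continuous_kerFun β' η θ τ)).measurable
    (A := |β - β'| * smoothConst η T * τ ^ (-(1 / 2 - θ))) (by positivity) hτ
    (fun ξ ↦ norm_kerFun_sub_le hη hτ hτT hθ hθ1 β β' ξ)
  have e : ker β η θ τ - ker β' η θ τ = h.toLp _ := by
    apply Lp.ext
    filter_upwards [Lp.coeFn_sub (ker β η θ τ) (ker β' η θ τ), ker_coe hη hτ hθ hθ1 β,
      ker_coe hη hτ hθ hθ1 β', h.coeFn_toLp] with ξ h1 h2 h3 h4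
    rw [h1, h4, Pi.sub_apply, Pi.sub_apply, h2, h3]
  rw [e]
  rwa [mul_assoc, ← Real.rpow_add hτ,
      show -(1 / 2 - θ) + -(1 / 4) = -(3 / 4 - θ) by ring] at h2

theorem mulOp_symbol_ker {η τ θ : ℝ} (hη : 0 < η) (hτ : 0 < τ) (hθ : 0 ≤ θ) (hθ1 : θ ≤ 1 / 2)
    {t : ℝ} (ht : 0 ≤ t) (β : ℝ) :
    mulOp (symbol β η t) (ker β η θ τ) = ker β η θ (t + τ) := by
  apply Lp.ext
  filter_upwards [mulOp_coe (symbol_memLp hη ht β) (ker β η θ τ), ker_coe hη hτ hθ hθ1 β,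
    ker_coe hη (add_pos_of_nonneg_of_pos ht hτ) hθ hθ1 β] with ξ h1 h2 h3
  rw [h1, h2, h3, kerFun, kerFun, symbol_add]
  ring

theorem wt_memLp {r : ℝ} (hr : r ≤ 0) :
    MemLp (fun ξ ↦ ((wt r ξ : ℝ) : ℂ)) ⊤ volume := by
  refine memLp_top_of_norm_le (C := 1) ?_ fun ξ ↦ ?_
  · exact (Complex.continuous_ofReal.comp (continuous_wt r)).measurable
  · rw [Complex.norm_real, Real.norm_of_nonneg (wt_pos _ _).le]
    exact wt_le_one hr ξ

/-- The propagators are strongly continuous in time. -/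
theorem continuousOn_mulOp_symbol {η : ℝ} (hη : 0 < η) (β : ℝ)
    (U : Lp ℂ 2 (volume : Measure ℝ)) :
    ContinuousOn (fun t ↦ mulOp (symbol β η t) U) (Ici 0) := by
  intro t₀ ht₀
  have hb : ∀ᶠ t in 𝓝[Ici 0] t₀, t ∈ Ico 0 (t₀ + 1) := by
    have h1 : ∀ᶠ t in 𝓝[Ici 0] t₀, t < t₀ + 1 :=
      (eventually_lt_nhds (lt_add_one t₀)).filter_mono nhdsWithin_le_nhds
    filter_upwards [h1, self_mem_nhdsWithin] with t h2 h3 using ⟨h3, h2⟩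
  refine tendsto_mulOp (C := Real.exp (η * (t₀ + 1)))
    (Eventually.of_forall fun t ↦ (continuous_symbol β η t).measurable)
    (continuous_symbol β η t₀).measurable ?_ ?_ ?_ U
  · filter_upwards [hb] with t ht ξ
    refine (norm_symbol_le_exp hη ht.1 β ξ).trans ?_
    gcongr
    exact ht.2.le
  · intro ξ
    refine (norm_symbol_le_exp hη ht₀ β ξ).trans ?_
    gcongr
    linarith
  · exact fun ξ ↦ ((continuous_symbol_time β η ξ).tendsto t₀).mono_left nhdsWithin_le_nhds

theorem continuousOn_ker {η θ : ℝ} (hη : 0 < η) (hθ : 0 ≤ θ) (hθ1 : θ ≤ 1 / 2) (β : ℝ) :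
    ContinuousOn (ker β η θ) (Ioi 0) := by
  intro τ₀ hτ₀
  have hτ₀' : 0 < τ₀ := hτ₀
  have h1 := (continuousOn_mulOp_symbol hη β (ker β η θ (τ₀ / 2))).comp
    (s := Ici (τ₀ / 2)) (f := fun τ ↦ τ - τ₀ / 2) (by fun_prop)
    (fun τ hτ ↦ mem_Ici.2 (sub_nonneg.2 hτ))
  have h2 : ContinuousOn (ker β η θ) (Ici (τ₀ / 2)) := by
    refine h1.congr fun τ hτ ↦ ?_
    rw [Function.comp_apply, mulOp_symbol_ker hη (half_pos hτ₀') hθ hθ1 (sub_nonneg.2 hτ),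
      sub_add_cancel]
  exact (h2.continuousAt (Ici_mem_nhds (half_lt_self hτ₀'))).continuousWithinAt

/-! ### The Fourier transform of a product in weighted `L²` spaces -/

/-- The integral defining the Fourier transform at `ξ`, as a functional on `L¹`. -/
def fourierEval (ξ : ℝ) : Lp ℂ 1 (volume : Measure ℝ) →L[ℂ] ℂ :=
  LinearMap.mkContinuous
    { toFun := fun u ↦ 𝓕 (u : ℝ → ℂ) ξ
      map_add' := fun u v ↦ by
        have e : 𝓕 ((u + v : Lp ℂ 1 (volume : Measure ℝ)) : ℝ → ℂ) = 𝓕 ((u : ℝ → ℂ) + v) :=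
          VectorFourier.fourierIntegral_congr_ae _ _ _ (Lp.coeFn_add u v)
        have e2 : 𝓕 ((u : ℝ → ℂ) + v) = 𝓕 (u : ℝ → ℂ) + 𝓕 (v : ℝ → ℂ) :=
          VectorFourier.fourierIntegral_add Real.continuous_fourierChar continuous_inner
            (L1.integrable_coeFn u) (L1.integrable_coeFn v)
        rw [e, e2, Pi.add_apply]
      map_smul' := fun c u ↦ by
        have e : 𝓕 ((c • u : Lp ℂ 1 (volume : Measure ℝ)) : ℝ → ℂ) = 𝓕 (c • (u : ℝ → ℂ)) :=
          VectorFourier.fourierIntegral_congr_ae _ _ _ (Lp.coeFn_smul c u)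
        have e2 : 𝓕 (c • (u : ℝ → ℂ)) = c • 𝓕 (u : ℝ → ℂ) :=
          VectorFourier.fourierIntegral_const_smul _ _ _ _ _
        rw [e, e2, Pi.smul_apply, RingHom.id_apply] }
    1 (fun u ↦ by
      rw [one_mul, L1.norm_eq_integral_norm]
      exact VectorFourier.norm_fourierIntegral_le_integral_norm _ _ _ _ _)

theorem fourierEval_apply (ξ : ℝ) (u : Lp ℂ 1 (volume : Measure ℝ)) :
    fourierEval ξ u = 𝓕 (u : ℝ → ℂ) ξ := rfl

theorem continuous_fourierEval (u : Lp ℂ 1 (volume : Measure ℝ)) :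
    Continuous fun ξ ↦ fourierEval ξ u :=
  VectorFourier.fourierIntegral_continuous Real.continuous_fourierChar continuous_inner
    (L1.integrable_coeFn u)

/-- The pointwise product `L² × L² → L¹`. -/
def mulOne : Lp ℂ 2 (volume : Measure ℝ) →L[ℂ] Lp ℂ 2 (volume : Measure ℝ) →L[ℂ]
    Lp ℂ 1 (volume : Measure ℝ) :=
  (ContinuousLinearMap.mul ℂ ℂ).holderL volume 2 2 1

theorem mulOne_coe (u v : Lp ℂ 2 (volume : Measure ℝ)) :
    mulOne u v =ᵐ[volume] fun x ↦ u x * v x := by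
  unfold mulOne
  rw [ContinuousLinearMap.holderL_apply_apply]
  exact ContinuousLinearMap.coeFn_holder _ _ _

theorem norm_mulOne_le (u v : Lp ℂ 2 (volume : Measure ℝ)) : ‖mulOne u v‖ ≤ ‖u‖ * ‖v‖ := by
  unfold mulOne
  rw [ContinuousLinearMap.holderL_apply_apply]
  refine (ContinuousLinearMap.norm_holder_apply_apply_le _ _ _).trans ?_
  have := ContinuousLinearMap.opNorm_mul_le ℂ ℂ
  rw [mul_assoc]
  exact mul_le_of_le_one_left (by positivity) this

theorem integral_norm_mul_le (u v : Lp ℂ 2 (volume : Measure ℝ)) :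
    Integrable (fun x ↦ ‖u x‖ * ‖v x‖) ∧ ∫ x, ‖u x‖ * ‖v x‖ ≤ ‖u‖ * ‖v‖ := by
  have e : (fun x ↦ ‖mulOne u v x‖) =ᵐ[volume] fun x ↦ ‖u x‖ * ‖v x‖ := by
    filter_upwards [mulOne_coe u v] with x hx
    rw [hx, norm_mul]
  refine ⟨((L1.integrable_coeFn (mulOne u v)).norm).congr e, ?_⟩
  rw [← integral_congr_ae e, ← L1.norm_eq_integral_norm]
  exact norm_mulOne_le u v

/-- The `L²` function whose Fourier transform is `⟨ζ⟩^{-σ} V`. -/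
def physical (σ : ℝ) : Lp ℂ 2 (volume : Measure ℝ) →L[ℂ] Lp ℂ 2 (volume : Measure ℝ) :=
  (FourierTransform.fourierInvCLM ℂ (Lp ℂ 2 (volume : Measure ℝ))).comp
    (mulOp fun ξ ↦ ((wt (-σ) ξ : ℝ) : ℂ))

theorem physical_apply (σ : ℝ) (V : Lp ℂ 2 (volume : Measure ℝ)) :
    physical σ V = 𝓕⁻ (mulOp (fun ξ ↦ ((wt (-σ) ξ : ℝ) : ℂ)) V) := rfl

/-- Peetre's inequality. -/
theorem wt_le_mul_wt {σ : ℝ} (hσ : 0 ≤ σ) (ξ t : ℝ) :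
    wt σ ξ ≤ 2 ^ (σ / 2) * (wt σ t * wt σ (ξ - t)) := by
  unfold wt
  rw [← Real.mul_rpow (by positivity) (by positivity), ← Real.mul_rpow (by norm_num) (by positivity)]
  refine Real.rpow_le_rpow (by positivity) ?_ (by linarith)
  have e : 2 * Real.pi * ξ = 2 * Real.pi * t + 2 * Real.pi * (ξ - t) := by ring
  rw [e]
  set a := 2 * Real.pi * t
  set b := 2 * Real.pi * (ξ - t)
  nlinarith [sq_nonneg (a - b), sq_nonneg (a * b)]

theorem fourier_mul_fourierInv (h₁ h₂ : 𝓢(ℝ, ℂ)) (ξ : ℝ) :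
    𝓕 (fun x : ℝ ↦ (𝓕⁻ h₁ : 𝓢(ℝ, ℂ)) x * (𝓕⁻ h₂ : 𝓢(ℝ, ℂ)) x) ξ = ∫ t, h₁ t * h₂ (ξ - t) := by
  set c : 𝓢(ℝ, ℂ) := SchwartzMap.convolution (ContinuousLinearMap.mul ℂ ℂ) h₁ h₂ with hc
  have e : (fun x : ℝ ↦ (𝓕⁻ h₁ : 𝓢(ℝ, ℂ)) x * (𝓕⁻ h₂ : 𝓢(ℝ, ℂ)) x) = (𝓕⁻ c : 𝓢(ℝ, ℂ)) := by
    ext x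
    have e1 : ∀ f : 𝓢(ℝ, ℂ), (𝓕⁻ f : 𝓢(ℝ, ℂ)) x = (𝓕 f : 𝓢(ℝ, ℂ)) (-x) := by
      intro f
      rw [SchwartzMap.fourierInv_coe, SchwartzMap.fourier_coe, Real.fourierInv_eq_fourier_neg]
    rw [e1, e1, e1, hc, SchwartzMap.fourier_convolution_apply,
      Real.fourier_mul_convolution_eq h₁.integrable h₂.integrable, SchwartzMap.fourier_coe,
      SchwartzMap.fourier_coe]
  rw [e, ← SchwartzMap.fourier_coe, FourierTransform.fourier_fourierInv_eq, hc,
    SchwartzMap.convolution_apply]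
  rfl

theorem physical_toLp {σ : ℝ} (hσ : 0 ≤ σ) (g : 𝓢(ℝ, ℂ)) :
    physical σ (g.toLp 2) = (𝓕⁻ (SchwartzMap.smulLeftCLM ℂ
      (fun ξ : ℝ ↦ ((wt (-σ) ξ : ℝ) : ℂ)) g) : 𝓢(ℝ, ℂ)).toLp 2 := by
  rw [physical_apply, ← SchwartzMap.toLp_fourierInv_eq]
  congr 1
  apply Lp.ext
  filter_upwards [mulOp_coe (wt_memLp (neg_nonpos.2 hσ)) (g.toLp 2), g.coeFn_toLp 2 volume,
    (SchwartzMap.smulLeftCLM ℂ (fun ξ : ℝ ↦ ((wt (-σ) ξ : ℝ) : ℂ)) g).coeFn_toLp 2 volume]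
    with x h1 h2 h3
  rw [h1, h2, h3, SchwartzMap.smulLeftCLM_apply_apply (wt_growth (-σ)), smul_eq_mul]

theorem fourierEval_mulOne_toLp (p₁ p₂ : 𝓢(ℝ, ℂ)) (ξ : ℝ) :
    fourierEval ξ (mulOne (p₁.toLp 2) (p₂.toLp 2)) = 𝓕 (fun x : ℝ ↦ p₁ x * p₂ x) ξ := by
  rw [fourierEval_apply]
  refine congrFun (VectorFourier.fourierIntegral_congr_ae _ _ _ ?_) ξ
  filter_upwards [mulOne_coe (p₁.toLp 2) (p₂.toLp 2), p₁.coeFn_toLp 2 volume,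
    p₂.coeFn_toLp 2 volume] with x h1 h2 h3
  rw [h1, h2, h3]

theorem integral_norm_mul_sub_le (u v : Lp ℂ 2 (volume : Measure ℝ)) (ξ : ℝ) :
    Integrable (fun t ↦ ‖u t‖ * ‖v (ξ - t)‖) ∧ ∫ t, ‖u t‖ * ‖v (ξ - t)‖ ≤ ‖u‖ * ‖v‖ := by
  have hmp : MeasurePreserving (fun t : ℝ ↦ ξ - t) volume volume :=
    Measure.measurePreserving_sub_left volume ξ
  have h5 := integral_norm_mul_le u (Lp.compMeasurePreserving _ hmp v)
  rw [Lp.norm_compMeasurePreserving] at h5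
  have e5 : (fun t ↦ ‖u t‖ * ‖Lp.compMeasurePreserving _ hmp v t‖) =ᵐ[volume]
      fun t ↦ ‖u t‖ * ‖v (ξ - t)‖ := by
    filter_upwards [Lp.coeFn_compMeasurePreserving v hmp] with t h2
    rw [h2, Function.comp_apply]
  refine ⟨h5.1.congr e5, ?_⟩
  rw [← integral_congr_ae e5]
  exact h5.2

theorem integral_norm_mul_sub_toLp_le (g₁ g₂ : 𝓢(ℝ, ℂ)) (ξ : ℝ) :
    Integrable (fun t ↦ ‖g₁ t‖ * ‖g₂ (ξ - t)‖) ∧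
      ∫ t, ‖g₁ t‖ * ‖g₂ (ξ - t)‖ ≤ ‖g₁.toLp 2‖ * ‖g₂.toLp 2‖ := by
  have h5 := integral_norm_mul_sub_le (g₁.toLp 2) (g₂.toLp 2) ξ
  have h3 := (Measure.measurePreserving_sub_left volume ξ).quasiMeasurePreserving.ae
    (g₂.coeFn_toLp 2 volume)
  have e5 : (fun t ↦ ‖(g₁.toLp 2 : Lp ℂ 2 (volume : Measure ℝ)) t‖ *
      ‖(g₂.toLp 2 : Lp ℂ 2 (volume : Measure ℝ)) (ξ - t)‖) =ᵐ[volume]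
      fun t ↦ ‖g₁ t‖ * ‖g₂ (ξ - t)‖ := by
    filter_upwards [g₁.coeFn_toLp 2 volume, h3] with t h1 h3
    rw [h1, h3]
  exact ⟨h5.1.congr e5, (integral_congr_ae e5).symm.trans_le h5.2⟩

theorem wt_mul_fourierEval_toLp_le {σ : ℝ} (hσ : 0 ≤ σ) (g₁ g₂ : 𝓢(ℝ, ℂ)) (ξ : ℝ) :
    wt σ ξ * ‖fourierEval ξ (mulOne (physical σ (g₁.toLp 2)) (physical σ (g₂.toLp 2)))‖ ≤
      2 ^ (σ / 2) * (‖g₁.toLp 2‖ * ‖g₂.toLp 2‖) := by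
  obtain ⟨hi, h6⟩ := integral_norm_mul_sub_toLp_le g₁ g₂ ξ
  rw [physical_toLp hσ, physical_toLp hσ, fourierEval_mulOne_toLp, fourier_mul_fourierInv]
  have hw := wt_pos σ ξ
  refine (mul_le_mul_of_nonneg_left (norm_integral_le_integral_norm _) hw.le).trans ?_
  rw [← integral_const_mul]
  calc _ ≤ ∫ t, 2 ^ (σ / 2) * (‖g₁ t‖ * ‖g₂ (ξ - t)‖) := by
        refine integral_mono_of_nonneg (Eventually.of_forall fun t ↦ by positivity)
          (hi.const_mul _) (Eventually.of_forall fun t ↦ ?_)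
        simp only
        rw [SchwartzMap.smulLeftCLM_apply_apply (wt_growth (-σ)),
          SchwartzMap.smulLeftCLM_apply_apply (wt_growth (-σ)), smul_eq_mul, smul_eq_mul,
          norm_mul, norm_mul, norm_mul, Complex.norm_real, Complex.norm_real,
          Real.norm_of_nonneg (wt_pos _ _).le, Real.norm_of_nonneg (wt_pos _ _).le]
        have ha := (wt_pos (-σ) t).le
        have hb := (wt_pos (-σ) (ξ - t)).le
        calc wt σ ξ * (wt (-σ) t * ‖g₁ t‖ * (wt (-σ) (ξ - t) * ‖g₂ (ξ - t)‖))
            ≤ 2 ^ (σ / 2) * (wt σ t * wt σ (ξ - t)) *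
              (wt (-σ) t * ‖g₁ t‖ * (wt (-σ) (ξ - t) * ‖g₂ (ξ - t)‖)) := by
              gcongr
              exact wt_le_mul_wt hσ ξ t
          _ = 2 ^ (σ / 2) * ((wt σ t * wt (-σ) t) * (wt σ (ξ - t) * wt (-σ) (ξ - t)) *
              (‖g₁ t‖ * ‖g₂ (ξ - t)‖)) := by ring
          _ = _ := by rw [wt_mul_neg, wt_mul_neg, one_mul, one_mul]
    _ = 2 ^ (σ / 2) * ∫ t, ‖g₁ t‖ * ‖g₂ (ξ - t)‖ := integral_const_mul _ _
    _ ≤ _ := by gcongr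

/-- The product estimate: `⟨ζ⟩^σ 𝓕(uv)` is bounded by the product of the `H^σ` norms of `u`
and `v`. For Schwartz functions it follows from `𝓕(uv) = 𝓕u ⋆ 𝓕v` and Peetre's inequality. -/
theorem wt_mul_fourierEval_le {σ : ℝ} (hσ : 0 ≤ σ) (V₁ V₂ : Lp ℂ 2 (volume : Measure ℝ))
    (ξ : ℝ) : wt σ ξ * ‖fourierEval ξ (mulOne (physical σ V₁) (physical σ V₂))‖ ≤
      2 ^ (σ / 2) * (‖V₁‖ * ‖V₂‖) := by
  have hcl : IsClosed {p : Lp ℂ 2 (volume : Measure ℝ) × Lp ℂ 2 (volume : Measure ℝ) |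
      wt σ ξ * ‖fourierEval ξ (mulOne (physical σ p.1) (physical σ p.2))‖ ≤
        2 ^ (σ / 2) * (‖p.1‖ * ‖p.2‖)} :=
    isClosed_le (by fun_prop) (by fun_prop)
  have hd : DenseRange (SchwartzMap.toLpCLM ℝ ℂ 2 (volume : Measure ℝ)) :=
    SchwartzMap.denseRange_toLpCLM (by norm_num)
  refine (hd.prodMap hd).induction_on
    (p := fun p ↦ wt σ ξ * ‖fourierEval ξ (mulOne (physical σ p.1) (physical σ p.2))‖ ≤
        2 ^ (σ / 2) * (‖p.1‖ * ‖p.2‖)) (V₁, V₂) hcl ?_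
  rintro ⟨g₁, g₂⟩
  exact wt_mul_fourierEval_toLp_le hσ g₁ g₂ ξ

/-- The function `⟨ζ⟩^σ 𝓕(u₁ u₂)`, where `𝓕 uᵢ = ⟨ζ⟩^{-σ} Vᵢ`. -/
def prodFun (σ : ℝ) (V₁ V₂ : Lp ℂ 2 (volume : Measure ℝ)) (ξ : ℝ) : ℂ :=
  (wt σ ξ : ℂ) * fourierEval ξ (mulOne (physical σ V₁) (physical σ V₂))

theorem norm_prodFun_le {σ : ℝ} (hσ : 0 ≤ σ) (V₁ V₂ : Lp ℂ 2 (volume : Measure ℝ)) (ξ : ℝ) :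
    ‖prodFun σ V₁ V₂ ξ‖ ≤ 2 ^ (σ / 2) * (‖V₁‖ * ‖V₂‖) := by
  rw [prodFun, norm_mul, Complex.norm_real, Real.norm_of_nonneg (wt_pos _ _).le]
  exact wt_mul_fourierEval_le hσ V₁ V₂ ξ

theorem prodFun_memLp {σ : ℝ} (hσ : 0 ≤ σ) (V₁ V₂ : Lp ℂ 2 (volume : Measure ℝ)) :
    MemLp (prodFun σ V₁ V₂) ⊤ volume := by
  refine memLp_top_of_norm_le ?_ (norm_prodFun_le hσ V₁ V₂)
  have := continuous_fourierEval (mulOne (physical σ V₁) (physical σ V₂))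
  unfold prodFun
  exact Continuous.measurable (by fun_prop)

/-- The bounded function `⟨ζ⟩^σ 𝓕(u₁ u₂)` as a continuous bilinear map of `V₁` and `V₂`, where
`𝓕 uᵢ = ⟨ζ⟩^{-σ} Vᵢ`. -/
def prodHat {σ : ℝ} (hσ : 0 ≤ σ) : Lp ℂ 2 (volume : Measure ℝ) →L[ℂ]
    Lp ℂ 2 (volume : Measure ℝ) →L[ℂ] Lp ℂ ⊤ (volume : Measure ℝ) :=
  LinearMap.mkContinuous₂
    (LinearMap.mk₂ ℂ (fun V₁ V₂ ↦ (prodFun_memLp hσ V₁ V₂).toLp _)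
      (fun V₁ V₁' V₂ ↦ by
        rw [← MemLp.toLp_add]
        refine MemLp.toLp_congr _ _ (Eventually.of_forall fun ξ ↦ ?_)
        simp [prodFun, mul_add])
      (fun c V₁ V₂ ↦ by
        rw [← MemLp.toLp_const_smul]
        refine MemLp.toLp_congr _ _ (Eventually.of_forall fun ξ ↦ ?_)
        simp [prodFun, mul_left_comm])
      (fun V₁ V₂ V₂' ↦ by
        rw [← MemLp.toLp_add]
        refine MemLp.toLp_congr _ _ (Eventually.of_forall fun ξ ↦ ?_)
        simp [prodFun, mul_add])
      (fun c V₁ V₂ ↦ by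
        rw [← MemLp.toLp_const_smul]
        refine MemLp.toLp_congr _ _ (Eventually.of_forall fun ξ ↦ ?_)
        simp [prodFun, mul_left_comm]))
    (2 ^ (σ / 2))
    (fun V₁ V₂ ↦ by
      rw [mul_assoc]
      exact norm_toLp_top_le (prodFun_memLp hσ V₁ V₂) (by positivity) (norm_prodFun_le hσ V₁ V₂))

theorem prodHat_coe {σ : ℝ} (hσ : 0 ≤ σ) (V₁ V₂ : Lp ℂ 2 (volume : Measure ℝ)) :
    prodHat hσ V₁ V₂ =ᵐ[volume] prodFun σ V₁ V₂ :=
  (prodFun_memLp hσ V₁ V₂).coeFn_toLp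

theorem norm_prodHat_le {σ : ℝ} (hσ : 0 ≤ σ) (V₁ V₂ : Lp ℂ 2 (volume : Measure ℝ)) :
    ‖prodHat hσ V₁ V₂‖ ≤ 2 ^ (σ / 2) * (‖V₁‖ * ‖V₂‖) :=
  norm_toLp_top_le (prodFun_memLp hσ V₁ V₂) (by positivity) (norm_prodFun_le hσ V₁ V₂)

/-- The Duhamel integrand `S(τ) ½ ∂ₓ (u₁ u₂)` in frequency space, where
`𝓕 uᵢ = ⟨ζ⟩^{-σ} Vᵢ`, with the weight `⟨ζ⟩^{σ - 2θ}`. -/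
def duhamel {σ : ℝ} (hσ : 0 ≤ σ) (β η θ τ : ℝ) : Lp ℂ 2 (volume : Measure ℝ) →L[ℂ]
    Lp ℂ 2 (volume : Measure ℝ) →L[ℂ] Lp ℂ 2 (volume : Measure ℝ) :=
  ((ContinuousLinearMap.compL ℂ (Lp ℂ 2 (volume : Measure ℝ)) (Lp ℂ ⊤ (volume : Measure ℝ))
    (Lp ℂ 2 (volume : Measure ℝ))) (mulTop (ker β η θ τ))).comp (prodHat hσ)

theorem duhamel_apply {σ : ℝ} (hσ : 0 ≤ σ) (β η θ τ : ℝ) (V₁ V₂ : Lp ℂ 2 (volume : Measure ℝ)) :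
    duhamel hσ β η θ τ V₁ V₂ = mulTop (ker β η θ τ) (prodHat hσ V₁ V₂) := rfl

theorem continuousOn_duhamel {σ η θ : ℝ} (hσ : 0 ≤ σ) (hη : 0 < η) (hθ : 0 ≤ θ)
    (hθ1 : θ ≤ 1 / 2) (β : ℝ) : ContinuousOn (duhamel hσ β η θ) (Ioi 0) := by
  unfold duhamel
  have := continuousOn_ker hη hθ hθ1 β
  fun_prop

theorem duhamel_coe {σ η τ θ : ℝ} (hσ : 0 ≤ σ) (hη : 0 < η) (hτ : 0 < τ) (hθ : 0 ≤ θ)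
    (hθ1 : θ ≤ 1 / 2) (β : ℝ) (V₁ V₂ : Lp ℂ 2 (volume : Measure ℝ)) :
    duhamel hσ β η θ τ V₁ V₂ =ᵐ[volume] fun ξ ↦ kerFun β η θ τ ξ * prodFun σ V₁ V₂ ξ := by
  rw [duhamel_apply]
  filter_upwards [mulTop_coe (ker β η θ τ) (prodHat hσ V₁ V₂), ker_coe hη hτ hθ hθ1 β,
    prodHat_coe hσ V₁ V₂] with ξ h1 h2 h3
  rw [h1, h2, h3]

/-- The constant of the bilinear estimates on the time interval `[0,T]`. -/
def bilinConst (η σ T : ℝ) : ℝ := smoothConst η T * 2 ^ (σ / 2)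

theorem bilinConst_pos {η : ℝ} (hη : 0 < η) (σ T : ℝ) : 0 < bilinConst η σ T :=
  mul_pos (smoothConst_pos hη T) (by positivity)

theorem norm_duhamel_le {σ η τ θ T : ℝ} (hσ : 0 ≤ σ) (hη : 0 < η) (hτ : 0 < τ) (hτT : τ ≤ T)
    (hθ : 0 ≤ θ) (hθ1 : θ ≤ 1 / 2) (β : ℝ) (V₁ V₂ : Lp ℂ 2 (volume : Measure ℝ)) :
    ‖duhamel hσ β η θ τ V₁ V₂‖ ≤
      bilinConst η σ T * τ ^ (-(3 / 4 - θ)) * (‖V₁‖ * ‖V₂‖) := by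
  rw [duhamel_apply]
  have hS := smoothConst_pos hη T
  calc _ ≤ ‖ker β η θ τ‖ * ‖prodHat hσ V₁ V₂‖ := norm_mulTop_le _ _
    _ ≤ smoothConst η T * τ ^ (-(3 / 4 - θ)) * (2 ^ (σ / 2) * (‖V₁‖ * ‖V₂‖)) := by
        gcongr
        · exact norm_ker_le hη hτ hθ hθ1 hτT β
        · exact norm_prodHat_le hσ V₁ V₂
    _ = _ := by
        unfold bilinConst
        ring

theorem norm_duhamel_sub_le {σ η τ θ T : ℝ} (hσ : 0 ≤ σ) (hη : 0 < η) (hτ : 0 < τ)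
    (hτT : τ ≤ T) (hθ : 0 ≤ θ) (hθ1 : θ ≤ 1 / 2) (β β' : ℝ)
    (V₁ V₂ : Lp ℂ 2 (volume : Measure ℝ)) :
    ‖duhamel hσ β η θ τ V₁ V₂ - duhamel hσ β' η θ τ V₁ V₂‖ ≤
      bilinConst η σ T * τ ^ (-(3 / 4 - θ)) * (|β - β'| * (‖V₁‖ * ‖V₂‖)) := by
  have hS := smoothConst_pos hη T
  rw [duhamel_apply, duhamel_apply, ← _root_.sub_apply, ← map_sub]
  calc _ ≤ ‖ker β η θ τ - ker β' η θ τ‖ * ‖prodHat hσ V₁ V₂‖ := norm_mulTop_le _ _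
    _ ≤ |β - β'| * smoothConst η T * τ ^ (-(3 / 4 - θ)) * (2 ^ (σ / 2) * (‖V₁‖ * ‖V₂‖)) := by
        gcongr
        · exact norm_ker_sub_le hη hτ hθ hθ1 hτT β β'
        · exact norm_prodHat_le hσ V₁ V₂
    _ = _ := by
        unfold bilinConst
        ring

/-- The difference of two Duhamel integrands, in terms of `D = V - V'`. -/
theorem norm_duhamel_diff_le {σ η τ θ T : ℝ} (hσ : 0 ≤ σ) (hη : 0 < η) (hτ : 0 < τ)
    (hτT : τ ≤ T) (hθ : 0 ≤ θ) (hθ1 : θ ≤ 1 / 2) (β β' : ℝ)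
    (V V' : Lp ℂ 2 (volume : Measure ℝ)) :
    ‖duhamel hσ β η θ τ V V - duhamel hσ β' η θ τ V' V'‖ ≤ bilinConst η σ T *
      τ ^ (-(3 / 4 - θ)) * (2 * ‖V'‖ * ‖V - V'‖ + ‖V - V'‖ ^ 2 + |β - β'| * ‖V'‖ ^ 2) := by
  have e : duhamel hσ β η θ τ V V - duhamel hσ β' η θ τ V' V' =
      (duhamel hσ β η θ τ (V - V') V' + duhamel hσ β η θ τ V' (V - V') +
        duhamel hσ β η θ τ (V - V') (V - V')) +
      (duhamel hσ β η θ τ V' V' - duhamel hσ β' η θ τ V' V') := by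
    simp only [map_sub, _root_.sub_apply]
    abel
  rw [e]
  refine (norm_add_le _ _).trans ?_
  refine (add_le_add (norm_add₃_le) (norm_duhamel_sub_le hσ hη hτ hτT hθ hθ1 β β' V' V')).trans ?_
  refine (add_le_add_left (add_le_add (add_le_add
    (norm_duhamel_le hσ hη hτ hτT hθ hθ1 β _ _) (norm_duhamel_le hσ hη hτ hτT hθ hθ1 β _ _))
    (norm_duhamel_le hσ hη hτ hτT hθ hθ1 β _ _)) _).trans (le_of_eq ?_)
  ring

/-! ### Sobolev spaces and solutions in frequency space -/

/-- The isometry `f ↦ ⟨ζ⟩^s 𝓕 f` from `H^s(ℝ)` onto `L²(ℝ)`. -/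
def freq (s : ℝ) : Hs s ≃ₗᵢ[ℂ] Lp ℂ 2 (volume : Measure ℝ) :=
  (Hs.besselIsometry s).trans (Lp.fourierTransformₗᵢ ℝ ℂ)

theorem freq_apply {s : ℝ} (f : Hs s) : freq s f = 𝓕 f.besselLp := rfl

theorem represents_fourier_bessel (s : ℝ) (G : Lp ℂ 2 (volume : Measure ℝ)) :
    Represents (fun ξ ↦ ((wt (-s) ξ : ℝ) : ℂ) * (𝓕 G : Lp ℂ 2 (volume : Measure ℝ)) ξ)
      (𝓕 (bessel (-s) (G : 𝓢'(ℝ, ℂ)))) := by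
  have h := (represents_fourier_lp G).smulLeft (wt_growth (-s))
  have e : 𝓕 (bessel (-s) (G : 𝓢'(ℝ, ℂ))) = TemperedDistribution.smulLeftCLM ℂ
      (fun ξ : ℝ ↦ ((wt (-s) ξ : ℝ) : ℂ)) (𝓕 (G : 𝓢'(ℝ, ℂ))) := by
    rw [bessel, TemperedDistribution.fourierMultiplierCLM_apply,
      FourierTransform.fourier_fourierInv_eq]
    rfl
  rw [e]
  exact h

theorem represents_freq {s : ℝ} (f : Hs s) :
    Represents (fun ξ ↦ ((wt (-s) ξ : ℝ) : ℂ) * freq s f ξ) (𝓕 (Hs.toDist s f)) := by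
  have e : Hs.toDist s f = bessel (-s) (f.besselLp : 𝓢'(ℝ, ℂ)) := by
    rw [← Hs.besselLp_spec, bessel_bessel, add_neg_cancel, bessel_zero]
  rw [e]
  exact represents_fourier_bessel s f.besselLp

theorem eq_of_represents_fourier {g : ℝ → ℂ} {F G : 𝓢'(ℝ, ℂ)} (hF : Represents g (𝓕 F))
    (hG : Represents g (𝓕 G)) : F = G := by
  have h := congrArg (fun H : 𝓢'(ℝ, ℂ) ↦ (𝓕⁻ H : 𝓢'(ℝ, ℂ))) (hF.unique hG)
  simpa using h

/-- A distribution whose Fourier transform is the function `⟨ζ⟩^{-s} X` with `X ∈ L²` belongs to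
`H^s(ℝ)`. -/
theorem freq_toHs {s : ℝ} {F : 𝓢'(ℝ, ℂ)} {g : ℝ → ℂ} (hg : Represents g (𝓕 F))
    {X : Lp ℂ 2 (volume : Measure ℝ)} (hX : X =ᵐ[volume] fun ξ ↦ ((wt s ξ : ℝ) : ℂ) * g ξ) :
    freq s (toHs s F) = X := by
  set G : Lp ℂ 2 (volume : Measure ℝ) := 𝓕⁻ X with hG
  have hGX : 𝓕 G = X := FourierTransform.fourier_fourierInv_eq X
  have e : F = bessel (-s) (G : 𝓢'(ℝ, ℂ)) := by
    refine eq_of_represents_fourier hg ((represents_fourier_bessel s G).congr ?_)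
    rw [hGX]
    filter_upwards [hX] with ξ h
    rw [h, ← mul_assoc, ← Complex.ofReal_mul, wt_neg_mul, Complex.ofReal_one, one_mul]
  set f : Hs s := (Hs.besselEquiv s).symm G with hf
  have hfF : Hs.toDist s f = F := e.symm
  have hfG : f.besselLp = G := (Hs.besselEquiv s).apply_symm_apply G
  rw [← hfF, toHs_toDist, freq_apply, hfG, hGX]

theorem fourier_semigroup {β η t : ℝ} {F G : 𝓢'(ℝ, ℂ)} {g : ℝ → ℂ} (hg : Represents g (𝓕 F))
    (hG : Represents (fun ξ ↦ symbol β η t ξ * g ξ) G) : 𝓕 (semigroup β η t F) = G := by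
  rw [semigroup, FourierTransform.fourier_fourierInv_eq]
  apply distOf_eq
  refine hG.congr ?_
  filter_upwards [funOf_ae_eq hg] with ξ h
  rw [h]

/-- If `⟨ζ⟩^s e^{(iq-p)t} 𝓕F` is an `L²` function, then `S(t) F` belongs to `H^s(ℝ)`. -/
theorem freq_toHs_semigroup {s β η t : ℝ} {F : 𝓢'(ℝ, ℂ)} {g : ℝ → ℂ} (hg : Represents g (𝓕 F))
    {X : Lp ℂ 2 (volume : Measure ℝ)}
    (hX : X =ᵐ[volume] fun ξ ↦ ((wt s ξ : ℝ) : ℂ) * (symbol β η t ξ * g ξ)) :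
    freq s (toHs s (semigroup β η t F)) = X := by
  have h := (represents_lp X).smulLeft (wt_growth (-s))
  have h2 : Represents (fun ξ ↦ symbol β η t ξ * g ξ) _ := h.congr (by
    filter_upwards [hX] with ξ h
    rw [h, ← mul_assoc, ← Complex.ofReal_mul, wt_neg_mul, Complex.ofReal_one, one_mul])
  refine freq_toHs (g := fun ξ ↦ symbol β η t ξ * g ξ) ?_ hX
  rw [fourier_semigroup hg h2]
  exact h2

theorem freq_semigroup {s η t : ℝ} (hη : 0 < η) (ht : 0 ≤ t) (β : ℝ) (φ : Hs s) :
    freq s (toHs s (semigroup β η t (Hs.toDist s φ))) = mulOp (symbol β η t) (freq s φ) := by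
  refine freq_toHs_semigroup (represents_freq φ) ?_
  filter_upwards [mulOp_coe (symbol_memLp hη ht β) (freq s φ)] with ξ h
  rw [h, mul_left_comm, ← mul_assoc (((wt s ξ : ℝ)) : ℂ), ← Complex.ofReal_mul, wt_mul_neg,
    Complex.ofReal_one, one_mul]

/-- The nonlinearity at an `L²` function, in frequency space. -/
theorem represents_fourier_nonlin (w : Lp ℂ 2 (volume : Measure ℝ)) :
    Represents (fun ξ ↦ (Real.pi * Complex.I * ξ) * fourierEval ξ (mulOne w w))
      (𝓕 (nonlin (w : 𝓢'(ℝ, ℂ)))) := by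
  have h1 : distOf (fun x ↦ funOf (w : 𝓢'(ℝ, ℂ)) x ^ 2) =
      ((mulOne w w : Lp ℂ 1 (volume : Measure ℝ)) : 𝓢'(ℝ, ℂ)) := by
    apply distOf_eq
    refine (represents_lp (mulOne w w)).congr ?_
    filter_upwards [mulOne_coe w w, funOf_ae_eq (represents_lp w)] with x h1 h2
    rw [h1, h2, sq]
  have h2 := (represents_lp (mulOne w w)).fourier (L1.integrable_coeFn (mulOne w w))
  have hgr : (fun ξ : ℝ ↦ ((inner ℝ ξ (1 : ℝ) : ℝ) : ℂ)).HasTemperateGrowth := by fun_prop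
  have h3 := ((h2.smulLeft hgr).const_smul (2 * Real.pi * Complex.I)).const_smul (1 / 2)
  have h4 : 𝓕 (nonlin (w : 𝓢'(ℝ, ℂ))) = (1 / 2 : ℂ) • (2 * Real.pi * Complex.I) •
      TemperedDistribution.smulLeftCLM ℂ (fun ξ : ℝ ↦ ((inner ℝ ξ (1 : ℝ) : ℝ) : ℂ))
        (𝓕 ((mulOne w w : Lp ℂ 1 (volume : Measure ℝ)) : 𝓢'(ℝ, ℂ))) := by
    rw [nonlin, h1, FourierTransform.fourier_smul, TemperedDistribution.fourier_lineDerivOp_eq]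
  rw [h4]
  refine h3.congr (Eventually.of_forall fun ξ ↦ ?_)
  simp only [fourierEval_apply, RCLike.inner_apply, conj_trivial, one_mul]
  ring

theorem fourier_physical (σ : ℝ) (V : Lp ℂ 2 (volume : Measure ℝ)) :
    𝓕 (physical σ V) = mulOp (fun ξ ↦ ((wt (-σ) ξ : ℝ) : ℂ)) V :=
  FourierTransform.fourier_fourierInv_eq _

theorem toDist_eq_physical {s σ a : ℝ} (hs : s = σ - 2 * a) (hσ : 0 ≤ σ) (ha : 0 ≤ a) (f : Hs s)
    {V : Lp ℂ 2 (volume : Measure ℝ)}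
    (hV : freq s f = mulOp (fun ξ ↦ ((wt (-(2 * a)) ξ : ℝ) : ℂ)) V) :
    Hs.toDist s f = (physical σ V : 𝓢'(ℝ, ℂ)) := by
  refine eq_of_represents_fourier ((represents_freq f).congr ?_)
    (represents_fourier_lp (physical σ V))
  rw [fourier_physical, hV]
  filter_upwards [mulOp_coe (wt_memLp (neg_nonpos.2 hσ)) V,
    mulOp_coe (wt_memLp (r := -(2 * a)) (by linarith)) V] with ξ h1 h2
  rw [h1, h2, ← mul_assoc, ← Complex.ofReal_mul, ← wt_add, hs]
  congr 3
  ring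

theorem freq_duhamel {s σ a η τ : ℝ} (hs : s = σ - 2 * a) (hσ : 0 ≤ σ) (ha : 0 ≤ a)
    (ha' : a ≤ 1 / 2) (hη : 0 < η) (hτ : 0 < τ) (β : ℝ) (V : Lp ℂ 2 (volume : Measure ℝ)) :
    freq s (toHs s (semigroup β η τ (nonlin (physical σ V : 𝓢'(ℝ, ℂ))))) =
      duhamel hσ β η a τ V V := by
  refine freq_toHs_semigroup (represents_fourier_nonlin _) ?_
  filter_upwards [duhamel_coe hσ hη hτ ha ha' β V V] with ξ h
  rw [h, kerFun, prodFun, hs, show σ - 2 * a = σ + -(2 * a) by ring, wt_add]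
  push_cast
  ring

theorem freq_eq_of_toDist_eq {s a : ℝ} (hs : s = -(2 * a)) (ha : 0 ≤ a) (f : Hs s)
    {w : Lp ℂ 2 (volume : Measure ℝ)} (h : Hs.toDist s f = (w : 𝓢'(ℝ, ℂ))) :
    freq s f = mulOp (fun ξ ↦ ((wt (-(2 * a)) ξ : ℝ) : ℂ)) (𝓕 w) := by
  rw [← toHs_toDist f, h]
  refine freq_toHs (represents_fourier_lp w) ?_
  rw [hs]
  exact mulOp_coe (wt_memLp (by linarith)) _

/-- The mild formulation in frequency space: `U(t) = ⟨ζ⟩^s 𝓕u(t)` and `V(t) = ⟨ζ⟩^σ 𝓕u(t)`, where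
`s = σ - 2a`, and `Φ = ⟨ζ⟩^s 𝓕φ`. The equation is required for `0 < t ≤ T` only, since `φ`
need not lie in `H^σ`, and no measurability of `V` is demanded. -/
structure IsMild {σ : ℝ} (hσ : 0 ≤ σ) (β η a T : ℝ) (Φ : Lp ℂ 2 (volume : Measure ℝ))
    (U V : ℝ → Lp ℂ 2 (volume : Measure ℝ)) : Prop where
  weight : ∀ t ∈ Ioc 0 T, U t = mulOp (fun ξ ↦ ((wt (-(2 * a)) ξ : ℝ) : ℂ)) (V t)
  integrable : ∀ t ∈ Ioc 0 T,
    IntervalIntegrable (fun t' ↦ duhamel hσ β η a (t - t') (V t') (V t')) volume 0 t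
  eq : ∀ t ∈ Ioc 0 T, U t = mulOp (symbol β η t) Φ -
    ∫ t' in (0 : ℝ)..t, duhamel hσ β η a (t - t') (V t') (V t')

theorem freq_integrand_eq {s σ a η T : ℝ} (hs : s = σ - 2 * a) (hσ : 0 ≤ σ) (ha : 0 ≤ a)
    (ha' : a ≤ 1 / 2) (hη : 0 < η) (β : ℝ) {u : ℝ → Hs s}
    {V : ℝ → Lp ℂ 2 (volume : Measure ℝ)}
    (hV : ∀ t ∈ Ioc 0 T, freq s (u t) = mulOp (fun ξ ↦ ((wt (-(2 * a)) ξ : ℝ) : ℂ)) (V t))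
    {t : ℝ} (ht : t ∈ Ioc 0 T) :
    (fun t' ↦ freq s (toHs s (semigroup β η (t - t') (nonlin (Hs.toDist s (u t'))))))
      =ᵐ[volume.restrict (uIoc 0 t)] fun t' ↦ duhamel hσ β η a (t - t') (V t') (V t') := by
  rw [uIoc_of_le ht.1.le]
  refine (ae_restrict_iff' measurableSet_Ioc).2 ?_
  filter_upwards [compl_mem_ae_iff.2 (measure_singleton t)] with t' ht' h
  have h1 : t' < t := lt_of_le_of_ne h.2 ht'
  rw [toDist_eq_physical hs hσ ha (u t') (hV t' ⟨h.1, h.2.trans ht.2⟩)]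
  exact freq_duhamel hs hσ ha ha' hη (sub_pos.2 h1) β (V t')

theorem intervalIntegrable_freq_iff {s t : ℝ} {f : ℝ → Hs s} :
    IntervalIntegrable (fun x ↦ freq s (f x)) volume 0 t ↔ IntervalIntegrable f volume 0 t := by
  rw [intervalIntegrable_iff, intervalIntegrable_iff]
  exact (freq s).toContinuousLinearEquiv.integrable_comp_iff

theorem freq_intervalIntegral {s t : ℝ} (f : ℝ → Hs s) :
    freq s (∫ x in (0 : ℝ)..t, f x) = ∫ x in (0 : ℝ)..t, freq s (f x) := by
  have h : ∫ x in uIoc 0 t, freq s (f x) = freq s (∫ x in uIoc 0 t, f x) :=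
    (freq s).toLinearIsometry.integral_comp_comm f
  rw [intervalIntegral.intervalIntegral_eq_integral_uIoc,
    intervalIntegral.intervalIntegral_eq_integral_uIoc, h]
  split_ifs
  · rw [one_smul, one_smul]
  · rw [neg_one_smul, neg_one_smul, map_neg]

/-- A solution gives a mild solution in frequency space, with the weighted bound of its `H^σ`
norm. -/
theorem IsSolution.exists_isMild {s σ a η T β : ℝ} (hs : s = σ - 2 * a) (hσ : 0 ≤ σ)
    (ha : 0 ≤ a) (ha' : a ≤ 1 / 2) (hσa : σ = 0 ∨ a = 0) (hη : 0 < η) {φ : Hs s}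
    {u : ℝ → Hs s} (h : IsSolution β η s T φ u) :
    ∃ V : ℝ → Lp ℂ 2 (volume : Measure ℝ),
      IsMild hσ β η a T (freq s φ) (fun t ↦ freq s (u t)) V ∧
      ∃ M : ℝ, ∀ t ∈ Ioc 0 T, ‖V t‖ ≤ M * t ^ (-a) := by
  have key : ∃ V : ℝ → Lp ℂ 2 (volume : Measure ℝ),
      (∀ t ∈ Ioc 0 T, freq s (u t) = mulOp (fun ξ ↦ ((wt (-(2 * a)) ξ : ℝ) : ℂ)) (V t)) ∧
      ∃ M : ℝ, ∀ t ∈ Ioc 0 T, ‖V t‖ ≤ M * t ^ (-a) := by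
    rcases ha.eq_or_lt with ha0 | ha0
    · obtain ⟨M, hM⟩ := (isCompact_Icc.image_of_continuousOn h.1.1).isBounded.exists_norm_le
      refine ⟨fun t ↦ freq s (u t), fun t _ ↦ ?_, M, fun t ht ↦ ?_⟩
      · simp only [← ha0, mul_zero, neg_zero, wt_zero, Complex.ofReal_one]
        rw [mulOp_one]
      · simp only [← ha0, neg_zero, Real.rpow_zero, mul_one, LinearIsometryEquiv.norm_map]
        exact hM _ (mem_image_of_mem u ⟨ht.1.le, ht.2⟩)
    · have hσ0 : σ = 0 := hσa.resolve_right ha0.ne'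
      have hs' : s = -(2 * a) := by rw [hs, hσ0, zero_sub]
      have hsa : |s| / 2 = a := by
        rw [hs', abs_neg, abs_of_pos (by linarith)]
        ring
      obtain ⟨M, hM⟩ := h.1.2 (by linarith)
      rw [hsa] at hM
      choose! w hw hwM using hM
      refine ⟨fun t ↦ 𝓕 (w t), fun t ht ↦ freq_eq_of_toDist_eq hs' ha _ (hw t ht), M,
        fun t ht ↦ ?_⟩
      rw [Lp.norm_fourier_eq]
      have := hwM t ht
      have h0 : 0 < t ^ a := Real.rpow_pos_of_pos ht.1 _
      rw [Real.rpow_neg ht.1.le, ← div_eq_mul_inv, le_div_iff₀ h0]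
      linarith
  obtain ⟨V, hV, hM⟩ := key
  refine ⟨V, ⟨hV, fun t ht ↦ ?_, fun t ht ↦ ?_⟩, hM⟩
  · have h1 := intervalIntegrable_freq_iff.2 (h.2 t ⟨ht.1.le, ht.2⟩).1
    exact h1.congr_ae (freq_integrand_eq hs hσ ha ha' hη β hV ht)
  · rw [(h.2 t ⟨ht.1.le, ht.2⟩).2, map_sub, freq_semigroup hη ht.1.le, freq_intervalIntegral]
    congr 1
    exact intervalIntegral.integral_congr_ae_restrict (freq_integrand_eq hs hσ ha ha' hη β hV ht)

theorem IsSolution.apply_zero {s η T β : ℝ} (hη : 0 < η) (hT : 0 ≤ T) {φ : Hs s}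
    {u : ℝ → Hs s} (h : IsSolution β η s T φ u) : u 0 = φ := by
  have h0 := (h.2 0 ⟨le_rfl, hT⟩).2
  rw [intervalIntegral.integral_same, sub_zero] at h0
  apply (freq s).injective
  rw [h0, freq_semigroup hη le_rfl]
  have e : symbol β η 0 = fun _ ↦ 1 := funext (symbol_zero β η)
  rw [e, mulOp_one]

/-- A mild solution in frequency space, continuous up to time `0` and with a weighted bound, gives
a solution. -/
theorem IsMild.exists_isSolution {s σ a η T β : ℝ} (hs : s = σ - 2 * a) {hσ : 0 ≤ σ}
    (ha : 0 ≤ a) (ha' : a ≤ 1 / 2) (hσa : σ = 0 ∨ a = 0) (hη : 0 < η) {φ : Hs s}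
    {U V : ℝ → Lp ℂ 2 (volume : Measure ℝ)} (h : IsMild hσ β η a T (freq s φ) U V)
    (h0 : U 0 = freq s φ) (hc : ContinuousOn U (Icc 0 T)) {M : ℝ}
    (hM : ∀ t ∈ Ioc 0 T, ‖V t‖ ≤ M * t ^ (-a)) :
    ∃ u : ℝ → Hs s, IsSolution β η s T φ u := by
  set u : ℝ → Hs s := fun t ↦ (freq s).symm (U t) with hu
  have hfu : ∀ t, freq s (u t) = U t := fun t ↦ (freq s).apply_symm_apply (U t)
  have hV : ∀ t ∈ Ioc 0 T,
      freq s (u t) = mulOp (fun ξ ↦ ((wt (-(2 * a)) ξ : ℝ) : ℂ)) (V t) := fun t ht ↦ by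
    rw [hfu, h.weight t ht]
  refine ⟨u, ⟨(freq s).symm.continuous.comp_continuousOn hc, fun hs0 ↦ ⟨M, fun t ht ↦ ?_⟩⟩,
    fun t ht ↦ ?_⟩
  · have ha0 : a ≠ 0 := by
      rintro rfl
      linarith
    have hσ0 : σ = 0 := hσa.resolve_right ha0
    have hsa : |s| / 2 = a := by
      rw [hs, hσ0, zero_sub, abs_neg, abs_of_nonneg (by linarith)]
      ring
    refine ⟨physical σ (V t), toDist_eq_physical hs hσ ha (u t) (hV t ht), ?_⟩
    have h1 : ‖physical σ (V t)‖ ≤ ‖V t‖ := by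
      rw [← Lp.norm_fourier_eq, fourier_physical]
      refine (norm_mulOp_le (C := 1) ?_ zero_le_one (fun ξ ↦ ?_) _).trans_eq (one_mul _)
      · exact (Complex.continuous_ofReal.comp (continuous_wt _)).measurable
      · rw [Complex.norm_real, Real.norm_of_nonneg (wt_pos _ _).le]
        exact wt_le_one (neg_nonpos.2 hσ) ξ
    have h2 : 0 < t ^ a := Real.rpow_pos_of_pos ht.1 _
    rw [hsa, mul_comm, ← le_div_iff₀ h2, div_eq_mul_inv, ← Real.rpow_neg ht.1.le]
    exact h1.trans (hM t ht)
  · rcases ht.1.eq_or_lt with h00 | ht0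
    · rw [← h00]
      refine ⟨by simp, ?_⟩
      rw [intervalIntegral.integral_same, sub_zero]
      apply (freq s).injective
      rw [hfu, h0, freq_semigroup hη le_rfl]
      have e : symbol β η 0 = fun _ ↦ 1 := funext (symbol_zero β η)
      rw [e, mulOp_one]
    · have ht' : t ∈ Ioc 0 T := ⟨ht0, ht.2⟩
      have hae := freq_integrand_eq hs hσ ha ha' hη β hV ht'
      refine ⟨intervalIntegrable_freq_iff.1 ((h.integrable t ht').congr_ae hae.symm), ?_⟩
      apply (freq s).injective
      rw [hfu, h.eq t ht', map_sub, freq_semigroup hη ht.1, freq_intervalIntegral]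
      congr 1
      exact (intervalIntegral.integral_congr_ae_restrict hae).symm

/-! ### Beta integrals and the fixed point -/

/-- The Beta integral `∫₀¹ (1 - θ)^{-p} θ^{-q} dθ`. -/
def betaConst (p q : ℝ) : ℝ := ∫ θ in (0 : ℝ)..1, (1 - θ) ^ (-p) * θ ^ (-q)

theorem intervalIntegrable_beta {p q : ℝ} (hp : p < 1) (hq : q < 1) :
    IntervalIntegrable (fun θ : ℝ ↦ (1 - θ) ^ (-p) * θ ^ (-q)) volume 0 1 := by
  have h := (Complex.betaIntegral_convergent (u := ((1 - q : ℝ) : ℂ)) (v := ((1 - p : ℝ) : ℂ))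
    (by simpa using hq) (by simpa using hp)).norm
  refine h.congr_ae ?_
  rw [uIoc_of_le zero_le_one, ← restrict_Ioo_eq_restrict_Ioc]
  refine (ae_restrict_iff' measurableSet_Ioo).2 (Eventually.of_forall fun θ hθ ↦ ?_)
  have h1 : 0 < 1 - θ := sub_pos.2 hθ.2
  simp only
  rw [norm_mul, ← Complex.ofReal_one, ← Complex.ofReal_sub, ← Complex.ofReal_sub,
    ← Complex.ofReal_sub, Complex.norm_cpow_eq_rpow_re_of_pos hθ.1,
    Complex.norm_cpow_eq_rpow_re_of_pos h1, Complex.ofReal_re, Complex.ofReal_re, mul_comm]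
  congr 2 <;> ring

theorem betaConst_nonneg (p q : ℝ) : 0 ≤ betaConst p q := by
  refine intervalIntegral.integral_nonneg zero_le_one fun θ hθ ↦ ?_
  have h1 : 0 ≤ 1 - θ := sub_nonneg.2 hθ.2
  have h2 := hθ.1
  positivity

theorem beta_scale {p q t θ : ℝ} (ht : 0 < t) (hθ : θ ∈ Icc (0 : ℝ) 1) :
    (t - t * θ) ^ (-p) * (t * θ) ^ (-q) = t ^ (-p - q) * ((1 - θ) ^ (-p) * θ ^ (-q)) := by
  have h1 : 0 ≤ 1 - θ := sub_nonneg.2 hθ.2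
  rw [show t - t * θ = t * (1 - θ) by ring, Real.mul_rpow ht.le h1, Real.mul_rpow ht.le hθ.1,
    sub_eq_add_neg (-p), Real.rpow_add ht]
  ring

theorem integral_beta {p q t : ℝ} (ht : 0 < t) :
    ∫ t' in (0 : ℝ)..t, (t - t') ^ (-p) * t' ^ (-q) = t ^ (1 - p - q) * betaConst p q := by
  have h := intervalIntegral.smul_integral_comp_mul_left (a := 0) (b := 1)
    (fun t' : ℝ ↦ (t - t') ^ (-p) * t' ^ (-q)) t
  rw [mul_zero, mul_one] at h
  rw [← h, betaConst, smul_eq_mul, show 1 - p - q = 1 + (-p - q) by ring, Real.rpow_add ht,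
    Real.rpow_one, mul_assoc, ← intervalIntegral.integral_const_mul (t ^ (-p - q))]
  congr 1
  apply intervalIntegral.integral_congr
  intro θ hθ
  rw [uIcc_of_le zero_le_one] at hθ
  exact beta_scale ht hθ

theorem intervalIntegrable_beta_scaled {p q t : ℝ} (hp : p < 1) (hq : q < 1) (ht : 0 < t) :
    IntervalIntegrable (fun t' : ℝ ↦ (t - t') ^ (-p) * t' ^ (-q)) volume 0 t := by
  have h : IntervalIntegrable (fun θ : ℝ ↦ (t - t * θ) ^ (-p) * (t * θ) ^ (-q)) volume 0 1 := by
    refine ((intervalIntegrable_beta hp hq).const_mul (t ^ (-p - q))).congr ?_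
    intro θ hθ
    rw [uIoc_of_le zero_le_one] at hθ
    exact (beta_scale ht ⟨hθ.1.le, hθ.2⟩).symm
  have h2 := (IntervalIntegrable.comp_mul_left_iff (a := 0) (b := t)
    (f := fun t' : ℝ ↦ (t - t') ^ (-p) * t' ^ (-q)) (c := t) ht.ne'
    enorm_ne_top).1 (by simpa [ht.ne'] using h)
  exact h2

/-- A bound of the integrand by a Beta kernel bounds the integral. -/
theorem norm_integral_le_beta {E : Type*} [NormedAddCommGroup E] [NormedSpace ℝ E]
    {p q t C : ℝ} (hp : p < 1) (hq : q < 1) (ht : 0 < t) {f : ℝ → E}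
    (hf : ∀ t' ∈ Ioo 0 t, ‖f t'‖ ≤ C * ((t - t') ^ (-p) * t' ^ (-q))) :
    ‖∫ t' in (0 : ℝ)..t, f t'‖ ≤ C * (t ^ (1 - p - q) * betaConst p q) := by
  rw [← integral_beta ht, ← intervalIntegral.integral_const_mul]
  refine intervalIntegral.norm_integral_le_of_norm_le ht.le ?_
    ((intervalIntegrable_beta_scaled hp hq ht).const_mul C)
  filter_upwards [compl_mem_ae_iff.2 (measure_singleton t)] with t' h1 h2
  exact hf t' ⟨h2.1, lt_of_le_of_ne h2.2 h1⟩

open Classical in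
/-- The curve `t ↦ t^{-a} v(t)` on `(0,T]`, continued by `0`. -/
def unweight {E : Type*} [NormedAddCommGroup E] [NormedSpace ℝ E] (a : ℝ) {T : ℝ}
    (v : Ioc (0 : ℝ) T → E) (t : ℝ) : E :=
  if h : t ∈ Ioc 0 T then t ^ (-a) • v ⟨t, h⟩ else 0

theorem unweight_apply {E : Type*} [NormedAddCommGroup E] [NormedSpace ℝ E] (a : ℝ) {T : ℝ}
    (v : Ioc (0 : ℝ) T → E) (t : Ioc (0 : ℝ) T) :
    unweight a v t = (t : ℝ) ^ (-a) • v t := dif_pos t.2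

section fixedPoint

variable {E : Type*} [NormedAddCommGroup E] [NormedSpace ℂ E] {B : ℝ → E →L[ℂ] E →L[ℂ] E}
  {V : ℝ → E} {K M T p a : ℝ}

theorem duhamel_integrand_le (hM0 : 0 ≤ M) (hK : 0 ≤ K)
    (hB : ∀ τ ∈ Ioc 0 T, ∀ x y, ‖B τ x y‖ ≤ K * τ ^ (-p) * (‖x‖ * ‖y‖))
    (hM : ∀ t ∈ Ioc 0 T, ‖V t‖ ≤ M * t ^ (-a)) {t : ℝ} (ht : t ∈ Ioc 0 T) {t' : ℝ}
    (ht' : t' ∈ Ioo 0 t) : ‖B (t - t') (V t') (V t')‖ ≤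
      K * M ^ 2 * ((t - t') ^ (-p) * t' ^ (-(2 * a))) := by
  have h1 : 0 < t - t' := sub_pos.2 ht'.2
  have h2 := hM t' ⟨ht'.1, ht'.2.le.trans ht.2⟩
  have h3 : t' ^ (-(2 * a)) = t' ^ (-a) * t' ^ (-a) := by
    rw [← Real.rpow_add ht'.1]
    congr 1
    ring
  have h4 : 0 < t' ^ (-a) := Real.rpow_pos_of_pos ht'.1 _
  calc _ ≤ K * (t - t') ^ (-p) * (‖V t'‖ * ‖V t'‖) :=
        hB _ ⟨h1, by linarith [ht'.1, ht.2]⟩ _ _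
    _ ≤ K * (t - t') ^ (-p) * ((M * t' ^ (-a)) * (M * t' ^ (-a))) := by gcongr
    _ = _ := by
        rw [h3]
        ring

theorem duhamel_intervalIntegrable (hM0 : 0 ≤ M) (hK : 0 ≤ K) (hp : p < 1) (ha : 2 * a < 1)
    (hBc : ContinuousOn B (Ioi 0))
    (hB : ∀ τ ∈ Ioc 0 T, ∀ x y, ‖B τ x y‖ ≤ K * τ ^ (-p) * (‖x‖ * ‖y‖))
    (hVc : ContinuousOn V (Ioc 0 T))
    (hM : ∀ t ∈ Ioc 0 T, ‖V t‖ ≤ M * t ^ (-a)) {t : ℝ} (ht : t ∈ Ioc 0 T) :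
    IntervalIntegrable (fun t' ↦ B (t - t') (V t') (V t')) volume 0 t := by
  have hc : ContinuousOn (fun t' ↦ B (t - t') (V t') (V t')) (Ioo 0 t) := by
    have h1 : ContinuousOn (fun t' ↦ B (t - t')) (Ioo 0 t) :=
      hBc.comp (by fun_prop) fun t' h ↦ mem_Ioi.2 (sub_pos.2 h.2)
    have h2 : ContinuousOn V (Ioo 0 t) :=
      hVc.mono fun t' h ↦ ⟨h.1, h.2.le.trans ht.2⟩
    exact (h1.clm_apply h2).clm_apply h2
  refine (((intervalIntegrable_beta_scaled hp ha ht.1).const_mul (K * M ^ 2))).mono_fun ?_ ?_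
  · rw [uIoc_of_le ht.1.le, ← restrict_Ioo_eq_restrict_Ioc]
    exact hc.aestronglyMeasurable measurableSet_Ioo
  · rw [uIoc_of_le ht.1.le, ← restrict_Ioo_eq_restrict_Ioc]
    refine (ae_restrict_iff' measurableSet_Ioo).2 (Eventually.of_forall fun t' ht' ↦ ?_)
    exact (duhamel_integrand_le hM0 hK hB hM ht ht').trans (le_abs_self _)

variable [NormedSpace ℝ E]

/-- The substitution `t' = tθ` makes dominated convergence applicable: both endpoint
singularities of the integrand stay at fixed places. -/
theorem duhamel_continuousOn (hM0 : 0 ≤ M) (hK : 0 ≤ K) (hp : p < 1) (ha : 2 * a < 1)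
    (hpa : p + a ≤ 1) (hBc : ContinuousOn B (Ioi 0))
    (hB : ∀ τ ∈ Ioc 0 T, ∀ x y, ‖B τ x y‖ ≤ K * τ ^ (-p) * (‖x‖ * ‖y‖))
    (hVc : ContinuousOn V (Ioc 0 T))
    (hM : ∀ t ∈ Ioc 0 T, ‖V t‖ ≤ M * t ^ (-a)) :
    ContinuousOn (fun t ↦ t ^ a • ∫ t' in (0 : ℝ)..t, B (t - t') (V t') (V t')) (Ioc 0 T) := by
  have e : ∀ t, (∫ t' in (0 : ℝ)..t, B (t - t') (V t') (V t')) =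
      t • ∫ θ in (0 : ℝ)..1, B (t - t * θ) (V (t * θ)) (V (t * θ)) := by
    intro t
    have h := intervalIntegral.smul_integral_comp_mul_left (a := 0) (b := 1)
      (fun t' ↦ B (t - t') (V t') (V t')) t
    rw [mul_zero, mul_one] at h
    exact h.symm
  have e2 : (fun t ↦ t ^ a • ∫ t' in (0 : ℝ)..t, B (t - t') (V t') (V t')) =
      fun t ↦ ∫ θ in Ioo (0 : ℝ) 1, (t ^ a * t) • B (t - t * θ) (V (t * θ)) (V (t * θ)) := by
    ext t
    rw [e, smul_smul, intervalIntegral.integral_of_le zero_le_one, integral_smul,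
      restrict_Ioo_eq_restrict_Ioc]
  rw [e2]
  have hmem : ∀ t ∈ Ioc 0 T, ∀ θ ∈ Ioo (0 : ℝ) 1, t * θ ∈ Ioo 0 t := fun t ht θ hθ ↦
    ⟨mul_pos ht.1 hθ.1, mul_lt_of_lt_one_right ht.1 hθ.2⟩
  refine continuousOn_of_dominated
    (bound := fun θ ↦ K * M ^ 2 * T ^ (1 - p - a) * ((1 - θ) ^ (-p) * θ ^ (-(2 * a)))) ?_ ?_ ?_ ?_
  · intro t ht
    have hc : ContinuousOn (fun θ ↦ (t ^ a * t) • B (t - t * θ) (V (t * θ)) (V (t * θ)))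
        (Ioo 0 1) := by
      have h1 : ContinuousOn (fun θ ↦ B (t - t * θ)) (Ioo 0 1) :=
        hBc.comp (by fun_prop) fun θ h ↦ mem_Ioi.2 (sub_pos.2 (hmem t ht θ h).2)
      have h2 : ContinuousOn (fun θ ↦ V (t * θ)) (Ioo 0 1) :=
        hVc.comp (by fun_prop) fun θ h ↦ ⟨(hmem t ht θ h).1, (hmem t ht θ h).2.le.trans ht.2⟩
      exact ((h1.clm_apply h2).clm_apply h2).const_smul _
    exact hc.aestronglyMeasurable measurableSet_Ioo
  · intro t ht
    refine (ae_restrict_iff' measurableSet_Ioo).2 (Eventually.of_forall fun θ hθ ↦ ?_)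
    have h1 := duhamel_integrand_le hM0 hK hB hM ht (hmem t ht θ hθ)
    rw [beta_scale ht.1 ⟨hθ.1.le, hθ.2.le⟩] at h1
    have h2 : 0 < t ^ a * t := mul_pos (Real.rpow_pos_of_pos ht.1 _) ht.1
    have h3 : 0 < 1 - θ := sub_pos.2 hθ.2
    have h4 := hθ.1
    have h5 : t ^ a * t * t ^ (-p - 2 * a) = t ^ (1 - p - a) := by
      nth_rewrite 2 [← Real.rpow_one t]
      rw [← Real.rpow_add ht.1, ← Real.rpow_add ht.1]
      congr 1
      ring
    rw [norm_smul, Real.norm_of_nonneg h2.le]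
    calc _ ≤ t ^ a * t * (K * M ^ 2 * (t ^ (-p - 2 * a) * ((1 - θ) ^ (-p) * θ ^ (-(2 * a))))) := by
          gcongr
      _ = K * M ^ 2 * (t ^ a * t * t ^ (-p - 2 * a)) * ((1 - θ) ^ (-p) * θ ^ (-(2 * a))) := by
          ring
      _ ≤ _ := by
          rw [h5]
          gcongr
          · exact ht.1.le
          · linarith
          · exact ht.2
  · have := (intervalIntegrable_beta hp ha).const_mul (K * M ^ 2 * T ^ (1 - p - a))
    rw [intervalIntegrable_iff_integrableOn_Ioo_of_le zero_le_one] at this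
    exact this
  · refine (ae_restrict_iff' measurableSet_Ioo).2 (Eventually.of_forall fun θ hθ ↦ ?_)
    have h0 : ContinuousOn (fun t : ℝ ↦ t ^ a * t) (Ioc 0 T) := by
      refine ContinuousOn.mul (fun t ht ↦ ?_) continuousOn_id
      exact (Real.continuousAt_rpow_const t a (Or.inl ht.1.ne')).continuousWithinAt
    have h1 : ContinuousOn (fun t ↦ B (t - t * θ)) (Ioc 0 T) :=
      hBc.comp (by fun_prop) fun t h ↦ mem_Ioi.2 (sub_pos.2 (hmem t h θ hθ).2)
    have h2 : ContinuousOn (fun t ↦ V (t * θ)) (Ioc 0 T) :=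
      hVc.comp (by fun_prop) fun t h ↦ ⟨(hmem t h θ hθ).1, (hmem t h θ hθ).2.le.trans h.2⟩
    exact h0.smul ((h1.clm_apply h2).clm_apply h2)

/-- The fixed point of `V ↦ g - ∫₀ᵗ B(t - t')(V, V) dt'` in a ball of the space of the curves `V`
on `(0,T]` for which `t^a V(t)` is bounded and continuous. -/
theorem exists_duhamel_fixedPoint [CompleteSpace E] {G : ℝ} (hG : 0 < G) (hK : 0 ≤ K) (hT : 0 < T)
    (hp : p < 1) (ha : 2 * a < 1) (hpa : p + a ≤ 1) (hBc : ContinuousOn B (Ioi 0))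
    (hB : ∀ τ ∈ Ioc 0 T, ∀ x y, ‖B τ x y‖ ≤ K * τ ^ (-p) * (‖x‖ * ‖y‖))
    {g : ℝ → E} (hgc : ContinuousOn (fun t ↦ t ^ a • g t) (Ioc 0 T))
    (hg : ∀ t ∈ Ioc 0 T, ‖t ^ a • g t‖ ≤ G)
    (hsmall : 8 * (K * (T ^ (1 - p - a) * betaConst p (2 * a))) * G ≤ 1) :
    ∃ V : ℝ → E, ContinuousOn V (Ioc 0 T) ∧ (∀ t ∈ Ioc 0 T, ‖V t‖ ≤ 2 * G * t ^ (-a)) ∧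
      ∀ t ∈ Ioc 0 T, V t = g t - ∫ t' in (0 : ℝ)..t, B (t - t') (V t') (V t') := by
  set c := T ^ (1 - p - a) * betaConst p (2 * a) with hc
  have hβ := betaConst_nonneg p (2 * a)
  have hc0 : 0 ≤ c := by positivity
  set X := BoundedContinuousFunction (Ioc (0 : ℝ) T) E with hX
  have hVc : ∀ v : X, ContinuousOn (unweight a v) (Ioc 0 T) := by
    intro v
    rw [continuousOn_iff_continuous_domRestrict]
    have h1 : Continuous fun t : Ioc (0 : ℝ) T ↦ (t : ℝ) ^ (-a) • v t := by
      refine Continuous.smul ?_ v.continuous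
      exact continuous_subtype_val.rpow_const fun t ↦ Or.inl t.2.1.ne'
    exact h1.congr fun t ↦ (unweight_apply a v t).symm
  have hVle : ∀ (v : X) (M : ℝ), ‖v‖ ≤ M → ∀ t ∈ Ioc 0 T, ‖unweight a v t‖ ≤ M * t ^ (-a) := by
    intro v M hM t ht
    have h0 : 0 < t ^ (-a) := Real.rpow_pos_of_pos ht.1 _
    have h1 : unweight a v t = t ^ (-a) • v ⟨t, ht⟩ := unweight_apply a v ⟨t, ht⟩
    rw [h1, norm_smul, Real.norm_of_nonneg h0.le, mul_comm]
    gcongr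
    exact (v.norm_coe_le_norm _).trans hM
  have hint : ∀ (v : X) (t : ℝ), t ∈ Ioc 0 T → IntervalIntegrable
      (fun t' ↦ B (t - t') (unweight a v t') (unweight a v t')) volume 0 t := fun v t ht ↦
    duhamel_intervalIntegrable (norm_nonneg v) hK hp ha hBc hB (hVc v) (hVle v _ le_rfl) ht
  have hbeta : ∀ (C : ℝ) (t : ℝ) (f : ℝ → E), 0 ≤ C → t ∈ Ioc 0 T →
      (∀ t' ∈ Ioo 0 t, ‖f t'‖ ≤ K * C * ((t - t') ^ (-p) * t' ^ (-(2 * a)))) →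
      ‖t ^ a • ∫ t' in (0 : ℝ)..t, f t'‖ ≤ K * c * C := by
    intro C t f hC ht hf
    have h1 := norm_integral_le_beta hp ha ht.1 hf
    have h0 : 0 < t ^ a := Real.rpow_pos_of_pos ht.1 _
    have h2 : t ^ a * t ^ (1 - p - 2 * a) ≤ T ^ (1 - p - a) := by
      rw [← Real.rpow_add ht.1, show a + (1 - p - 2 * a) = 1 - p - a by ring]
      exact Real.rpow_le_rpow ht.1.le ht.2 (by linarith)
    rw [norm_smul, Real.norm_of_nonneg h0.le]
    calc _ ≤ t ^ a * (K * C * (t ^ (1 - p - 2 * a) * betaConst p (2 * a))) := by gcongr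
      _ = K * C * ((t ^ a * t ^ (1 - p - 2 * a)) * betaConst p (2 * a)) := by ring
      _ ≤ K * C * (T ^ (1 - p - a) * betaConst p (2 * a)) := by gcongr
      _ = K * c * C := by
          rw [hc]
          ring
  have hΨle : ∀ (v : X) (t : ℝ), t ∈ Ioc 0 T → ‖t ^ a • g t -
      t ^ a • ∫ t' in (0 : ℝ)..t, B (t - t') (unweight a v t') (unweight a v t')‖ ≤
      G + K * c * ‖v‖ ^ 2 := by
    intro v t ht
    refine (norm_sub_le _ _).trans (add_le_add (hg t ht) ?_)
    exact hbeta _ t _ (by positivity) ht fun t' ht' ↦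
      duhamel_integrand_le (norm_nonneg v) hK hB (hVle v _ le_rfl) ht ht'
  have hΨc : ∀ v : X, Continuous fun t : Ioc (0 : ℝ) T ↦ (t : ℝ) ^ a • g t -
      (t : ℝ) ^ a • ∫ t' in (0 : ℝ)..t, B (t - t') (unweight a v t') (unweight a v t') := by
    intro v
    have h1 := hgc.sub (duhamel_continuousOn (norm_nonneg v) hK hp ha hpa hBc hB (hVc v)
      (hVle v _ le_rfl))
    rw [continuousOn_iff_continuous_domRestrict] at h1
    exact h1
  set Ψ : X → X := fun v ↦ BoundedContinuousFunction.ofNormedAddCommGroup _ (hΨc v) _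
    (fun t ↦ hΨle v t t.2) with hΨ
  have hΨapp : ∀ (v : X) (t : Ioc (0 : ℝ) T), Ψ v t = (t : ℝ) ^ a • g t -
      (t : ℝ) ^ a • ∫ t' in (0 : ℝ)..t, B (t - t') (unweight a v t') (unweight a v t') :=
    fun v t ↦ rfl
  have hmaps : MapsTo Ψ (Metric.closedBall 0 (2 * G)) (Metric.closedBall 0 (2 * G)) := by
    intro v hv
    rw [mem_closedBall_zero_iff] at hv ⊢
    refine (BoundedContinuousFunction.norm_le (by positivity)).2 fun t ↦ ?_
    refine (hΨle v t t.2).trans ?_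
    have h1 : K * c * ‖v‖ ^ 2 ≤ K * c * (2 * G) ^ 2 := by gcongr
    nlinarith
  have hcontr : ∀ v ∈ Metric.closedBall (0 : X) (2 * G), ∀ w ∈ Metric.closedBall (0 : X) (2 * G),
      dist (Ψ v) (Ψ w) ≤ (1 / 2 : NNReal) * dist v w := by
    intro v hv w hw
    rw [mem_closedBall_zero_iff] at hv hw
    have hd : 0 ≤ dist v w := dist_nonneg
    refine (BoundedContinuousFunction.dist_le (by positivity)).2 fun t ↦ ?_
    have ht := t.2
    have e : Ψ v t - Ψ w t = (t : ℝ) ^ a • ∫ t' in (0 : ℝ)..t,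
        (B (t - t') (unweight a w t') (unweight a w t') -
          B (t - t') (unweight a v t') (unweight a v t')) := by
      rw [hΨapp, hΨapp, intervalIntegral.integral_sub (hint w t ht) (hint v t ht), smul_sub]
      abel
    rw [dist_eq_norm, e]
    refine (hbeta (4 * G * dist v w) t _ (by positivity) ht fun t' ht' ↦ ?_).trans ?_
    · have h1 : 0 < (t : ℝ) - t' := sub_pos.2 ht'.2
      have ht'' : t' ∈ Ioc 0 T := ⟨ht'.1, ht'.2.le.trans ht.2⟩
      have h0 : 0 < t' ^ (-a) := Real.rpow_pos_of_pos ht'.1 _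
      have hτ : (t : ℝ) - t' ∈ Ioc 0 T := ⟨h1, by linarith [ht'.1, ht.2]⟩
      have hdiff : ‖unweight a w t' - unweight a v t'‖ ≤ dist v w * t' ^ (-a) := by
        have hw1 : unweight a w t' = t' ^ (-a) • w ⟨t', ht''⟩ := unweight_apply a w ⟨t', ht''⟩
        have hv1 : unweight a v t' = t' ^ (-a) • v ⟨t', ht''⟩ := unweight_apply a v ⟨t', ht''⟩
        rw [hw1, hv1, ← smul_sub, norm_smul, Real.norm_of_nonneg h0.le, mul_comm, ← dist_eq_norm,
          dist_comm]
        gcongr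
        exact BoundedContinuousFunction.dist_coe_le_dist _
      have e2 : B (t - t') (unweight a w t') (unweight a w t') -
          B (t - t') (unweight a v t') (unweight a v t') =
          B (t - t') (unweight a w t' - unweight a v t') (unweight a w t') +
          B (t - t') (unweight a v t') (unweight a w t' - unweight a v t') := by
        simp only [map_sub, _root_.sub_apply]
        abel
      have h3 : t' ^ (-(2 * a)) = t' ^ (-a) * t' ^ (-a) := by
        rw [← Real.rpow_add ht'.1]
        congr 1
        ring
      rw [e2]
      refine (norm_add_le _ _).trans ((add_le_add (hB _ hτ _ _) (hB _ hτ _ _)).trans ?_)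
      calc _ = K * ((t : ℝ) - t') ^ (-p) * (‖unweight a w t' - unweight a v t'‖ *
            (‖unweight a w t'‖ + ‖unweight a v t'‖)) := by ring
        _ ≤ K * ((t : ℝ) - t') ^ (-p) * ((dist v w * t' ^ (-a)) *
            (2 * G * t' ^ (-a) + 2 * G * t' ^ (-a))) := by
            gcongr
            · exact hVle w _ hw t' ht''
            · exact hVle v _ hv t' ht''
        _ = _ := by
            rw [h3]
            ring
    · push_cast
      nlinarith
  have hcw : ContractingWith (1 / 2) (hmaps.restrict Ψ _ _) := by
    refine ⟨?_, LipschitzWith.of_dist_le_mul fun v w ↦ hcontr v v.2 w w.2⟩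
    rw [← NNReal.coe_lt_coe]
    norm_num
  obtain ⟨v, hv, hfix, -⟩ := ContractingWith.exists_fixedPoint'
    (Metric.isClosed_closedBall.isComplete) hmaps hcw
    (Metric.mem_closedBall_self (by positivity)) (edist_ne_top _ _)
  rw [mem_closedBall_zero_iff] at hv
  refine ⟨unweight a v, hVc v, hVle v _ hv, fun t ht ↦ ?_⟩
  have h1 : unweight a v t = t ^ (-a) • v ⟨t, ht⟩ := unweight_apply a v ⟨t, ht⟩
  have h2 : v ⟨t, ht⟩ = t ^ a • g t -
      t ^ a • ∫ t' in (0 : ℝ)..t, B (t - t') (unweight a v t') (unweight a v t') := by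
    rw [← hΨapp v ⟨t, ht⟩, hfix]
  rw [h1, h2, ← smul_sub, smul_smul, ← Real.rpow_add ht.1, neg_add_cancel, Real.rpow_zero,
    one_smul]

end fixedPoint

/-! ### Local existence -/

theorem wt_symbol_memLp {η t p : ℝ} (hη : 0 < η) (ht : 0 < t) (hp : 0 ≤ p) (hp1 : p ≤ 1) (β : ℝ) :
    MemLp (fun ξ ↦ ((wt (2 * p) ξ : ℝ) : ℂ) * symbol β η t ξ) ⊤ volume := by
  refine memLp_top_of_norm_le ?_ (norm_wt_symbol_le hη ht le_rfl hp hp1 β)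
  exact ((Complex.continuous_ofReal.comp (continuous_wt _)).mul
    (continuous_symbol β η t)).measurable

theorem mulOp_wt_symbol_add {η t t' p : ℝ} (hη : 0 < η) (ht : 0 < t) (ht' : 0 ≤ t') (hp : 0 ≤ p)
    (hp1 : p ≤ 1) (β : ℝ) (Φ : Lp ℂ 2 (volume : Measure ℝ)) :
    mulOp (fun ξ ↦ ((wt (2 * p) ξ : ℝ) : ℂ) * symbol β η (t + t') ξ) Φ =
      mulOp (fun ξ ↦ ((wt (2 * p) ξ : ℝ) : ℂ) * symbol β η t ξ) (mulOp (symbol β η t') Φ) := by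
  have e : (fun ξ ↦ ((wt (2 * p) ξ : ℝ) : ℂ) * symbol β η (t + t') ξ) =
      fun ξ ↦ (((wt (2 * p) ξ : ℝ) : ℂ) * symbol β η t ξ) * symbol β η t' ξ := by
    ext ξ
    rw [symbol_add, mul_assoc]
  have h := wt_symbol_memLp hη (add_pos_of_pos_of_nonneg ht ht') hp hp1 β
  rw [e] at h ⊢
  exact (mulOp_mulOp (wt_symbol_memLp hη ht hp hp1 β) (symbol_memLp hη ht' β) h Φ).symm

theorem continuousOn_mulOp_wt_symbol {η p : ℝ} (hη : 0 < η) (hp : 0 ≤ p) (hp1 : p ≤ 1) (β : ℝ)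
    (Φ : Lp ℂ 2 (volume : Measure ℝ)) : ContinuousOn
      (fun t ↦ mulOp (fun ξ ↦ ((wt (2 * p) ξ : ℝ) : ℂ) * symbol β η t ξ) Φ) (Ioi 0) := by
  intro t₀ ht₀
  have ht₀' : 0 < t₀ := ht₀
  have h1 : ContinuousOn (fun t ↦ mulOp (symbol β η (t - t₀ / 2)) Φ) (Ici (t₀ / 2)) :=
    (continuousOn_mulOp_symbol hη β Φ).comp (f := fun t ↦ t - t₀ / 2) (by fun_prop)
      fun t ht ↦ mem_Ici.2 (sub_nonneg.2 ht)
  have h2 : ContinuousOn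
      (fun t ↦ mulOp (fun ξ ↦ ((wt (2 * p) ξ : ℝ) : ℂ) * symbol β η t ξ) Φ) (Ici (t₀ / 2)) := by
    refine ((mulOp fun ξ ↦ ((wt (2 * p) ξ : ℝ) : ℂ) *
      symbol β η (t₀ / 2) ξ).continuous.comp_continuousOn h1).congr fun t ht ↦ ?_
    have h3 := mulOp_wt_symbol_add hη (half_pos ht₀') (sub_nonneg.2 ht) hp hp1 β Φ
    rw [add_sub_cancel] at h3
    exact h3
  exact (h2.continuousAt (Ici_mem_nhds (half_lt_self ht₀'))).continuousWithinAt

theorem mulOp_wt_neg_mulOp {r : ℝ} (hr : 0 ≤ r) {m : ℝ → ℂ}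
    (hm : MemLp m ⊤ volume) (hrm : MemLp (fun ξ ↦ ((wt r ξ : ℝ) : ℂ) * m ξ) ⊤ volume)
    (Φ : Lp ℂ 2 (volume : Measure ℝ)) :
    mulOp (fun ξ ↦ ((wt (-r) ξ : ℝ) : ℂ)) (mulOp (fun ξ ↦ ((wt r ξ : ℝ) : ℂ) * m ξ) Φ) =
      mulOp m Φ := by
  have e : (fun ξ ↦ ((wt (-r) ξ : ℝ) : ℂ) * (((wt r ξ : ℝ) : ℂ) * m ξ)) = m := by
    ext ξ
    rw [← mul_assoc, ← Complex.ofReal_mul, wt_neg_mul, Complex.ofReal_one, one_mul]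
  rw [mulOp_mulOp (wt_memLp (by linarith)) hrm (by rwa [e]), e]

theorem mulOp_wt_duhamel {σ η τ a : ℝ} (hσ : 0 ≤ σ) (hη : 0 < η) (hτ : 0 < τ) (ha : 0 ≤ a)
    (ha' : a ≤ 1 / 2) (β : ℝ) (V₁ V₂ : Lp ℂ 2 (volume : Measure ℝ)) :
    mulOp (fun ξ ↦ ((wt (-(2 * a)) ξ : ℝ) : ℂ)) (duhamel hσ β η 0 τ V₁ V₂) =
      duhamel hσ β η a τ V₁ V₂ := by
  apply Lp.ext
  filter_upwards [mulOp_coe (wt_memLp (r := -(2 * a)) (by linarith)) (duhamel hσ β η 0 τ V₁ V₂),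
    duhamel_coe hσ hη hτ le_rfl (by norm_num) β V₁ V₂, duhamel_coe hσ hη hτ ha ha' β V₁ V₂]
    with ξ h1 h2 h3
  rw [h1, h2, h3, kerFun, kerFun, mul_zero, neg_zero, wt_zero]
  push_cast
  ring

theorem mulOp_symbol_zero (β η : ℝ) (Φ : Lp ℂ 2 (volume : Measure ℝ)) :
    mulOp (symbol β η 0) Φ = Φ := by
  rw [show symbol β η 0 = fun _ ↦ 1 from funext (symbol_zero β η), mulOp_one]

theorem mulOp_wt_integral {σ η a t : ℝ} (hσ : 0 ≤ σ) (hη : 0 < η) (ht : 0 ≤ t) (ha : 0 ≤ a)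
    (ha' : a ≤ 1 / 2) (β : ℝ) {V : ℝ → Lp ℂ 2 (volume : Measure ℝ)}
    (hi : IntervalIntegrable (fun t' ↦ duhamel hσ β η 0 (t - t') (V t') (V t')) volume 0 t) :
    mulOp (fun ξ ↦ ((wt (-(2 * a)) ξ : ℝ) : ℂ))
        (∫ t' in (0 : ℝ)..t, duhamel hσ β η 0 (t - t') (V t') (V t')) =
      ∫ t' in (0 : ℝ)..t, duhamel hσ β η a (t - t') (V t') (V t') := by
  rw [← ContinuousLinearMap.intervalIntegral_comp_comm _ hi]
  refine intervalIntegral.integral_congr_ae ?_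
  filter_upwards [compl_mem_ae_iff.2 (measure_singleton t)] with t' h1 h2
  rw [uIoc_of_le ht] at h2
  exact mulOp_wt_duhamel hσ hη (sub_pos.2 (lt_of_le_of_ne h2.2 h1)) ha ha' β _ _

/-- A curve that differs from a continuous one by `O(t^q)` is continuous at time `0`; in the
application the difference is the Duhamel term. -/
theorem continuousWithinAt_zero {E : Type*} [NormedAddCommGroup E] {U L : ℝ → E} {T C q : ℝ}
    (hq : 0 < q) (hL : ContinuousOn L (Ici 0)) (h0 : U 0 = L 0)
    (h : ∀ t ∈ Ioc 0 T, ‖U t - L t‖ ≤ C * t ^ q) : ContinuousWithinAt U (Icc 0 T) 0 := by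
  have h1 : Tendsto L (𝓝[Icc 0 T] 0) (𝓝 (L 0)) :=
    ((hL 0 self_mem_Ici).mono Icc_subset_Ici_self)
  have h2 : Tendsto (fun t : ℝ ↦ C * t ^ q) (𝓝[Icc 0 T] 0) (𝓝 0) := by
    have h3 : Tendsto (fun t : ℝ ↦ C * t ^ q) (𝓝 0) (𝓝 (C * 0 ^ q)) :=
      ((Real.continuousAt_rpow_const 0 q (Or.inr hq.le)).tendsto).const_mul C
    rw [Real.zero_rpow hq.ne', mul_zero] at h3
    exact h3.mono_left nhdsWithin_le_nhds
  have h4 : Tendsto (fun t ↦ U t - L t) (𝓝[Icc 0 T] 0) (𝓝 0) := by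
    refine squeeze_zero_norm' ?_ h2
    filter_upwards [self_mem_nhdsWithin] with t ht
    rcases ht.1.eq_or_lt with h5 | h5
    · rw [← h5, h0, sub_self, norm_zero, Real.zero_rpow hq.ne', mul_zero]
    · exact h t ⟨h5, ht.2⟩
  have h5 := h4.add h1
  simp only [sub_add_cancel, zero_add] at h5
  rw [← h0] at h5
  exact h5

/-- Local existence, on a time interval that does not depend on `β`. -/
theorem exists_isSolution {s σ a η : ℝ} (hs : s = σ - 2 * a) (hσ : 0 ≤ σ) (ha : 0 ≤ a)
    (ha' : a < 1 / 4) (hσa : σ = 0 ∨ a = 0) (hη : 0 < η) (R : ℝ) :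
    ∃ T : ℝ, 0 < T ∧ ∀ φ : Hs s, ‖φ‖ ≤ R → ∀ β : ℝ, ∃ u : ℝ → Hs s, IsSolution β η s T φ u := by
  set S := smoothConst η 1 with hS
  have hS0 : 0 < S := smoothConst_pos hη 1
  set K := bilinConst η σ 1 with hK
  have hK0 : 0 < K := bilinConst_pos hη σ 1
  set G := S * (|R| + 1) with hG
  have hG0 : 0 < G := by positivity
  have hβ := betaConst_nonneg (3 / 4) (2 * a)
  have hq : 0 < 1 - 3 / 4 - a := by linarith
  -- `T` makes the contraction constant `8 K B(1/4, 1 - 2a) T^{1/4 - a} G` at most one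
  set x := 8 * K * betaConst (3 / 4) (2 * a) * G with hx
  have hx0 : 0 ≤ x := by positivity
  set T := ((x + 1)⁻¹) ^ (1 - 3 / 4 - a)⁻¹ with hT
  have hT0 : 0 < T := by positivity
  have hT1 : T ≤ 1 :=
    Real.rpow_le_one (by positivity) (inv_le_one_of_one_le₀ (by linarith)) (by positivity)
  have hTq : T ^ (1 - 3 / 4 - a) = (x + 1)⁻¹ := by
    rw [hT, ← Real.rpow_mul (by positivity), inv_mul_cancel₀ hq.ne', Real.rpow_one]
  have hsmall : 8 * (K * (T ^ (1 - 3 / 4 - a) * betaConst (3 / 4) (2 * a))) * G ≤ 1 := by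
    rw [hTq]
    calc _ = x * (x + 1)⁻¹ := by
          rw [hx]
          ring
      _ ≤ 1 := by
          rw [← div_eq_mul_inv, div_le_one (by linarith)]
          linarith
  refine ⟨T, hT0, fun φ hφ β ↦ ?_⟩
  set Φ := freq s φ with hΦ
  have hΦR : ‖Φ‖ ≤ |R| + 1 := by
    rw [hΦ, LinearIsometryEquiv.norm_map]
    linarith [le_abs_self R]
  set g : ℝ → Lp ℂ 2 (volume : Measure ℝ) := fun t ↦
    mulOp (fun ξ ↦ ((wt (2 * a) ξ : ℝ) : ℂ) * symbol β η t ξ) Φ with hg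
  have hB : ∀ θ, 0 ≤ θ → θ ≤ 1 / 2 → ∀ τ ∈ Ioc 0 T, ∀ x y,
      ‖duhamel hσ β η θ τ x y‖ ≤ K * τ ^ (-(3 / 4 - θ)) * (‖x‖ * ‖y‖) :=
    fun θ hθ hθ1 τ hτ x y ↦ norm_duhamel_le hσ hη hτ.1 (hτ.2.trans hT1) hθ hθ1 β x y
  have hB0 : ∀ τ ∈ Ioc 0 T, ∀ x y,
      ‖duhamel hσ β η 0 τ x y‖ ≤ K * τ ^ (-(3 / 4) : ℝ) * (‖x‖ * ‖y‖) := by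
    have := hB 0 le_rfl (by norm_num)
    simpa only [sub_zero] using this
  have hgc : ContinuousOn (fun t ↦ t ^ a • g t) (Ioc 0 T) := by
    have h1 : ContinuousOn g (Ioc 0 T) :=
      (continuousOn_mulOp_wt_symbol hη ha (by linarith) β Φ).mono fun t ht ↦ ht.1
    have h2 : ContinuousOn (fun t : ℝ ↦ t ^ a) (Ioc 0 T) := fun t ht ↦
      (Real.continuousAt_rpow_const t a (Or.inl ht.1.ne')).continuousWithinAt
    exact h2.smul h1
  have hgG : ∀ t ∈ Ioc 0 T, ‖t ^ a • g t‖ ≤ G := by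
    intro t ht
    have h0 : 0 < t ^ a := Real.rpow_pos_of_pos ht.1 _
    have h00 : 0 < t ^ (-a) := Real.rpow_pos_of_pos ht.1 _
    have h1 : ‖g t‖ ≤ S * t ^ (-a) * ‖Φ‖ := by
      refine norm_mulOp_le ?_ (by positivity)
        (norm_wt_symbol_le hη ht.1 (ht.2.trans hT1) ha (by linarith) β) Φ
      exact ((Complex.continuous_ofReal.comp (continuous_wt _)).mul
        (continuous_symbol β η t)).measurable
    rw [norm_smul, Real.norm_of_nonneg h0.le]
    calc _ ≤ t ^ a * (S * t ^ (-a) * ‖Φ‖) := by gcongr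
      _ = S * ‖Φ‖ * (t ^ a * t ^ (-a)) := by ring
      _ ≤ G := by
          rw [← Real.rpow_add ht.1, add_neg_cancel, Real.rpow_zero, mul_one, hG]
          gcongr
  have hBc := fun θ (hθ : 0 ≤ θ) (hθ1 : θ ≤ 1 / 2) ↦ continuousOn_duhamel hσ hη hθ hθ1 β
  obtain ⟨V, hVc, hVM, hVeq⟩ := exists_duhamel_fixedPoint hG0 hK0.le hT0 (by norm_num)
    (by linarith) (by linarith) (hBc 0 le_rfl (by norm_num)) hB0 hgc hgG hsmall
  have hi0 : ∀ t ∈ Ioc 0 T, IntervalIntegrable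
      (fun t' ↦ duhamel hσ β η 0 (t - t') (V t') (V t')) volume 0 t := fun t ht ↦
    duhamel_intervalIntegrable (by positivity) hK0.le (by norm_num) (by linarith)
      (hBc 0 le_rfl (by norm_num)) hB0 hVc hVM ht
  have hia : ∀ t ∈ Ioc 0 T, IntervalIntegrable
      (fun t' ↦ duhamel hσ β η a (t - t') (V t') (V t')) volume 0 t := fun t ht ↦
    duhamel_intervalIntegrable (by positivity) hK0.le (by linarith) (by linarith)
      (hBc a ha (by linarith)) (hB a ha (by linarith)) hVc hVM ht
  set U : ℝ → Lp ℂ 2 (volume : Measure ℝ) := fun t ↦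
    if t ≤ 0 then Φ else mulOp (fun ξ ↦ ((wt (-(2 * a)) ξ : ℝ) : ℂ)) (V t) with hU
  have hUw : ∀ t ∈ Ioc 0 T, U t = mulOp (fun ξ ↦ ((wt (-(2 * a)) ξ : ℝ) : ℂ)) (V t) :=
    fun t ht ↦ if_neg (not_le.2 ht.1)
  have hU0 : U 0 = Φ := if_pos le_rfl
  have hUeq : ∀ t ∈ Ioc 0 T, U t = mulOp (symbol β η t) Φ -
      ∫ t' in (0 : ℝ)..t, duhamel hσ β η a (t - t') (V t') (V t') := by
    intro t ht
    rw [hUw t ht, hVeq t ht, map_sub, mulOp_wt_integral hσ hη ht.1.le ha (by linarith) β (hi0 t ht),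
      mulOp_wt_neg_mulOp (by linarith) (symbol_memLp hη ht.1.le β)
        (wt_symbol_memLp hη ht.1 ha (by linarith) β)]
  have hUc : ContinuousOn U (Icc 0 T) := by
    intro t ht
    rcases ht.1.eq_or_lt with h0 | h0
    · rw [← h0]
      refine continuousWithinAt_zero (q := 1 - (3 / 4 - a) - 2 * a)
        (C := K * (2 * G) ^ 2 * betaConst (3 / 4 - a) (2 * a)) (by linarith)
        (continuousOn_mulOp_symbol hη β Φ) ?_ fun t ht ↦ ?_
      · rw [hU0, mulOp_symbol_zero]
      · rw [hUeq t ht, sub_sub_cancel_left, norm_neg]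
        refine (norm_integral_le_beta (p := 3 / 4 - a) (q := 2 * a) (C := K * (2 * G) ^ 2)
          (by linarith) (by linarith) ht.1
          fun t' ht' ↦ duhamel_integrand_le (by positivity) hK0.le
            (hB a ha (by linarith)) hVM ht ht').trans (le_of_eq ?_)
        ring
    · have h1 : ContinuousOn U (Ioc 0 T) :=
        ((mulOp fun ξ ↦ ((wt (-(2 * a)) ξ : ℝ) : ℂ)).continuous.comp_continuousOn hVc).congr hUw
      have h2 : Ioc 0 T ∈ 𝓝[Icc 0 T] t := by
        filter_upwards [self_mem_nhdsWithin, nhdsWithin_le_nhds (lt_mem_nhds h0)] with r h3 h4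
        exact ⟨h4, h3.2⟩
      exact (h1 t ⟨h0, ht.2⟩).mono_of_mem_nhdsWithin h2
  have hmild : IsMild hσ β η a T (freq s φ) U V := ⟨hUw, hia, hUeq⟩
  exact hmild.exists_isSolution hs ha (by linarith) hσa hη hU0 hUc hVM

/-! ### Stability of mild solutions -/

open scoped InnerProductSpace

/-- A singular Gronwall inequality in abstract form. The hypothesis `H` says that a bound of the
integrand by `c (t - t')^{-δ}` bounds `f t` by `ε + κ c`; no measurability of `f` is needed. The
bound `f t ≤ ρ e^{lt}` is propagated in steps of a length that depends on the rough bound `M'`. -/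
theorem singular_gronwall {f : ℝ → ℝ} {T δ κ M₀ M' ρ ε l : ℝ} (hδ : 0 < δ)
    (hδ1 : δ ≤ 1) (hκ : 0 ≤ κ) (hM₀ : 0 ≤ M₀) (hM' : 0 ≤ M') (hρ : 0 < ρ) (hl : 0 < l)
    (hf0 : ∀ t ∈ Ioc 0 T, 0 ≤ f t) (hfM : ∀ t ∈ Ioc 0 T, f t ≤ M')
    (H : ∀ t ∈ Ioc 0 T, ∀ c, 0 ≤ c →
      (∀ t' ∈ Ioo 0 t, 2 * M₀ * f t' + f t' ^ 2 ≤ c * (t - t') ^ (-δ)) → f t ≤ ε + κ * c)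
    (hlκ : κ * (2 * M₀ + 1) * l ^ (-δ) ≤ 1 / 2) (hρl : ρ * Real.exp (l * T) ≤ 1)
    (hε : ε ≤ ρ / 4) : ∀ t ∈ Ioc 0 T, f t ≤ ρ * Real.exp (l * t) := by
  -- the step `h` is chosen such that the rough bound contributes at most `ρ / 4` on its length
  obtain ⟨h, hh0, hh⟩ : ∃ h : ℝ, 0 < h ∧ κ * ((2 * M₀ + M') * M' * h ^ δ) ≤ ρ / 4 := by
    set x := κ * ((2 * M₀ + M') * M') with hx
    have hx0 : 0 ≤ x := by positivity
    refine ⟨(ρ / 4 / (x + 1)) ^ δ⁻¹, by positivity, ?_⟩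
    rw [← Real.rpow_mul (by positivity), inv_mul_cancel₀ hδ.ne', Real.rpow_one]
    calc _ = x / (x + 1) * (ρ / 4) := by
          rw [hx]
          field_simp
      _ ≤ 1 * (ρ / 4) := by
          gcongr
          rw [div_le_one (by linarith)]
          linarith
      _ = _ := one_mul _
  have key : ∀ n : ℕ, ∀ t ∈ Ioc 0 T, t ≤ n * h → f t ≤ ρ * Real.exp (l * t) := by
    intro n
    induction n with
    | zero =>
      intro t ht htn
      rw [Nat.cast_zero, zero_mul] at htn
      exact absurd ht.1 (not_lt.2 htn)
    | succ n ih =>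
      intro t ht htn
      set c := (2 * M₀ + 1) * ρ * Real.exp (l * t) * l ^ (-δ) + (2 * M₀ + M') * M' * h ^ δ with hc
      have hlδ : 0 < l ^ (-δ) := Real.rpow_pos_of_pos hl _
      have hhδ : 0 < h ^ δ := Real.rpow_pos_of_pos hh0 _
      have hA : 0 ≤ (2 * M₀ + 1) * ρ * Real.exp (l * t) * l ^ (-δ) := by positivity
      have hB : 0 ≤ (2 * M₀ + M') * M' * h ^ δ := by positivity
      have hft := H t ht c (by positivity) fun t' ht' ↦ by
        have hτ : 0 < t - t' := sub_pos.2 ht'.2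
        have hτδ : 0 < (t - t') ^ (-δ) := Real.rpow_pos_of_pos hτ _
        have ht'T : t' ∈ Ioc 0 T := ⟨ht'.1, ht'.2.le.trans ht.2⟩
        have h0 := hf0 t' ht'T
        rcases le_or_gt t' (n * h) with h1 | h1
        · have h2 := ih t' ht'T h1
          have h3 : ρ * Real.exp (l * t') ≤ 1 := by
            refine le_trans ?_ hρl
            gcongr
            exact ht'T.2
          have h4 : Real.exp (l * t') ≤ Real.exp (l * t) * (l ^ (-δ) * (t - t') ^ (-δ)) := by
            have hy : 0 < l * (t - t') := mul_pos hl hτ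
            have h5 : Real.exp (-(l * (t - t'))) ≤ (l * (t - t')) ^ (-δ) := by
              rw [Real.exp_neg, Real.rpow_neg hy.le]
              apply inv_anti₀ (Real.rpow_pos_of_pos hy _)
              rcases le_total (l * (t - t')) 1 with h6 | h6
              · exact (Real.rpow_le_one hy.le h6 hδ.le).trans (Real.one_le_exp hy.le)
              · have h7 := Real.rpow_le_rpow_of_exponent_le h6 hδ1
                rw [Real.rpow_one] at h7
                linarith [Real.add_one_le_exp (l * (t - t'))]
            rw [← Real.mul_rpow hl.le hτ.le]
            calc Real.exp (l * t') = Real.exp (l * t) * Real.exp (-(l * (t - t'))) := by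
                  rw [← Real.exp_add]
                  congr 1
                  ring
              _ ≤ _ := by gcongr
          calc 2 * M₀ * f t' + f t' ^ 2 ≤ (2 * M₀ + 1) * (ρ * Real.exp (l * t')) := by
                nlinarith [mul_nonneg hM₀ h0]
            _ ≤ (2 * M₀ + 1) * (ρ * (Real.exp (l * t) * (l ^ (-δ) * (t - t') ^ (-δ)))) := by
                gcongr
            _ = ((2 * M₀ + 1) * ρ * Real.exp (l * t) * l ^ (-δ)) * (t - t') ^ (-δ) := by ring
            _ ≤ c * (t - t') ^ (-δ) := by
                gcongr
                linarith
        · have h2 := hfM t' ht'T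
          have h3 : t - t' ≤ h := by
            push_cast at htn
            linarith
          have h4 : 1 ≤ h ^ δ * (t - t') ^ (-δ) := by
            rw [Real.rpow_neg hτ.le, ← div_eq_mul_inv, ← Real.div_rpow hh0.le hτ.le]
            exact Real.one_le_rpow ((one_le_div hτ).2 h3) hδ.le
          calc 2 * M₀ * f t' + f t' ^ 2 ≤ (2 * M₀ + M') * M' * 1 := by
                nlinarith [mul_le_mul_of_nonneg_left h2 hM₀]
            _ ≤ (2 * M₀ + M') * M' * (h ^ δ * (t - t') ^ (-δ)) := by gcongr
            _ = ((2 * M₀ + M') * M' * h ^ δ) * (t - t') ^ (-δ) := by ring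
            _ ≤ c * (t - t') ^ (-δ) := by
                gcongr
                linarith
      have he : 1 ≤ Real.exp (l * t) := Real.one_le_exp (mul_pos hl ht.1).le
      have h9 : κ * c ≤ 1 / 2 * (ρ * Real.exp (l * t)) + ρ / 4 := by
        rw [hc, mul_add]
        refine add_le_add ?_ hh
        calc _ = (κ * (2 * M₀ + 1) * l ^ (-δ)) * (ρ * Real.exp (l * t)) := by ring
          _ ≤ _ := by gcongr
      nlinarith
  intro t ht
  obtain ⟨n, hn⟩ := exists_nat_ge (t / h)
  exact key n t ht ((div_le_iff₀ hh0).1 hn)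

/-- A symmetric injective operator has dense range, so that the norm of `X` can be tested on its
range. -/
theorem norm_le_of_inner_le {H : Type*} [NormedAddCommGroup H] [InnerProductSpace ℂ H]
    [CompleteSpace H] {A : H →L[ℂ] H} (hA : ∀ x y, ⟪A x, y⟫_ℂ = ⟪x, A y⟫_ℂ)
    (hinj : Function.Injective A) {X : H} {b : ℝ} (hb : 0 ≤ b)
    (h : ∀ Z, ‖⟪A Z, X⟫_ℂ‖ ≤ b * ‖A Z‖) : ‖X‖ ≤ b := by
  have hd : DenseRange A := by
    have h1 : (A : H →ₗ[ℂ] H).rangeᗮ = ⊥ := by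
      rw [Submodule.eq_bot_iff]
      intro y hy
      apply hinj
      rw [map_zero, ← inner_self_eq_zero (𝕜 := ℂ), ← hA]
      rw [Submodule.mem_orthogonal] at hy
      exact hy _ ⟨A y, rfl⟩
    have h2 := (Submodule.topologicalClosure_eq_top_iff).2 h1
    have h3 := Submodule.dense_iff_topologicalClosure_eq_top.2 h2
    exact h3
  have h4 : ∀ Y, ‖⟪Y, X⟫_ℂ‖ ≤ b * ‖Y‖ := fun Y ↦
    hd.induction_on (p := fun Y ↦ ‖⟪Y, X⟫_ℂ‖ ≤ b * ‖Y‖) Y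
      (isClosed_le (by fun_prop) (by fun_prop)) h
  have h5 := h4 X
  rw [inner_self_eq_norm_sq_to_K, norm_pow, RCLike.norm_ofReal, abs_norm, sq] at h5
  rcases (norm_nonneg X).eq_or_lt with h6 | h6
  · rw [← h6]
    exact hb
  · exact le_of_mul_le_mul_right h5 h6

theorem inner_mulOp_wt {r : ℝ} (hr : r ≤ 0) (x y : Lp ℂ 2 (volume : Measure ℝ)) :
    ⟪mulOp (fun ξ ↦ ((wt r ξ : ℝ) : ℂ)) x, y⟫_ℂ =
      ⟪x, mulOp (fun ξ ↦ ((wt r ξ : ℝ) : ℂ)) y⟫_ℂ := by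
  rw [MeasureTheory.L2.inner_def, MeasureTheory.L2.inner_def]
  refine integral_congr_ae ?_
  filter_upwards [mulOp_coe (wt_memLp hr) x, mulOp_coe (wt_memLp hr) y] with ξ h1 h2
  rw [h1, h2, RCLike.inner_apply, RCLike.inner_apply, map_mul, Complex.conj_ofReal]
  ring

theorem mulOp_wt_injective {r : ℝ} (hr : r ≤ 0) :
    Function.Injective (mulOp fun ξ ↦ ((wt r ξ : ℝ) : ℂ)) := by
  intro x y hxy
  apply Lp.ext
  have h1 := mulOp_coe (wt_memLp hr) x
  rw [hxy] at h1
  filter_upwards [h1, mulOp_coe (wt_memLp hr) y] with ξ h2 h3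
  rw [h3] at h2
  exact (mul_left_cancel₀ (Complex.ofReal_ne_zero.2 (wt_pos r ξ).ne') h2).symm

/-- A Bochner integral in `H^s` of `H^σ`-valued functions is bounded in `H^σ` by the integral of
the `H^σ` norms, even where measurability into `H^σ` is not known. -/
theorem norm_le_of_mulOp_wt_eq_integral {r p q t C : ℝ} (hr : r ≤ 0) (hp : p < 1) (hq : q < 1)
    (ht : 0 < t) (hC : 0 ≤ C) {X : Lp ℂ 2 (volume : Measure ℝ)}
    {F : ℝ → Lp ℂ 2 (volume : Measure ℝ)} (hF : IntervalIntegrable F volume 0 t)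
    (hX : mulOp (fun ξ ↦ ((wt r ξ : ℝ) : ℂ)) X = ∫ t' in (0 : ℝ)..t, F t')
    (h : ∀ t' ∈ Ioo 0 t, ∃ G, F t' = mulOp (fun ξ ↦ ((wt r ξ : ℝ) : ℂ)) G ∧
      ‖G‖ ≤ C * ((t - t') ^ (-p) * t' ^ (-q))) :
    ‖X‖ ≤ C * (t ^ (1 - p - q) * betaConst p q) := by
  have hβ := betaConst_nonneg p q
  refine norm_le_of_inner_le (inner_mulOp_wt hr) (mulOp_wt_injective hr) (by positivity) fun Z ↦ ?_
  have e : ⟪Z, ∫ t' in (0 : ℝ)..t, F t'⟫_ℂ = ∫ t' in (0 : ℝ)..t, ⟪Z, F t'⟫_ℂ :=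
    ((innerSL ℂ Z).intervalIntegral_comp_comm hF).symm
  rw [inner_mulOp_wt hr, hX, e]
  refine (norm_integral_le_beta (C := ‖mulOp (fun ξ ↦ ((wt r ξ : ℝ) : ℂ)) Z‖ * C) hp hq ht
    fun t' ht' ↦ ?_).trans (le_of_eq (by ring))
  obtain ⟨G, hG, hGC⟩ := h t' ht'
  rw [hG, ← inner_mulOp_wt hr, mul_assoc]
  exact (norm_inner_le_norm _ _).trans (by gcongr)

/-! ### Uniqueness and the limit `β → 0` -/

/-- The size of the dispersive effect of the difference `b` of two values of `β` on the free
evolution of `Φ` over `[0,T]`. -/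
def freeGap (b T : ℝ) (Φ : Lp ℂ 2 (volume : Measure ℝ)) : ℝ :=
  ‖mulOp (fun ξ ↦ ((phaseGap b T ξ : ℝ) : ℂ)) Φ‖

theorem continuous_phaseGap (b T : ℝ) : Continuous (phaseGap b T) := by
  unfold phaseGap
  fun_prop

theorem phaseGap_nonneg {T : ℝ} (hT : 0 ≤ T) (b ξ : ℝ) : 0 ≤ phaseGap b T ξ :=
  le_min zero_le_two (by positivity)

theorem norm_phaseGap_le {T : ℝ} (hT : 0 ≤ T) (b ξ : ℝ) :
    ‖((phaseGap b T ξ : ℝ) : ℂ)‖ ≤ 2 := by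
  rw [Complex.norm_real, Real.norm_of_nonneg (phaseGap_nonneg hT b ξ)]
  exact min_le_left _ _

theorem measurable_phaseGap (b T : ℝ) : Measurable fun ξ ↦ ((phaseGap b T ξ : ℝ) : ℂ) :=
  (Complex.continuous_ofReal.comp (continuous_phaseGap b T)).measurable

theorem freeGap_zero (T : ℝ) (Φ : Lp ℂ 2 (volume : Measure ℝ)) : freeGap 0 T Φ = 0 := by
  have e : (fun ξ ↦ ((phaseGap 0 T ξ : ℝ) : ℂ)) = fun _ ↦ 0 := by
    ext ξ
    simp [phaseGap]
  rw [freeGap, e, mulOp_zero, norm_zero]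

theorem tendsto_freeGap {T : ℝ} (hT : 0 ≤ T) (Φ : Lp ℂ 2 (volume : Measure ℝ)) :
    Tendsto (fun b ↦ freeGap b T Φ) (𝓝 0) (𝓝 0) := by
  have h : Tendsto (fun b ↦ mulOp (fun ξ ↦ ((phaseGap b T ξ : ℝ) : ℂ)) Φ) (𝓝 0)
      (𝓝 (mulOp (fun ξ ↦ ((phaseGap 0 T ξ : ℝ) : ℂ)) Φ)) := by
    refine tendsto_mulOp (C := 2) (Eventually.of_forall fun b ↦ measurable_phaseGap b T)
      (measurable_phaseGap 0 T) (Eventually.of_forall fun b ↦ norm_phaseGap_le hT b)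
      (norm_phaseGap_le hT 0) (fun ξ ↦ ?_) Φ
    have hc : Continuous fun b ↦ ((phaseGap b T ξ : ℝ) : ℂ) := by
      unfold phaseGap
      fun_prop
    exact hc.tendsto 0
  have h2 := h.norm
  have h3 : ‖mulOp (fun ξ ↦ ((phaseGap 0 T ξ : ℝ) : ℂ)) Φ‖ = 0 := freeGap_zero T Φ
  rw [h3] at h2
  exact h2

/-- The difference of two free evolutions, measured with the smoothing weight `⟨ζ⟩^{2p}`. -/
theorem norm_mulOp_symbol_sub_le {η T t p : ℝ} (hη : 0 < η) (ht : t ∈ Ioc 0 T) (hp : 0 ≤ p)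
    (hp1 : p ≤ 1) (β β' : ℝ) (Φ : Lp ℂ 2 (volume : Measure ℝ)) :
    ‖mulOp (fun ξ ↦ ((wt (2 * p) ξ : ℝ) : ℂ) * symbol β η t ξ) Φ -
      mulOp (fun ξ ↦ ((wt (2 * p) ξ : ℝ) : ℂ) * symbol β' η t ξ) Φ‖ ≤
      smoothConst η T * t ^ (-p) * freeGap (β - β') T Φ := by
  have hT : 0 ≤ T := ht.1.le.trans ht.2
  have h1 := wt_symbol_memLp hη ht.1 hp hp1 β
  have h2 := wt_symbol_memLp hη ht.1 hp hp1 β'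
  rw [mulOp_sub h1 h2]
  refine norm_mulOp_le_mulOp (h1.sub h2)
    (memLp_top_of_norm_le (measurable_phaseGap _ T) (norm_phaseGap_le hT _)) (fun ξ ↦ ?_) Φ
  have h3 := norm_wt_symbol_le hη ht.1 ht.2 hp hp1 β' ξ
  have h4 := norm_symbol_sub_le ht.1.le η β β' ξ
  have h5 : phaseGap (β - β') t ξ ≤ phaseGap (β - β') T ξ := by
    unfold phaseGap
    gcongr
    exact ht.2
  have hw := (wt_pos (2 * p) ξ).le
  have hg := phaseGap_nonneg hT (β - β') ξ
  rw [norm_mul, Complex.norm_real, Real.norm_of_nonneg hw] at h3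
  simp only [Pi.sub_apply]
  rw [← mul_sub, norm_mul, Complex.norm_real, Complex.norm_real, Real.norm_of_nonneg hw,
    Real.norm_of_nonneg hg]
  calc _ ≤ wt (2 * p) ξ * (phaseGap (β - β') T ξ * ‖symbol β' η t ξ‖) := by
        gcongr
        exact h4.trans (by gcongr)
    _ = (wt (2 * p) ξ * ‖symbol β' η t ξ‖) * phaseGap (β - β') T ξ := by ring
    _ ≤ _ := by gcongr

/-- The difference of the Duhamel integrands of two curves, in terms of the weighted difference
`t'^a ‖V - V'‖`. -/
theorem norm_duhamel_diff_le_beta {σ η θ T a M₀ c δ t t' β β' : ℝ} (hσ : 0 ≤ σ) (hη : 0 < η)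
    (hθ : 0 ≤ θ) (hθ1 : θ ≤ 1 / 2) (hδ : 0 ≤ δ) {V V' : ℝ → Lp ℂ 2 (volume : Measure ℝ)}
    (ht : t ∈ Ioc 0 T) (ht' : t' ∈ Ioo 0 t) (hM : ‖V' t'‖ ≤ M₀ * t' ^ (-a))
    (hc : 2 * M₀ * (t' ^ a * ‖V t' - V' t'‖) + (t' ^ a * ‖V t' - V' t'‖) ^ 2 ≤
      c * (t - t') ^ (-δ)) :
    ‖duhamel hσ β η θ (t - t') (V t') (V t') - duhamel hσ β' η θ (t - t') (V' t') (V' t')‖ ≤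
      bilinConst η σ T * (c + |β - β'| * M₀ ^ 2 * T ^ δ) *
        ((t - t') ^ (-(3 / 4 - θ + δ)) * t' ^ (-(2 * a))) := by
  have hτ : 0 < t - t' := sub_pos.2 ht'.2
  have hτT : t - t' ≤ T := by linarith [ht'.1, ht.2]
  have hT : 0 < T := ht.1.trans_le ht.2
  have hK := bilinConst_pos hη σ T
  have hpos : 0 < t' ^ (-a) := Real.rpow_pos_of_pos ht'.1 _
  have hpos' : 0 < (t - t') ^ (-(3 / 4 - θ)) := Real.rpow_pos_of_pos hτ _
  set d := t' ^ a * ‖V t' - V' t'‖ with hd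
  have hd0 : 0 ≤ d := mul_nonneg (Real.rpow_nonneg ht'.1.le _) (norm_nonneg _)
  have hD : ‖V t' - V' t'‖ = t' ^ (-a) * d := by
    rw [hd, ← mul_assoc, ← Real.rpow_add ht'.1, neg_add_cancel, Real.rpow_zero, one_mul]
  have h2a : t' ^ (-(2 * a)) = t' ^ (-a) * t' ^ (-a) := by
    rw [← Real.rpow_add ht'.1]
    congr 1
    ring
  have hδT : 1 ≤ T ^ δ * (t - t') ^ (-δ) := by
    rw [Real.rpow_neg hτ.le, ← div_eq_mul_inv, ← Real.div_rpow hT.le hτ.le]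
    exact Real.one_le_rpow ((one_le_div hτ).2 hτT) hδ
  refine (norm_duhamel_diff_le hσ hη hτ hτT hθ hθ1 β β' (V t') (V' t')).trans ?_
  calc _ ≤ bilinConst η σ T * (t - t') ^ (-(3 / 4 - θ)) *
        (2 * (M₀ * t' ^ (-a)) * (t' ^ (-a) * d) + (t' ^ (-a) * d) ^ 2 +
          |β - β'| * (M₀ * t' ^ (-a)) ^ 2) := by
        rw [hD]
        gcongr
    _ = bilinConst η σ T * (t - t') ^ (-(3 / 4 - θ)) * (t' ^ (-a) * t' ^ (-a)) *
        ((2 * M₀ * d + d ^ 2) + |β - β'| * M₀ ^ 2 * 1) := by ring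
    _ ≤ bilinConst η σ T * (t - t') ^ (-(3 / 4 - θ)) * (t' ^ (-a) * t' ^ (-a)) *
        (c * (t - t') ^ (-δ) + |β - β'| * M₀ ^ 2 * (T ^ δ * (t - t') ^ (-δ))) := by gcongr
    _ = bilinConst η σ T * (c + |β - β'| * M₀ ^ 2 * T ^ δ) *
        ((t - t') ^ (-(3 / 4 - θ)) * (t - t') ^ (-δ) * (t' ^ (-a) * t' ^ (-a))) := by ring
    _ = _ := by
        rw [← h2a, ← Real.rpow_add hτ]
        congr 4
        ring

/-- The constant of the Duhamel estimate with the kernel `(t - t')^{-(3/4 - θ + δ)} t'^{-2a}`. -/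
def stabConst (η σ T a δ θ : ℝ) : ℝ :=
  bilinConst η σ T * (T ^ (1 / 4 - a - δ) * betaConst (3 / 4 - θ + δ) (2 * a))

theorem stabConst_nonneg {η T : ℝ} (hη : 0 < η) (hT : 0 ≤ T) (σ a δ θ : ℝ) :
    0 ≤ stabConst η σ T a δ θ := by
  have h1 := bilinConst_pos hη σ T
  have h2 := betaConst_nonneg (3 / 4 - θ + δ) (2 * a)
  unfold stabConst
  positivity

/-- The equation for the difference of two mild solutions. -/
theorem IsMild.sub_eq {σ β β' η a T : ℝ} {hσ : 0 ≤ σ} {Φ : Lp ℂ 2 (volume : Measure ℝ)}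
    {U V U' V' : ℝ → Lp ℂ 2 (volume : Measure ℝ)} (h : IsMild hσ β η a T Φ U V)
    (h' : IsMild hσ β' η a T Φ U' V') {t : ℝ} (ht : t ∈ Ioc 0 T) :
    U t - U' t = (mulOp (symbol β η t) Φ - mulOp (symbol β' η t) Φ) -
      ∫ t' in (0 : ℝ)..t, (duhamel hσ β η a (t - t') (V t') (V t') -
        duhamel hσ β' η a (t - t') (V' t') (V' t')) := by
  rw [h.eq t ht, h'.eq t ht,
    intervalIntegral.integral_sub (h.integrable t ht) (h'.integrable t ht)]
  abel

/-- The difference of two mild solutions in `H^s`. The number `c` bounds the part of the integrand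
that depends on `V - V'`, with a singularity `(t - t')^{-δ}` on top of that of the kernel. -/
theorem IsMild.norm_sub_le {σ β β' η a T M₀ c δ : ℝ} {hσ : 0 ≤ σ} (hη : 0 < η) (ha : 0 ≤ a)
    (hδ : 0 ≤ δ) (hδa : δ < 1 / 4 - a)
    {Φ : Lp ℂ 2 (volume : Measure ℝ)} {U V U' V' : ℝ → Lp ℂ 2 (volume : Measure ℝ)}
    (h : IsMild hσ β η a T Φ U V) (h' : IsMild hσ β' η a T Φ U' V')
    (hM : ∀ t ∈ Ioc 0 T, ‖V' t‖ ≤ M₀ * t ^ (-a)) {t : ℝ} (ht : t ∈ Ioc 0 T) (hc0 : 0 ≤ c)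
    (hc : ∀ t' ∈ Ioo 0 t, 2 * M₀ * (t' ^ a * ‖V t' - V' t'‖) + (t' ^ a * ‖V t' - V' t'‖) ^ 2 ≤
      c * (t - t') ^ (-δ)) :
    ‖U t - U' t‖ ≤ smoothConst η T * freeGap (β - β') T Φ +
      stabConst η σ T a δ a * (c + |β - β'| * M₀ ^ 2 * T ^ δ) := by
  have hT : 0 < T := ht.1.trans_le ht.2
  have hK := bilinConst_pos hη σ T
  have hβ := betaConst_nonneg (3 / 4 - a + δ) (2 * a)
  rw [h.sub_eq h' ht]
  refine (norm_sub_le_of_le ?_ (norm_integral_le_beta (by linarith) (by linarith) ht.1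
    fun t' ht' ↦ norm_duhamel_diff_le_beta hσ hη ha (by linarith) hδ ht ht'
      (hM t' ⟨ht'.1, ht'.2.le.trans ht.2⟩) (hc t' ht'))).trans (add_le_add le_rfl ?_)
  · have h1 := norm_mulOp_symbol_sub_le hη ht le_rfl zero_le_one β β' Φ
    simpa only [mul_zero, wt_zero, Complex.ofReal_one, one_mul, neg_zero, Real.rpow_zero,
      mul_one] using h1
  · rw [show 1 - (3 / 4 - a + δ) - 2 * a = 1 / 4 - a - δ by ring, stabConst]
    calc _ = bilinConst η σ T * (t ^ (1 / 4 - a - δ) * betaConst (3 / 4 - a + δ) (2 * a)) *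
          (c + |β - β'| * M₀ ^ 2 * T ^ δ) := by ring
      _ ≤ _ := by
          gcongr
          · exact ht.1.le
          · exact ht.2

/-- The difference of two mild solutions in `H^σ`, with the weight `t^a`. -/
theorem IsMild.weighted_norm_sub_le {σ β β' η a T M₀ c δ : ℝ} {hσ : 0 ≤ σ} (hη : 0 < η)
    (ha : 0 ≤ a) (hδ : 0 ≤ δ) (hδa : δ < 1 / 4 - a)
    {Φ : Lp ℂ 2 (volume : Measure ℝ)} {U V U' V' : ℝ → Lp ℂ 2 (volume : Measure ℝ)}
    (h : IsMild hσ β η a T Φ U V) (h' : IsMild hσ β' η a T Φ U' V')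
    (hM : ∀ t ∈ Ioc 0 T, ‖V' t‖ ≤ M₀ * t ^ (-a)) {t : ℝ} (ht : t ∈ Ioc 0 T) (hc0 : 0 ≤ c)
    (hc : ∀ t' ∈ Ioo 0 t, 2 * M₀ * (t' ^ a * ‖V t' - V' t'‖) + (t' ^ a * ‖V t' - V' t'‖) ^ 2 ≤
      c * (t - t') ^ (-δ)) :
    t ^ a * ‖V t - V' t‖ ≤ smoothConst η T * freeGap (β - β') T Φ +
      stabConst η σ T a δ 0 * (c + |β - β'| * M₀ ^ 2 * T ^ δ) := by
  have hT : 0 < T := ht.1.trans_le ht.2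
  have hK := bilinConst_pos hη σ T
  have hta : 0 < t ^ a := Real.rpow_pos_of_pos ht.1 _
  have hβ := betaConst_nonneg (3 / 4 - 0 + δ) (2 * a)
  set L := mulOp (fun ξ ↦ ((wt (2 * a) ξ : ℝ) : ℂ) * symbol β η t ξ) Φ -
    mulOp (fun ξ ↦ ((wt (2 * a) ξ : ℝ) : ℂ) * symbol β' η t ξ) Φ with hL
  have hr : -(2 * a) ≤ 0 := by linarith
  have hX : mulOp (fun ξ ↦ ((wt (-(2 * a)) ξ : ℝ) : ℂ)) (L - (V t - V' t)) =
      ∫ t' in (0 : ℝ)..t, (duhamel hσ β η a (t - t') (V t') (V t') -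
        duhamel hσ β' η a (t - t') (V' t') (V' t')) := by
    have h1 := h.sub_eq h' ht
    rw [h.weight t ht, h'.weight t ht] at h1
    rw [map_sub, map_sub _ (V t), h1, hL, map_sub,
      mulOp_wt_neg_mulOp (by linarith) (symbol_memLp hη ht.1.le β)
        (wt_symbol_memLp hη ht.1 ha (by linarith) β),
      mulOp_wt_neg_mulOp (by linarith) (symbol_memLp hη ht.1.le β')
        (wt_symbol_memLp hη ht.1 ha (by linarith) β')]
    abel
  have h2 := norm_le_of_mulOp_wt_eq_integral (p := 3 / 4 - 0 + δ) (q := 2 * a)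
    (C := bilinConst η σ T * (c + |β - β'| * M₀ ^ 2 * T ^ δ)) hr (by linarith) (by linarith) ht.1
    (by positivity) ((h.integrable t ht).sub (h'.integrable t ht)) hX fun t' ht' ↦ ⟨_, by
      have hτ := sub_pos.2 ht'.2
      rw [← mulOp_wt_duhamel hσ hη hτ ha (by linarith) β,
        ← mulOp_wt_duhamel hσ hη hτ ha (by linarith) β', ← map_sub],
      norm_duhamel_diff_le_beta hσ hη le_rfl (by norm_num) hδ ht ht'
        (hM t' ⟨ht'.1, ht'.2.le.trans ht.2⟩) (hc t' ht')⟩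
  have h3 : ‖L‖ ≤ smoothConst η T * t ^ (-a) * freeGap (β - β') T Φ :=
    norm_mulOp_symbol_sub_le hη ht ha (by linarith) β β' Φ
  have h4 : ‖V t - V' t‖ ≤ ‖L‖ + ‖L - (V t - V' t)‖ := by
    have h5 := _root_.norm_sub_le L (L - (V t - V' t))
    rwa [sub_sub_cancel] at h5
  have e1 : t ^ a * t ^ (-a) = 1 := by
    rw [← Real.rpow_add ht.1, add_neg_cancel, Real.rpow_zero]
  have e2 : t ^ a * t ^ (1 - (3 / 4 - 0 + δ) - 2 * a) = t ^ (1 / 4 - a - δ) := by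
    rw [← Real.rpow_add ht.1]
    congr 1
    ring
  calc t ^ a * ‖V t - V' t‖
      ≤ t ^ a * (smoothConst η T * t ^ (-a) * freeGap (β - β') T Φ +
          bilinConst η σ T * (c + |β - β'| * M₀ ^ 2 * T ^ δ) *
            (t ^ (1 - (3 / 4 - 0 + δ) - 2 * a) * betaConst (3 / 4 - 0 + δ) (2 * a))) := by
        gcongr
        linarith
    _ = (t ^ a * t ^ (-a)) * (smoothConst η T * freeGap (β - β') T Φ) +
          bilinConst η σ T * ((t ^ a * t ^ (1 - (3 / 4 - 0 + δ) - 2 * a)) *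
            betaConst (3 / 4 - 0 + δ) (2 * a)) * (c + |β - β'| * M₀ ^ 2 * T ^ δ) := by ring
    _ ≤ _ := by
        rw [e1, e2, one_mul, stabConst]
        gcongr
        · exact ht.1.le
        · exact ht.2

/-- Stability: the distance in `H^s` of two mild solutions with the same datum is controlled by
the distance of their dispersion parameters. The constant `A` depends on the second solution only
through its weighted bound `M₀`, and not at all on the first. -/
theorem exists_stability_const {σ η a T M₀ : ℝ} (hσ : 0 ≤ σ) (hη : 0 < η) (ha : 0 ≤ a)
    (ha' : a < 1 / 4) (hT : 0 < T) (hM₀ : 0 ≤ M₀) : ∃ A : ℝ, 0 < A ∧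
    ∀ (β β' : ℝ) (Φ : Lp ℂ 2 (volume : Measure ℝ)) (U V U' V' : ℝ → Lp ℂ 2 (volume : Measure ℝ)),
      IsMild hσ β η a T Φ U V → IsMild hσ β' η a T Φ U' V' →
      (∃ M, ∀ t ∈ Ioc 0 T, ‖V t‖ ≤ M * t ^ (-a)) →
      (∀ t ∈ Ioc 0 T, ‖V' t‖ ≤ M₀ * t ^ (-a)) →
      ∀ ρ, 0 < ρ → A * ρ ≤ 1 → A * (freeGap (β - β') T Φ + |β - β'|) ≤ ρ →
        ∀ t ∈ Ioc 0 T, ‖U t - U' t‖ ≤ A * ρ := by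
  -- half of the available power of time is spent on the singular kernel of the Gronwall argument
  set δ := (1 / 4 - a) / 2 with hδ
  have hδ0 : 0 < δ := by linarith
  have hδa : δ < 1 / 4 - a := by linarith
  set κ := stabConst η σ T a δ 0 with hκ
  set κ' := stabConst η σ T a δ a with hκ'
  have hκ0 : 0 ≤ κ := stabConst_nonneg hη hT.le σ a δ 0
  have hκ'0 : 0 ≤ κ' := stabConst_nonneg hη hT.le σ a δ a
  have hS := smoothConst_pos hη T
  have hTδ : 0 < T ^ δ := Real.rpow_pos_of_pos hT _
  obtain ⟨l, hl0, hl⟩ : ∃ l : ℝ, 0 < l ∧ κ * (2 * M₀ + 1) * l ^ (-δ) ≤ 1 / 2 := by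
    set x := κ * (2 * M₀ + 1) with hx
    have hx0 : 0 ≤ x := by positivity
    refine ⟨(2 * (x + 1)) ^ δ⁻¹, by positivity, ?_⟩
    rw [← Real.rpow_mul (by positivity), mul_neg, inv_mul_cancel₀ hδ0.ne', Real.rpow_neg_one,
      ← div_eq_mul_inv, div_le_iff₀ (by positivity)]
    linarith
  set e := Real.exp (l * T) with he
  have he1 : 1 ≤ e := Real.one_le_exp (mul_pos hl0 hT).le
  set C := smoothConst η T + (κ + κ') * (M₀ ^ 2 * T ^ δ) with hC
  set D := κ' * ((2 * M₀ + 1) * e * T ^ δ) with hD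
  have hC0 : 0 < C := by positivity
  have hD0 : 0 ≤ D := by positivity
  refine ⟨e + 4 * C + D, by positivity, ?_⟩
  rintro β β' Φ U V U' V' h h' ⟨M, hM⟩ hM' ρ hρ hρ1 hgap
  set gap := freeGap (β - β') T Φ with hgapdef
  have hgap0 : 0 ≤ gap := norm_nonneg _
  have hb0 := abs_nonneg (β - β')
  have hCgap : C * (gap + |β - β'|) ≤ ρ / 4 := by
    have : 4 * C * (gap + |β - β'|) ≤ (e + 4 * C + D) * (gap + |β - β'|) := by
      gcongr
      linarith
    linarith
  have herr : ∀ k, 0 ≤ k → k ≤ κ + κ' →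
      smoothConst η T * gap + k * (|β - β'| * M₀ ^ 2 * T ^ δ) ≤ ρ / 4 := by
    intro k hk0 hk
    refine le_trans ?_ hCgap
    have h1 : k * (|β - β'| * M₀ ^ 2 * T ^ δ) ≤ (κ + κ') * (M₀ ^ 2 * T ^ δ) * |β - β'| := by
      calc _ = k * ((M₀ ^ 2 * T ^ δ) * |β - β'|) := by ring
        _ ≤ (κ + κ') * ((M₀ ^ 2 * T ^ δ) * |β - β'|) := by gcongr
        _ = _ := by ring
    have h2 : 0 ≤ (κ + κ') * (M₀ ^ 2 * T ^ δ) * gap := by positivity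
    have h3 : 0 ≤ smoothConst η T * |β - β'| := by positivity
    rw [hC]
    linarith
  have hρe : ρ * e ≤ 1 := by
    refine le_trans ?_ hρ1
    rw [mul_comm]
    gcongr
    linarith
  have hf0 : ∀ t ∈ Ioc 0 T, 0 ≤ t ^ a * ‖V t - V' t‖ := fun t ht ↦
    mul_nonneg (Real.rpow_nonneg ht.1.le _) (norm_nonneg _)
  have hfM : ∀ t ∈ Ioc 0 T, t ^ a * ‖V t - V' t‖ ≤ |M| + M₀ := by
    intro t ht
    have h1 : 0 < t ^ a := Real.rpow_pos_of_pos ht.1 _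
    have h2 : t ^ a * t ^ (-a) = 1 := by
      rw [← Real.rpow_add ht.1, add_neg_cancel, Real.rpow_zero]
    calc _ ≤ t ^ a * (M * t ^ (-a) + M₀ * t ^ (-a)) := by
          gcongr
          exact norm_sub_le_of_le (hM t ht) (hM' t ht)
      _ = (t ^ a * t ^ (-a)) * (M + M₀) := by ring
      _ ≤ _ := by
          rw [h2, one_mul]
          linarith [le_abs_self M]
  have hgr := singular_gronwall (f := fun t ↦ t ^ a * ‖V t - V' t‖) (M₀ := M₀)
    (ε := smoothConst η T * gap + κ * (|β - β'| * M₀ ^ 2 * T ^ δ)) hδ0 (by linarith) hκ0 hM₀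
    (by positivity : 0 ≤ |M| + M₀) hρ hl0 hf0 hfM
    (fun t ht c hc0 hc ↦ by
      have := h.weighted_norm_sub_le hη ha hδ0.le hδa h' hM' ht hc0 hc
      linarith) hl hρe (herr κ hκ0 (by linarith))
  intro t ht
  have hfin := h.norm_sub_le hη ha hδ0.le hδa h' hM' ht
    (c := (2 * M₀ + 1) * (ρ * e) * T ^ δ) (by positivity) fun t' ht' ↦ by
      have ht'T : t' ∈ Ioc 0 T := ⟨ht'.1, ht'.2.le.trans ht.2⟩
      have hτ : 0 < t - t' := sub_pos.2 ht'.2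
      have h0 := hf0 t' ht'T
      have h1 : t' ^ a * ‖V t' - V' t'‖ ≤ ρ * e := by
        refine (hgr t' ht'T).trans ?_
        have := mul_le_mul_of_nonneg_left ht'T.2 hl0.le
        gcongr
        exact Real.exp_le_exp.2 this
      have h2 : 1 ≤ T ^ δ * (t - t') ^ (-δ) := by
        rw [Real.rpow_neg hτ.le, ← div_eq_mul_inv, ← Real.div_rpow hT.le hτ.le]
        exact Real.one_le_rpow ((one_le_div hτ).2 (by linarith [ht'.1, ht.2])) hδ0.le
      calc _ ≤ (2 * M₀ + 1) * (ρ * e) * 1 := by nlinarith [mul_le_mul_of_nonneg_left h1 hM₀]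
        _ ≤ (2 * M₀ + 1) * (ρ * e) * (T ^ δ * (t - t') ^ (-δ)) := by gcongr
        _ = _ := by ring
  calc _ ≤ smoothConst η T * gap + κ' * ((2 * M₀ + 1) * (ρ * e) * T ^ δ +
        |β - β'| * M₀ ^ 2 * T ^ δ) := hfin
    _ = (smoothConst η T * gap + κ' * (|β - β'| * M₀ ^ 2 * T ^ δ)) + D * ρ := by
        rw [hD]
        ring
    _ ≤ ρ / 4 + D * ρ := by
        gcongr
        exact herr κ' hκ'0 (by linarith)
    _ ≤ (e + 4 * C + D) * ρ := by nlinarith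

/-- Stability in `H^s` on the closed interval: solutions for `β` near `β'` are near the solution
for `β'`. -/
theorem IsSolution.exists_stability_const {s σ a η T β' : ℝ} (hs : s = σ - 2 * a) (hσ : 0 ≤ σ)
    (ha : 0 ≤ a) (ha' : a < 1 / 4) (hσa : σ = 0 ∨ a = 0) (hη : 0 < η) (hT : 0 < T) {φ : Hs s}
    {v : ℝ → Hs s} (hv : IsSolution β' η s T φ v) : ∃ A : ℝ, 0 < A ∧
    ∀ (β : ℝ) (u : ℝ → Hs s), IsSolution β η s T φ u → ∀ ρ, 0 < ρ → A * ρ ≤ 1 →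
      A * (freeGap (β - β') T (freq s φ) + |β - β'|) ≤ ρ →
        ∀ t ∈ Icc 0 T, ‖u t - v t‖ ≤ A * ρ := by
  obtain ⟨V', hV', M₀, hM₀⟩ := hv.exists_isMild hs hσ ha (by linarith) hσa hη
  obtain ⟨A, hA, hstab⟩ := ChenLee.exists_stability_const hσ hη ha ha' hT (abs_nonneg M₀)
  refine ⟨A, hA, fun β u hu ρ hρ hρ1 hgap t ht ↦ ?_⟩
  rcases ht.1.eq_or_lt with h0 | h0
  · rw [← h0, hu.apply_zero hη hT.le, hv.apply_zero hη hT.le, sub_self, norm_zero]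
    positivity
  · obtain ⟨V, hV, hM⟩ := hu.exists_isMild hs hσ ha (by linarith) hσa hη
    have h1 := hstab β β' (freq s φ) _ V _ V' hV hV' hM (fun t ht ↦ (hM₀ t ht).trans (by
      have := Real.rpow_pos_of_pos ht.1 (-a)
      gcongr
      exact le_abs_self M₀)) ρ hρ hρ1 hgap t ⟨h0, ht.2⟩
    rwa [← map_sub, LinearIsometryEquiv.norm_map] at h1

theorem IsSolution.eqOn {s σ a η T β : ℝ} (hs : s = σ - 2 * a) (hσ : 0 ≤ σ)
    (ha : 0 ≤ a) (ha' : a < 1 / 4) (hσa : σ = 0 ∨ a = 0) (hη : 0 < η) (hT : 0 < T) {φ : Hs s}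
    {u v : ℝ → Hs s} (hu : IsSolution β η s T φ u) (hv : IsSolution β η s T φ v) :
    EqOn u v (Icc 0 T) := by
  obtain ⟨A, hA, hstab⟩ := hv.exists_stability_const hs hσ ha ha' hσa hη hT
  intro t ht
  rw [← sub_eq_zero, ← norm_le_zero_iff]
  refine le_of_forall_pos_le_add fun e he ↦ ?_
  rw [zero_add]
  have hρ : 0 < min e 1 / A := div_pos (lt_min he one_pos) hA
  have h1 : A * (min e 1 / A) = min e 1 := mul_div_cancel₀ _ hA.ne'
  have h2 := hstab β u hu (min e 1 / A) hρ (h1.trans_le (min_le_right _ _))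
    (by rw [sub_self, freeGap_zero, abs_zero, add_zero, mul_zero]; exact hρ.le) t ht
  rw [h1] at h2
  exact h2.trans (min_le_left _ _)

/-- The error `freeGap β T φ + |β|` of the stability estimate tends to zero with `β`, and the other
solution, for `β' = 0`, is fixed; hence so is the constant. -/
theorem tendsto_iSup_enorm_sub {s σ a η T : ℝ} (hs : s = σ - 2 * a) (hσ : 0 ≤ σ)
    (ha : 0 ≤ a) (ha' : a < 1 / 4) (hσa : σ = 0 ∨ a = 0) (hη : 0 < η) (hT : 0 < T) {φ : Hs s}
    {u : ℝ → ℝ → Hs s} (hu : ∀ β : ℝ, 0 ≤ β → IsSolution β η s T φ (u β)) :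
    Tendsto (fun β : ℝ ↦ ⨆ t ∈ Icc (0 : ℝ) T, ‖u β t - u 0 t‖ₑ) (𝓝[>] 0) (𝓝 0) := by
  obtain ⟨A, hA, hstab⟩ := (hu 0 le_rfl).exists_stability_const hs hσ ha ha' hσa hη hT
  have hlim : Tendsto (fun β : ℝ ↦ A * (freeGap β T (freq s φ) + |β|)) (𝓝[>] 0) (𝓝 0) := by
    have h1 : Tendsto (fun β : ℝ ↦ |β|) (𝓝 0) (𝓝 0) := by
      simpa using (continuous_abs (G := ℝ)).tendsto 0
    have h2 := ((tendsto_freeGap hT.le (freq s φ)).add h1).const_mul A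
    rw [add_zero, mul_zero] at h2
    exact h2.mono_left nhdsWithin_le_nhds
  rw [ENNReal.tendsto_nhds_zero]
  intro e he
  obtain ⟨r, hr0, hr⟩ : ∃ r : ℝ, 0 < r ∧ ENNReal.ofReal r ≤ e := by
    obtain ⟨r, hr0, hr⟩ := ENNReal.lt_iff_exists_real_btwn.1 he
    exact ⟨r, ENNReal.ofReal_pos.1 hr.1, hr.2.le⟩
  have hρ : 0 < min r 1 / A := div_pos (lt_min hr0 one_pos) hA
  have h1 : A * (min r 1 / A) = min r 1 := mul_div_cancel₀ _ hA.ne'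
  filter_upwards [hlim.eventually_le_const hρ, self_mem_nhdsWithin] with β hβ hβ0
  refine iSup₂_le fun t ht ↦ ?_
  have h2 := hstab β (u β) (hu β (le_of_lt hβ0)) (min r 1 / A) hρ (h1.trans_le (min_le_right _ _))
    (by rwa [sub_zero]) t ht
  rw [h1] at h2
  rw [← ofReal_norm]
  exact (ENNReal.ofReal_le_ofReal (h2.trans (min_le_left _ _))).trans hr

end ChenLee

end

theorem mainTheorem4 (η : ℝ) (hη : 0 < η) (s : ℝ) (hs : -1 / 2 < s) :
    (∀ R : ℝ, ∃ T : ℝ, 0 < T ∧ ∀ φ : ChenLee.Hs s, ‖φ‖ ≤ R → ∀ β : ℝ, 0 ≤ β →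
      ∃ u : ℝ → ChenLee.Hs s, ChenLee.IsSolution β η s T φ u) ∧
    (∀ (T : ℝ) (φ : ChenLee.Hs s) (β : ℝ), 0 < T → 0 ≤ β →
      ∀ u v : ℝ → ChenLee.Hs s, ChenLee.IsSolution β η s T φ u →
        ChenLee.IsSolution β η s T φ v → Set.EqOn u v (Set.Icc 0 T)) ∧
    (∀ (T : ℝ) (φ : ChenLee.Hs s) (u : ℝ → ℝ → ChenLee.Hs s), 0 < T →
      (∀ β : ℝ, 0 ≤ β → ChenLee.IsSolution β η s T φ (u β)) →
        Filter.Tendsto (fun β : ℝ ↦ ⨆ t ∈ Set.Icc (0 : ℝ) T, ‖u β t - u 0 t‖ₑ)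
          (nhdsWithin 0 (Set.Ioi 0)) (nhds 0)) := by
  -- the auxiliary space `H^σ` has `σ = max s 0`, and the blow-up rate is `a = (σ - s) / 2`
  obtain ⟨σ, a, hsa, hσ, ha, ha', hσa⟩ : ∃ σ a : ℝ, s = σ - 2 * a ∧ 0 ≤ σ ∧ 0 ≤ a ∧ a < 1 / 4 ∧
      (σ = 0 ∨ a = 0) := by
    rcases le_total 0 s with h | h
    · exact ⟨s, 0, by ring, h, le_rfl, by norm_num, Or.inr rfl⟩
    · exact ⟨0, -s / 2, by ring, le_rfl, by linarith, by linarith, Or.inl rfl⟩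
  refine ⟨fun R ↦ ?_, fun T φ β hT _ u v hu hv ↦ ?_, fun T φ u hT hu ↦ ?_⟩
  · obtain ⟨T, hT, h⟩ := ChenLee.exists_isSolution hsa hσ ha ha' hσa hη R
    exact ⟨T, hT, fun φ hφ β _ ↦ h φ hφ β⟩
  · exact hu.eqOn hsa hσ ha ha' hσa hη hT hv
  · exact ChenLee.tendsto_iSup_enorm_sub hsa hσ ha ha' hσa hη hT hu
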